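/- Let $k$ be an algebraically closed field of characteristic $0$, let $A$ be a finitely generated commutative $k$-algebra, $X=\operatorname{Spec}A$, and let $\mathfrak g$ be a finite-dimensional reductive Lie algebra over $k$. Let $\Gamma$ be a finite abelian group acting on $A$ (hence on $X$) by $k$-algebra automorphisms and on $\mathfrak g$ by Lie algebra automorphisms. Let $\mathfrak M=(\mathfrak g\otimes_k A)^\Gamma$ be the associated equivariant map algebra (fixed points of the diagonal action). Let $x$ be a rational point of $X$ with maximal ideal $\mathfrak m_x$, isotropy group $\Gamma_x$ and $\mathfrak g^x=\{u\in\mathfrak g:\gamma u=u\ \forall\gamma\in\Gamma_x\}$; evaluation at $x$ is a surjective homomorphism $\operatorname{ev}_x:\mathfrak M\to\mathfrak g^x$. Through it every finite-dimensional $\mathfrak g^x$-module $V$ is regarded as an $\mathfrak M$-module, called an evaluation module at $x$. (Every evaluation module at another point of the orbit $\Gamma\cdot x$ is also of this form.) $\operatorname{Ext}^1_{\mathfrak M}$ denotes the space of extensions of $\mathfrak M$-modules. Put $\mathfrak K_x=\ker\operatorname{ev}_x$, $\mathfrak K_x'=[\mathfrak K_x,\mathfrak K_x]$, $I=\bigcap_{y\in\Gamma\cdot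 x}\mathfrak m_y$ and $\mathfrak Q_x=(\mathfrak g\otimes I^2)^\Gamma$; then $\mathfrak K_x'\subseteq\mathfrak Q_x\subseteq\mathfrak K_x$ are ideals of $\mathfrak M$, and $\mathfrak g^x\cong\mathfrak M/\mathfrak K_x$ acts on $\mathfrak Q_x/\mathfrak K_x'$ through the adjoint representation. Let $\Xi$ be the character group of $\Gamma$, written additively, and $\Xi_x=\{\xi\in\Xi:\xi|_{\Gamma_x}=0\}$. For a representation $W$ of $\Gamma$ let $W_\xi$ be its isotypic component of type $\xi\in\Xi$, and for $\omega\in\Xi/\Xi_x$ let $\mathfrak g_\omega=\bigoplus_{\xi\in\omega}\mathfrak g_\xi$, a $\mathfrak g^x$-submodule of $\mathfrak g$. (a) Suppose that $\mathfrak g^x$ is semisimple. Let $V_1,V_2$ be irreducible finite-dimensional $\mathfrak g^x$-modules, regarded as evaluation modules at $x$, and for each $\omega\in\Xi/\Xi_x$ let $a_\omega\in\omega$ be any representative. Then, as $k$-vector spaces, $$\operatorname{Ext}^1_{\mathfrak M}(V_1,V_2)\;\cong\;\operatorname{Hom}_{\mathfrak g^x}(\mathfrak Q_x/\mathfrak K_x',\,V_1^*\otimes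 V_2)\;\oplus\;\bigoplus_{\omega\in\Xi/\Xi_x}\operatorname{Hom}_{\mathfrak g^x}(\mathfrak g_\omega,\,V_1^*\otimes V_2)\otimes\big((I/I^2)_{-a_\omega}\big)^*.$$ (b) Suppose that $\Gamma$ acts freely on the set of rational points of $X$ and that $\mathfrak g$ is semisimple. Then $\mathfrak g^x=\mathfrak g$, and for any two finite-dimensional $\mathfrak g$-modules $V_1,V_2$, regarded as evaluation modules at $x$, as $k$-vector spaces, $$\operatorname{Ext}^1_{\mathfrak M}(V_1,V_2)\;\cong\;\operatorname{Hom}_{\mathfrak g}(\mathfrak g,\,V_1^*\otimes V_2)\otimes(\mathfrak m_x/\mathfrak m_x^2)^*.$$ -/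

import Mathlib

open TensorProduct CategoryTheory
open scoped DirectSum

universe u

noncomputable section

namespace EquivMap

/-! ### Group actions by automorphisms

A group `Γ` acts on the commutative `k`-algebra `A` by algebra automorphisms through
`[MulSemiringAction Γ A] [SMulCommClass Γ k A]`, and on the Lie algebra `𝔤` by Lie algebra
automorphisms through `[DistribMulAction Γ 𝔤] [SMulCommClass Γ k 𝔤] [IsLieAction Γ 𝔤]`. -/

/-- The action of `Γ` on `𝔤` preserves Lie brackets. -/
class IsLieAction (Γ 𝔤 : Type*) [Group Γ] [LieRing 𝔤] [DistribMulAction Γ 𝔤] : Prop where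
  smul_lie' : ∀ (γ : Γ) (u v : 𝔤), γ • ⁅u, v⁆ = ⁅γ • u, γ • v⁆

section Defs

variable (k : Type u) [Field k]
variable {Γ : Type*} [CommGroup Γ]
variable {A : Type u} [CommRing A] [Algebra k A] [MulSemiringAction Γ A] [SMulCommClass Γ k A]
variable (𝔤 : Type u) [LieRing 𝔤] [LieAlgebra k 𝔤] [DistribMulAction Γ 𝔤] [SMulCommClass Γ k 𝔤]

/-! ### The equivariant map algebra

The regular maps `X → 𝔤` on `X = Spec A` form the Lie algebra `A ⊗[k] 𝔤`, with bracket
`⁅a ⊗ u, b ⊗ v⁆ = ab ⊗ ⁅u, v⁆`. -/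

/-- The diagonal action of `γ` on `A ⊗ 𝔤`. -/
def diag (A : Type u) [CommRing A] [Algebra k A] [MulSemiringAction Γ A] [SMulCommClass Γ k A]
    (γ : Γ) : A ⊗[k] 𝔤 →ₗ[k] A ⊗[k] 𝔤 :=
  TensorProduct.map (DistribSMul.toLinearMap k A γ) (DistribSMul.toLinearMap k 𝔤 γ)

variable {k 𝔤} in
@[simp] lemma diag_tmul (γ : Γ) (a : A) (u : 𝔤) :
    diag k 𝔤 A γ (a ⊗ₜ u) = (γ • a) ⊗ₜ[k] (γ • u) := rfl

variable {k 𝔤} in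
lemma diag_lie [IsLieAction Γ 𝔤] (γ : Γ) (α β : A ⊗[k] 𝔤) :
    diag k 𝔤 A γ ⁅α, β⁆ = ⁅diag k 𝔤 A γ α, diag k 𝔤 A γ β⁆ := by
  induction α using TensorProduct.induction_on with
  | zero => simp
  | add α₁ α₂ h₁ h₂ => simp only [add_lie, map_add, h₁, h₂]
  | tmul a u =>
    induction β using TensorProduct.induction_on with
    | zero => simp
    | add β₁ β₂ h₁ h₂ => simp only [lie_add, map_add, h₁, h₂]
    | tmul b v => simp [LieAlgebra.ExtendScalars.bracket_tmul, IsLieAction.smul_lie']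

variable (Γ) (A) in
/-- The equivariant map algebra `𝔐 = (𝔤 ⊗ A)^Γ`. -/
def mapAlgebra [IsLieAction Γ 𝔤] : LieSubalgebra k (A ⊗[k] 𝔤) where
  carrier := {α | ∀ γ : Γ, diag k 𝔤 A γ α = α}
  add_mem' ha hb γ := by rw [map_add, ha γ, hb γ]
  zero_mem' γ := map_zero _
  smul_mem' c α h γ := by rw [map_smul, h γ]
  lie_mem' ha hb γ := by rw [diag_lie, ha γ, hb γ]

variable {k}

/-! ### Rational points

A rational point of `X` is a `k`-algebra homomorphism `x : A →ₐ[k] k`, with maximal ideal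
`RingHom.ker x`. -/

/-- The translate `γ · x` of a point, i.e. `(γ · x)(a) = x(γ⁻¹ a)`. -/
def translate (γ : Γ) (x : A →ₐ[k] k) : A →ₐ[k] k :=
  x.comp (MulSemiringAction.toAlgHom k A γ⁻¹)

@[simp] lemma translate_apply (γ : Γ) (x : A →ₐ[k] k) (a : A) :
    translate γ x a = x (γ⁻¹ • a) := rfl

variable (Γ) in
/-- The isotropy group `Γ_x`. -/
def isotropy (x : A →ₐ[k] k) : Subgroup Γ where
  carrier := {γ | translate γ x = x}
  one_mem' := by ext a; simp
  mul_mem' {γ δ} hγ hδ := by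
    ext a
    have h₁ := DFunLike.congr_fun hγ a
    have h₂ := DFunLike.congr_fun hδ (γ⁻¹ • a)
    simp only [translate_apply] at h₁ h₂
    rw [translate_apply, mul_inv_rev, mul_smul, h₂, h₁]
  inv_mem' {γ} hγ := by
    ext a
    have h₁ := DFunLike.congr_fun hγ (γ • a)
    simpa using h₁.symm

lemma translate_mul (γ δ : Γ) (x : A →ₐ[k] k) :
    translate (γ * δ) x = translate γ (translate δ x) := by
  ext a
  rw [translate_apply, translate_apply, translate_apply, mul_inv_rev, mul_smul]

/-- `Γ` acts freely on (the set of rational points of) `X`. -/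
def ActsFreely (k : Type u) [Field k] (Γ : Type*) [CommGroup Γ]
    (A : Type u) [CommRing A] [Algebra k A] [MulSemiringAction Γ A] [SMulCommClass Γ k A] : Prop :=
  ∀ y : A →ₐ[k] k, isotropy Γ y = ⊥

variable [IsLieAction Γ 𝔤]

variable (Γ) in
/-- The subalgebra `𝔤^x` of elements of `𝔤` fixed by the isotropy group of `x`. -/
def fixedAt (x : A →ₐ[k] k) : LieSubalgebra k 𝔤 where
  carrier := {u | ∀ γ ∈ isotropy Γ x, γ • u = u}
  add_mem' ha hb γ hγ := by rw [smul_add, ha γ hγ, hb γ hγ]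
  zero_mem' γ _ := smul_zero _
  smul_mem' c u h γ hγ := by rw [smul_comm, h γ hγ]
  lie_mem' ha hb γ hγ := by rw [IsLieAction.smul_lie', ha γ hγ, hb γ hγ]

/-! ### Evaluation -/

/-- Evaluation of a regular map at `x`, i.e. `a ⊗ u ↦ a(x) u`. -/
def evalAt (𝔤 : Type u) [LieRing 𝔤] [LieAlgebra k 𝔤] (x : A →ₐ[k] k) : A ⊗[k] 𝔤 →ₗ⁅k⁆ 𝔤 where
  __ := TensorProduct.lift ((LinearMap.lsmul k 𝔤).comp x.toLinearMap)
  map_lie' {α β} := by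
    simp only [AddHom.toFun_eq_coe, LinearMap.coe_toAddHom]
    induction α using TensorProduct.induction_on with
    | zero => simp
    | add α₁ α₂ h₁ h₂ => simp only [add_lie, map_add, h₁, h₂]
    | tmul a u =>
      induction β using TensorProduct.induction_on with
      | zero => simp
      | add β₁ β₂ h₁ h₂ => simp only [lie_add, map_add, h₁, h₂]
      | tmul b v => simp [LieAlgebra.ExtendScalars.bracket_tmul, smul_smul, mul_comm]

@[simp] lemma evalAt_tmul (𝔤 : Type u) [LieRing 𝔤] [LieAlgebra k 𝔤] (x : A →ₐ[k] k) (a : A)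
    (u : 𝔤) : evalAt 𝔤 x (a ⊗ₜ u) = x a • u := rfl

lemma evalAt_diag (𝔤 : Type u) [LieRing 𝔤] [LieAlgebra k 𝔤] [DistribMulAction Γ 𝔤]
    [SMulCommClass Γ k 𝔤] (x : A →ₐ[k] k) (γ : Γ) (α : A ⊗[k] 𝔤) :
    evalAt 𝔤 x (diag k 𝔤 A γ α) = γ • evalAt 𝔤 (translate γ⁻¹ x) α := by
  induction α using TensorProduct.induction_on with
  | zero => simp
  | add α₁ α₂ h₁ h₂ => simp only [map_add, smul_add, h₁, h₂]
  | tmul a u => simp [smul_comm]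

variable (Γ) in
/-- The evaluation map `ev_x : 𝔐 → 𝔤^x`. -/
def ev (x : A →ₐ[k] k) : mapAlgebra k Γ A 𝔤 →ₗ⁅k⁆ fixedAt Γ 𝔤 x where
  toFun α := ⟨evalAt 𝔤 x α, fun γ hγ => by
    have h := evalAt_diag 𝔤 x γ (α : A ⊗[k] 𝔤)
    rw [α.2 γ, show translate γ⁻¹ x = x from (isotropy Γ x).inv_mem hγ] at h
    exact h.symm⟩
  map_add' α β := by ext; simp
  map_smul' c α := by ext; simp
  map_lie' {α β} := by ext; simp

@[simp] lemma coe_ev (x : A →ₐ[k] k) (α : mapAlgebra k Γ A 𝔤) :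
    (ev Γ 𝔤 x α : 𝔤) = evalAt 𝔤 x (α : A ⊗[k] 𝔤) := rfl

lemma exists_separating [Finite Γ] (x : A →ₐ[k] k) :
    ∃ a : A, x a = 1 ∧ ∀ γ : Γ, translate γ x ≠ x → translate γ x a = 0 := by
  classical
  have := Fintype.ofFinite Γ
  have key : ∀ γ : Γ, ∃ b : A, x b = 1 ∧ (translate γ x ≠ x → translate γ x b = 0) := by
    intro γ
    by_cases h : translate γ x = x
    · exact ⟨1, map_one x, fun h' => absurd h h'⟩
    · obtain ⟨b, hb⟩ : ∃ b, translate γ x b ≠ x b := by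
        by_contra! h'
        exact h (AlgHom.ext h')
      have hb' : x b - translate γ x b ≠ 0 := sub_ne_zero.mpr (Ne.symm hb)
      refine ⟨(x b - translate γ x b)⁻¹ • (b - algebraMap k A (translate γ x b)), ?_, fun _ => ?_⟩
      · rw [map_smul, map_sub, AlgHom.commutes, smul_eq_mul]
        exact inv_mul_cancel₀ hb'
      · rw [map_smul, map_sub, AlgHom.commutes]
        simp
  choose b hb₁ hb₂ using key
  refine ⟨∏ γ, b γ, by simp [hb₁], fun γ h => ?_⟩
  rw [map_prod]
  exact Finset.prod_eq_zero (Finset.mem_univ γ) (hb₂ γ h)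

lemma ev_surjective [CharZero k] [Finite Γ] (x : A →ₐ[k] k) :
    Function.Surjective (ev Γ 𝔤 x) := by
  classical
  have := Fintype.ofFinite Γ
  intro u
  obtain ⟨a, ha₁, ha₂⟩ := exists_separating (Γ := Γ) x
  have hmem : (∑ γ : Γ, diag k 𝔤 A γ (a ⊗ₜ (u : 𝔤))) ∈ mapAlgebra k Γ A 𝔤 := by
    intro δ
    rw [map_sum]
    refine Fintype.sum_equiv (Equiv.mulLeft δ) _ _ fun γ => ?_
    simp [mul_smul]
  have hN : ((Nat.card (isotropy Γ x) : ℕ) : k) ≠ 0 := by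
    exact_mod_cast Nat.card_pos.ne'
  refine ⟨(Nat.card (isotropy Γ x) : k)⁻¹ • ⟨_, hmem⟩, ?_⟩
  rw [map_smul, inv_smul_eq_iff₀ hN]
  ext
  rw [coe_ev, map_sum]
  have : ∀ γ : Γ, evalAt 𝔤 x (diag k 𝔤 A γ (a ⊗ₜ (u : 𝔤)))
      = if γ ∈ isotropy Γ x then (u : 𝔤) else 0 := by
    intro γ
    split_ifs with h
    · rw [evalAt_diag, show translate γ⁻¹ x = x from (isotropy Γ x).inv_mem h]
      simp [ha₁, u.2 γ h]
    · have h' : translate γ⁻¹ x ≠ x := fun h' => h (by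
        simpa using (isotropy Γ x).inv_mem (x := γ⁻¹) h')
      rw [evalAt_diag, evalAt_tmul, ha₂ _ h', zero_smul, smul_zero]
  simp_rw [this]
  rw [← Finset.sum_filter, Finset.sum_const, ← Fintype.card_subtype, ← Nat.card_eq_fintype_card]
  simp [Nat.cast_smul_eq_nsmul]
/-! ### The ideals `𝔎_x`, `𝔎_x'` and `𝔔_x` -/

variable (Γ) in
/-- `𝔎_x`, the kernel of `ev_x`. -/
def idealK (x : A →ₐ[k] k) : LieIdeal k (mapAlgebra k Γ A 𝔤) := (ev Γ 𝔤 x).ker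

variable (Γ) in
/-- `𝔎_x' = [𝔎_x, 𝔎_x]`, as an ideal of `𝔐`. -/
def idealK' (x : A →ₐ[k] k) : LieIdeal k (mapAlgebra k Γ A 𝔤) := ⁅idealK Γ 𝔤 x, idealK Γ 𝔤 x⁆

variable (Γ) in
/-- The ideal `I = {a ∈ A : a(y) = 0 for all y ∈ Γ · x}`. -/
def orbitIdeal (x : A →ₐ[k] k) : Ideal A := ⨅ γ : Γ, RingHom.ker (translate γ x)

lemma mem_orbitIdeal (x : A →ₐ[k] k) (a : A) :
    a ∈ orbitIdeal Γ x ↔ ∀ γ : Γ, x (γ⁻¹ • a) = 0 := by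
  simp [orbitIdeal, Submodule.mem_iInf, RingHom.mem_ker]

/-- For an ideal `J` of `A`, the image of `J ⊗ 𝔤` in `A ⊗ 𝔤`. -/
def tensorIdeal (k : Type u) [Field k] {A : Type u} [CommRing A] [Algebra k A]
    (𝔤 : Type u) [LieRing 𝔤] [LieAlgebra k 𝔤] (J : Ideal A) : Submodule k (A ⊗[k] 𝔤) :=
  LinearMap.range (LinearMap.rTensor 𝔤 (J.restrictScalars k).subtype)

lemma lie_mem_tensorIdeal (𝔤 : Type u) [LieRing 𝔤] [LieAlgebra k 𝔤] (J : Ideal A)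
    (α : A ⊗[k] 𝔤) {β : A ⊗[k] 𝔤} (hβ : β ∈ tensorIdeal k 𝔤 J) :
    ⁅α, β⁆ ∈ tensorIdeal k 𝔤 J := by
  obtain ⟨β, rfl⟩ := hβ
  induction α using TensorProduct.induction_on with
  | zero => simp
  | add α₁ α₂ h₁ h₂ => rw [add_lie]; exact add_mem h₁ h₂
  | tmul a u =>
    induction β using TensorProduct.induction_on with
    | zero => simp
    | add β₁ β₂ h₁ h₂ => rw [map_add, lie_add]; exact add_mem h₁ h₂
    | tmul b v =>
      rw [LinearMap.rTensor_tmul, LieAlgebra.ExtendScalars.bracket_tmul]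
      exact ⟨(⟨a * b, J.mul_mem_left a b.2⟩ : J.restrictScalars k) ⊗ₜ ⁅u, v⁆, rfl⟩

variable (Γ) in
/-- `𝔔_x = (𝔤 ⊗ I²)^Γ`. -/
def idealQ (x : A →ₐ[k] k) : LieIdeal k (mapAlgebra k Γ A 𝔤) where
  carrier := {α | (α : A ⊗[k] 𝔤) ∈ tensorIdeal k 𝔤 (orbitIdeal Γ x ^ 2)}
  add_mem' ha hb := (tensorIdeal k 𝔤 (orbitIdeal Γ x ^ 2)).add_mem ha hb
  zero_mem' := (tensorIdeal k 𝔤 (orbitIdeal Γ x ^ 2)).zero_mem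
  smul_mem' c _ h := (tensorIdeal k 𝔤 (orbitIdeal Γ x ^ 2)).smul_mem c h
  lie_mem {α _} h := lie_mem_tensorIdeal 𝔤 _ (α : A ⊗[k] 𝔤) h

lemma mem_idealQ (x : A →ₐ[k] k) (α : mapAlgebra k Γ A 𝔤) :
    α ∈ idealQ Γ 𝔤 x ↔ (α : A ⊗[k] 𝔤) ∈ tensorIdeal k 𝔤 (orbitIdeal Γ x ^ 2) := Iff.rfl

lemma idealQ_le_idealK (x : A →ₐ[k] k) : idealQ Γ 𝔤 x ≤ idealK Γ 𝔤 x := by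
  intro α hα
  have key : ∀ β ∈ tensorIdeal k 𝔤 (orbitIdeal Γ x ^ 2), evalAt 𝔤 x β = 0 := by
    rintro _ ⟨β, rfl⟩
    induction β using TensorProduct.induction_on with
    | zero => simp
    | add β₁ β₂ h₁ h₂ => simp only [map_add, h₁, h₂, add_zero]
    | tmul b v =>
      have h := (mem_orbitIdeal (Γ := Γ) x (b : A)).mp (Ideal.pow_le_self two_ne_zero b.2) 1
      rw [inv_one, one_smul] at h
      simp [h]
  exact LieHom.mem_ker.mpr (Subtype.ext (key _ ((mem_idealQ 𝔤 x α).mp hα)))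

variable (Γ) in
/-- `𝔔_x / 𝔎_x'`, as a quotient of `𝔐`-modules. -/
def QModK' (x : A →ₐ[k] k) : Type u :=
  idealQ Γ 𝔤 x ⧸ LieSubmodule.comap (LieSubmodule.incl (idealQ Γ 𝔤 x)) (idealK' Γ 𝔤 x)

namespace QModK'

variable (x : A →ₐ[k] k)

instance : AddCommGroup (QModK' Γ 𝔤 x) :=
  inferInstanceAs (AddCommGroup (idealQ Γ 𝔤 x ⧸ LieSubmodule.comap (LieSubmodule.incl (idealQ Γ 𝔤 x)) (idealK' Γ 𝔤 x)))

instance : Module k (QModK' Γ 𝔤 x) :=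
  inferInstanceAs (Module k (idealQ Γ 𝔤 x ⧸ LieSubmodule.comap (LieSubmodule.incl (idealQ Γ 𝔤 x)) (idealK' Γ 𝔤 x)))

/-- The action of `𝔐` on `𝔔_x / 𝔎_x'` induced by the adjoint representation. -/
instance : LieRingModule (mapAlgebra k Γ A 𝔤) (QModK' Γ 𝔤 x) :=
  inferInstanceAs (LieRingModule (mapAlgebra k Γ A 𝔤)
    (idealQ Γ 𝔤 x ⧸ LieSubmodule.comap (LieSubmodule.incl (idealQ Γ 𝔤 x)) (idealK' Γ 𝔤 x)))

instance : LieModule k (mapAlgebra k Γ A 𝔤) (QModK' Γ 𝔤 x) :=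
  inferInstanceAs (LieModule k (mapAlgebra k Γ A 𝔤)
    (idealQ Γ 𝔤 x ⧸ LieSubmodule.comap (LieSubmodule.incl (idealQ Γ 𝔤 x)) (idealK' Γ 𝔤 x)))

variable {𝔤 x}

lemma lie_eq_zero {α : mapAlgebra k Γ A 𝔤} (hα : ev Γ 𝔤 x α = 0) (q : QModK' Γ 𝔤 x) :
    ⁅α, q⁆ = 0 := by
  obtain ⟨q, rfl⟩ := LieSubmodule.Quotient.surjective_mk' _ q
  exact (LieSubmodule.Quotient.mk_eq_zero _).mpr
    (LieSubmodule.lie_mem_lie (I := idealK Γ 𝔤 x) (N := idealK Γ 𝔤 x)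
      (LieHom.mem_ker.mpr hα) (idealQ_le_idealK 𝔤 x q.2))

lemma lie_congr {α β : mapAlgebra k Γ A 𝔤} (h : ev Γ 𝔤 x α = ev Γ 𝔤 x β)
    (q : QModK' Γ 𝔤 x) : ⁅α, q⁆ = ⁅β, q⁆ := by
  rw [← sub_eq_zero, ← sub_lie]
  exact lie_eq_zero (by rw [map_sub, h, sub_self]) q

variable [CharZero k] [Finite Γ]

/-- The action of `𝔤^x ≅ 𝔐 / 𝔎_x` on `𝔔_x / 𝔎_x'`: an element `u` acts as any `α ∈ 𝔐` with
`α(x) = u`, see `ev_lie`. -/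
instance : Bracket (fixedAt Γ 𝔤 x) (QModK' Γ 𝔤 x) where
  bracket u q := ⁅Function.surjInv (ev_surjective 𝔤 x) u, q⁆

lemma ev_lie (α : mapAlgebra k Γ A 𝔤) (q : QModK' Γ 𝔤 x) : ⁅ev Γ 𝔤 x α, q⁆ = ⁅α, q⁆ :=
  lie_congr (Function.surjInv_eq (ev_surjective 𝔤 x) _) q

instance : LieRingModule (fixedAt Γ 𝔤 x) (QModK' Γ 𝔤 x) where
  add_lie u v q := by
    obtain ⟨α, rfl⟩ := ev_surjective 𝔤 x u
    obtain ⟨β, rfl⟩ := ev_surjective 𝔤 x v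
    rw [← map_add, ev_lie, ev_lie, ev_lie, add_lie]
  lie_add u q r := lie_add (Function.surjInv (ev_surjective 𝔤 x) u) q r
  leibniz_lie u v q := by
    obtain ⟨α, rfl⟩ := ev_surjective 𝔤 x u
    obtain ⟨β, rfl⟩ := ev_surjective 𝔤 x v
    rw [← LieHom.map_lie, ev_lie, ev_lie, ev_lie, ev_lie, ev_lie, leibniz_lie]

instance : LieModule k (fixedAt Γ 𝔤 x) (QModK' Γ 𝔤 x) where
  smul_lie c u q := by
    obtain ⟨α, rfl⟩ := ev_surjective 𝔤 x u
    rw [← map_smul, ev_lie, ev_lie, smul_lie]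
  lie_smul c u q := lie_smul c (Function.surjInv (ev_surjective 𝔤 x) u) q

end QModK'

/-! ### Characters and isotypic components

The character group `Ξ` of `Γ` is `Γ →* kˣ`, written multiplicatively. -/

/-- The isotypic component of type `ξ` of a `k`-linear action `T` of `Γ` on `W`. -/
def isotypic {W : Type*} [AddCommGroup W] [Module k W] (T : Γ → W →ₗ[k] W) (ξ : Γ →* kˣ) :
    Submodule k W where
  carrier := {w | ∀ γ, T γ w = (ξ γ : k) • w}
  add_mem' ha hb γ := by rw [map_add, ha γ, hb γ, smul_add]
  zero_mem' γ := by simp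
  smul_mem' c w h γ := by rw [map_smul, h γ, smul_comm]

/-- The isotypic component `𝔤_ξ`. -/
def weightSpace (𝔤 : Type u) [LieRing 𝔤] [LieAlgebra k 𝔤] [DistribMulAction Γ 𝔤]
    [SMulCommClass Γ k 𝔤] (ξ : Γ →* kˣ) : Submodule k 𝔤 :=
  isotypic (fun γ : Γ => DistribSMul.toLinearMap k 𝔤 γ) ξ

lemma mem_weightSpace (𝔤 : Type u) [LieRing 𝔤] [LieAlgebra k 𝔤] [DistribMulAction Γ 𝔤]
    [SMulCommClass Γ k 𝔤] (ξ : Γ →* kˣ) (u : 𝔤) :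
    u ∈ weightSpace 𝔤 ξ ↔ ∀ γ : Γ, γ • u = (ξ γ : k) • u := Iff.rfl

variable (Γ) in
/-- `Ξ_x`, the group of characters of `Γ` that are trivial on `Γ_x`. -/
def charSubgroup (x : A →ₐ[k] k) : Subgroup (Γ →* kˣ) where
  carrier := {ξ | ∀ γ ∈ isotropy Γ x, ξ γ = 1}
  one_mem' _ _ := rfl
  mul_mem' h₁ h₂ γ hγ := by simp [h₁ γ hγ, h₂ γ hγ]
  inv_mem' h γ hγ := by simp [h γ hγ]

lemma smul_mem_orbitIdeal (x : A →ₐ[k] k) (γ : Γ) :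
    orbitIdeal Γ x ≤ (orbitIdeal Γ x).comap (MulSemiringAction.toAlgHom k A γ) := by
  intro a ha
  rw [Ideal.mem_comap, mem_orbitIdeal]
  intro δ
  have h := (mem_orbitIdeal x a).mp ha (γ⁻¹ * δ)
  rwa [mul_inv_rev, inv_inv, mul_smul] at h

variable (Γ) in
/-- The isotypic component `(I/I²)_ξ`, where `Γ` acts on `I/I²` by `γ · [a] = [γ · a]`. -/
def cotangentComponent (x : A →ₐ[k] k) (ξ : Γ →* kˣ) :
    Submodule k (orbitIdeal Γ x).Cotangent :=
  isotypic (fun γ : Γ => Ideal.mapCotangent _ _ (MulSemiringAction.toAlgHom k A γ)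
    (smul_mem_orbitIdeal x γ)) ξ

section Decomposition

variable [IsAlgClosed k] [CharZero k] [Finite Γ]

variable (k) in
lemma sum_char_eq_zero [Fintype (Γ →* kˣ)] {γ : Γ} (hγ : γ ≠ 1) :
    ∑ ξ : Γ →* kˣ, (ξ γ : k) = 0 := by
  have : NeZero (Monoid.exponent Γ) := ⟨Monoid.exponent_ne_zero_of_finite⟩
  have : NeZero ((Monoid.exponent Γ : ℕ) : k) :=
    ⟨by exact_mod_cast Monoid.exponent_ne_zero_of_finite⟩
  obtain ⟨η, hη⟩ := CommGroup.exists_apply_ne_one_of_hasEnoughRootsOfUnity Γ k hγ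
  have h : (η γ : k) * ∑ ξ : Γ →* kˣ, (ξ γ : k) = ∑ ξ : Γ →* kˣ, (ξ γ : k) := by
    rw [Finset.mul_sum]
    exact Fintype.sum_equiv (Equiv.mulLeft η) _ _ fun ξ => by simp
  have h' : ((η γ : k) - 1) * ∑ ξ : Γ →* kˣ, (ξ γ : k) = 0 := by
    rw [sub_mul, one_mul, h, sub_self]
  refine (mul_eq_zero.mp h').resolve_left fun h0 => hη ?_
  exact Units.ext (sub_eq_zero.mp h0)

instance finite_char : Finite (Γ →* kˣ) := by
  have : NeZero (Monoid.exponent Γ) := ⟨Monoid.exponent_ne_zero_of_finite⟩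
  have : NeZero ((Monoid.exponent Γ : ℕ) : k) :=
    ⟨by exact_mod_cast Monoid.exponent_ne_zero_of_finite⟩
  obtain ⟨e⟩ := CommGroup.monoidHom_mulEquiv_of_hasEnoughRootsOfUnity Γ k
  exact Finite.of_equiv _ e.symm.toEquiv

/-- An element of `𝔤` on which `Γ_x` acts through the restriction of `χ` is a sum of elements of
the components `𝔤_ξ` with `ξ ∈ χ Ξ_x`. -/
lemma mem_iSup_weightSpace_of_isotropy (x : A →ₐ[k] k) (χ : Γ →* kˣ) {u : 𝔤}
    (hu : ∀ γ ∈ isotropy Γ x, γ • u = (χ γ : k) • u) :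
    u ∈ ⨆ ξ ∈ {ξ : Γ →* kˣ | (ξ : (Γ →* kˣ) ⧸ charSubgroup Γ x) = χ}, weightSpace 𝔤 ξ := by
  classical
  have := Fintype.ofFinite Γ
  have := Fintype.ofFinite (Γ →* kˣ)
  let p : (Γ →* kˣ) → 𝔤 := fun ξ => ∑ γ : Γ, ((ξ γ)⁻¹ : kˣ) • (γ • u)
  have hp : ∀ ξ, p ξ ∈ weightSpace 𝔤 ξ := by
    intro ξ
    rw [mem_weightSpace]
    intro δ
    simp only [p, Finset.smul_sum]
    refine Fintype.sum_equiv (Equiv.mulLeft δ) _ _ fun γ => ?_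
    rw [Equiv.coe_mulLeft, Units.smul_def, Units.smul_def, smul_comm, smul_smul, smul_smul]
    congr 1
    rw [map_mul]
    simp
    field_simp
  have hz : ∀ ξ : Γ →* kˣ, (ξ : (Γ →* kˣ) ⧸ charSubgroup Γ x) ≠ χ → p ξ = 0 := by
    intro ξ hξ
    obtain ⟨δ, hδ, hne⟩ : ∃ δ ∈ isotropy Γ x, ξ δ ≠ χ δ := by
      by_contra! h
      refine hξ (QuotientGroup.eq.mpr fun γ hγ => ?_)
      simp [h γ hγ]
    have h : p ξ = ((ξ δ : k)⁻¹ * (χ δ : k)) • p ξ := by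
      simp only [p, Finset.smul_sum]
      refine Fintype.sum_equiv (Equiv.mulRight δ⁻¹) _ _ fun γ => ?_
      have h1 : γ • u = (χ δ : k) • ((γ * δ⁻¹) • u) := by
        rw [← smul_comm, ← hu δ hδ, smul_smul, inv_mul_cancel_right]
      rw [h1]
      rw [Equiv.coe_mulRight, Units.smul_def, Units.smul_def, smul_smul, smul_smul]
      congr 1
      rw [map_mul]
      simp
      field_simp
    have h' : (1 - (ξ δ : k)⁻¹ * (χ δ : k)) • p ξ = 0 := by rw [sub_smul, one_smul, ← h, sub_self]
    refine (smul_eq_zero.mp h').resolve_left fun h0 => hne ?_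
    have := sub_eq_zero.mp h0
    exact Units.ext (by field_simp at this; exact this)
  have hsum : ∑ ξ, p ξ = (Fintype.card (Γ →* kˣ) : k) • u := by
    simp only [p]
    rw [Finset.sum_comm, Finset.sum_eq_single 1]
    · simp [Nat.cast_smul_eq_nsmul]
    · intro γ _ hγ
      simp only [Units.smul_def]
      rw [← Finset.sum_smul]
      have : ∑ ξ : Γ →* kˣ, (((ξ γ)⁻¹ : kˣ) : k) = ∑ ξ : Γ →* kˣ, (ξ γ⁻¹ : k) := by simp
      rw [this, sum_char_eq_zero k (inv_ne_one.mpr hγ), zero_smul]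
    · simp
  have hc : (Fintype.card (Γ →* kˣ) : k) ≠ 0 := by exact_mod_cast Fintype.card_ne_zero
  rw [← Submodule.smul_mem_iff _ hc, ← hsum]
  refine Submodule.sum_mem _ fun ξ _ => ?_
  by_cases h : (ξ : (Γ →* kˣ) ⧸ charSubgroup Γ x) = χ
  · exact Submodule.mem_iSup_of_mem ξ (Submodule.mem_iSup_of_mem h (hp ξ))
  · rw [hz ξ h]
    exact zero_mem _

lemma smul_of_mem_iSup_weightSpace (x : A →ₐ[k] k) (χ : Γ →* kˣ) {u : 𝔤}
    (hu : u ∈ ⨆ ξ ∈ {ξ : Γ →* kˣ | (ξ : (Γ →* kˣ) ⧸ charSubgroup Γ x) = χ}, weightSpace 𝔤 ξ) :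
    ∀ γ ∈ isotropy Γ x, γ • u = (χ γ : k) • u := by
  intro γ hγ
  have hle : (⨆ ξ ∈ {ξ : Γ →* kˣ | (ξ : (Γ →* kˣ) ⧸ charSubgroup Γ x) = χ}, weightSpace 𝔤 ξ)
      ≤ LinearMap.eqLocus (DistribSMul.toLinearMap k 𝔤 γ) ((χ γ : k) • LinearMap.id) := by
    refine iSup₂_le fun ξ hξ v hv => ?_
    have h := (QuotientGroup.eq.mp hξ) γ hγ
    have h' : ξ γ = χ γ := by
      simpa [inv_mul_eq_one] using h
    have hv' := hv γ
    rw [h'] at hv'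
    exact hv'
  exact hle hu

variable (Γ) in
/-- The `𝔤^x`-submodule `𝔤_ω = ⨁_{ξ ∈ ω} 𝔤_ξ` of `𝔤`, for a coset `ω ∈ Ξ/Ξ_x`. -/
def cosetSpace (x : A →ₐ[k] k) (ω : (Γ →* kˣ) ⧸ charSubgroup Γ x) :
    LieSubmodule k (fixedAt Γ 𝔤 x) 𝔤 where
  __ := ⨆ ξ ∈ {ξ : Γ →* kˣ | (ξ : (Γ →* kˣ) ⧸ charSubgroup Γ x) = ω}, weightSpace 𝔤 ξ
  lie_mem {l u} hu := by
    induction ω using QuotientGroup.induction_on with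
    | H χ =>
      have hu' := smul_of_mem_iSup_weightSpace 𝔤 x χ hu
      refine mem_iSup_weightSpace_of_isotropy 𝔤 x χ fun γ hγ => ?_
      change γ • ⁅(l : 𝔤), u⁆ = (χ γ : k) • ⁅(l : 𝔤), u⁆
      rw [IsLieAction.smul_lie' γ, l.2 γ hγ, hu' γ hγ, lie_smul]

end Decomposition

/-! ### Representations and extensions -/

attribute [local instance 100] LieRing.ofAssociativeRing

/-- The module over the universal enveloping algebra `U(L)` given by a representation of the Lie
algebra `L` on `V`. -/
def repModule {L V : Type u} [LieRing L] [LieAlgebra k L] [AddCommGroup V] [Module k V]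
    (ρ : L →ₗ⁅k⁆ Module.End k V) : ModuleCat.{u} (UniversalEnvelopingAlgebra k L) :=
  letI : Module (UniversalEnvelopingAlgebra k L) V :=
    Module.compHom V (UniversalEnvelopingAlgebra.lift k ρ).toRingHom
  ModuleCat.of (UniversalEnvelopingAlgebra k L) V

/-- `Ext¹_L(V₁, V₂)` for representations `ρ₁`, `ρ₂` of `L` on `V₁`, `V₂`, a vector space over `k`:
the degree one extensions in the category of `U(L)`-modules, that is, of `L`-modules. -/
abbrev Ext1 {L V₁ V₂ : Type u} [LieRing L] [LieAlgebra k L] [AddCommGroup V₁] [Module k V₁]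
    [AddCommGroup V₂] [Module k V₂] (ρ₁ : L →ₗ⁅k⁆ Module.End k V₁)
    (ρ₂ : L →ₗ⁅k⁆ Module.End k V₂) : Type u :=
  Abelian.Ext.{u} (repModule ρ₁) (repModule ρ₂) 1

variable (Γ) in
/-- The evaluation representation `𝔐 → 𝔤^x → End V` attached to a `𝔤^x`-module `V`. -/
def evalRep (x : A →ₐ[k] k) (V : Type u) [AddCommGroup V] [Module k V]
    [LieRingModule (fixedAt Γ 𝔤 x) V] [LieModule k (fixedAt Γ 𝔤 x) V] :
    mapAlgebra k Γ A 𝔤 →ₗ⁅k⁆ Module.End k V :=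
  (LieModule.toEnd k (fixedAt Γ 𝔤 x) V).comp (ev Γ 𝔤 x)

variable (Γ) in
/-- The evaluation representation `𝔐 → 𝔤^x ⊆ 𝔤 → End V` attached to a `𝔤`-module `V`. If `Γ_x` is
trivial, then `𝔤^x = 𝔤` and all evaluation representations at `x` are of this form. -/
def evalRepFull (x : A →ₐ[k] k) (V : Type u) [AddCommGroup V] [Module k V]
    [LieRingModule 𝔤 V] [LieModule k 𝔤 V] :
    mapAlgebra k Γ A 𝔤 →ₗ⁅k⁆ Module.End k V :=
  (LieModule.toEnd k 𝔤 V).comp ((fixedAt Γ 𝔤 x).incl.comp (ev Γ 𝔤 x))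

end Defs
end EquivMap
end

/-! Write `E` for `𝔐`, `L` for `𝔤^x`, `K` for `ker ev_x` and `M` for `V₁* ⊗ V₂ ≅ Hom(V₁, V₂)`. A
free presentation of `V₁` over `U(E)` identifies `Ext¹(V₁, V₂)` with the derivations `E → M` modulo
the inner ones (`nonempty_ext1_equiv`). Since `K` acts trivially on `M`, a derivation restricts to
an `E`-equivariant map `K → M`, and this restriction is an isomorphism from derivations modulo inner
ones onto equivariant maps (`nonempty_ext1_equiv_kerHoms`). Cohomologically this is the five-term
sequence together with the vanishing of H¹ and H² of `L` in `M`. Only Whitehead's first lemma is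
proved here, with a Casimir element. The second vanishing is replaced by applying the first to
finite-dimensional subquotients of `Hom(E, M)` (`exists_derivation_extension'`).

An equivariant map `K → M` kills `K' = [K, K]`. As `𝔔_x` has finite codimension in `K`, Whitehead's
lemma also shows that every equivariant map on `𝔔_x / K'` extends to `K`. This splits off the first
summand and leaves the maps on `K / 𝔔_x` (`nonempty_kerHoms_equiv`). Averaging over `Γ` turns such a
map into a `Γ`-invariant map on `I ⊗ 𝔤` that kills `I² ⊗ 𝔤`. An element `e` of `A` with value `1` at
`x` and `0` at the other points of the orbit concentrates it at `x`: the result is a map from the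
summand `e (I/I²)` to `Hom_L(𝔤, M)` compatible with `Γ_x` (`nonempty_kerHomsMod_equiv`). The cosets
in `Ξ/Ξ_x` are the characters of `Γ_x`. The piece `𝔤_ω` pairs with the part of `e (I/I²)` of inverse
character, and summing over `Γ` identifies that part with `(I/I²)_{-a_ω}`, whatever the
representative `a_ω` (`nonempty_localHoms_equiv`).

For a free action `Γ_x` is trivial and `e (I/I²)` is `𝔪_x/𝔪_x²`, so it remains to see that `𝔔_x =
K'` (`idealQ_le_idealK'`). The Nullstellensatz yields a function on `X × X` that is `1` on the
diagonal and `0` on the graphs of all `γ ≠ 1`. With it, sums of brackets of averaged elements reduce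
to the averages of `ab ⊗ [v, w]`, and these span `𝔔_x` because `𝔤 = [𝔤, 𝔤]`. -/

/-! ### Whitehead's first lemma -/

namespace LieAlgebra

/-- A linear map `d : E → M` is a derivation along `π : E → L` if
`d ⁅x, y⁆ = π x · d y - π y · d x`. -/
def IsDerivationAlong {k E L M : Type*} [CommRing k] [LieRing E] [LieAlgebra k E]
    [LieRing L] [LieAlgebra k L] [AddCommGroup M] [Module k M] [LieRingModule L M]
    (π : E →ₗ⁅k⁆ L) (d : E →ₗ[k] M) : Prop :=
  ∀ x y : E, d ⁅x, y⁆ = ⁅π x, d y⁆ - ⁅π y, d x⁆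

section Killing

variable {k L : Type*} [Field k] [LieRing L] [LieAlgebra k L]

/-- The part of `I` orthogonal to `[I, I]` is an abelian ideal, hence zero, and the modular law
gives `I ≤ [I, I]`. -/
lemma lie_self_of_isKilling [Module.Finite k L] [IsKilling k L] (I : LieIdeal k L) :
    ⁅I, I⁆ = I := by
  have hle : ⁅I, I⁆ ≤ I := LieSubmodule.lie_le_left I I
  obtain ⟨hd, hc⟩ := LieIdeal.isCompl_killingCompl (⁅I, I⁆ : LieIdeal k L)
  set J := LieIdeal.killingCompl k L (⁅I, I⁆ : LieIdeal k L)
  have hJ : J ⊓ I = ⊥ := by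
    have hab : IsLieAbelian (J ⊓ I : LieIdeal k L) := ?_
    · exact IsKilling.ideal_eq_bot_of_isLieAbelian (J ⊓ I : LieIdeal k L)
    rw [LieSubmodule.lie_abelian_iff_lie_self_eq_bot, ← le_bot_iff, ← hd.eq_bot]
    exact le_inf (LieSubmodule.mono_lie inf_le_right inf_le_right)
      ((LieSubmodule.lie_le_left _ _).trans inf_le_left)
  refine le_antisymm hle ?_
  calc I = (⁅I, I⁆ ⊔ J) ⊓ I := by rw [codisjoint_iff.mp hc, top_inf_eq]
    _ ≤ ⁅I, I⁆ ⊔ J ⊓ I := sup_inf_le_assoc_of_le J hle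
    _ ≤ ⁅I, I⁆ := by rw [hJ, sup_bot_eq]

variable {V : Type*} [AddCommGroup V] [Module k V] [LieRingModule L V] [LieModule k L V]

variable (k L V) in
/-- The radical of the trace form of `V`. -/
noncomputable def traceRadical : LieIdeal k L :=
  InvariantForm.orthogonal (LieModule.traceForm k L V)
    (LieModule.traceForm_lieInvariant k L V) ⊤

lemma mem_traceRadical {x : L} :
    x ∈ traceRadical k L V ↔ ∀ y, LieModule.traceForm k L V x y = 0 := by
  simp [traceRadical, InvariantForm.mem_orthogonal, LieModule.traceForm_comm k L V x]

/-- The trace form vanishes on the radical `R`, so the derived ideal of `R` acts nilpotently. This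
ideal is all of `R`, which is perfect, so some nonzero vector is killed by `R`. The vectors killed
by `R` form an `L`-submodule, which is everything by irreducibility. -/
lemma lie_eq_zero_of_mem_traceRadical [CharZero k] [Module.Finite k L] [IsKilling k L]
    [Module.Finite k V] [LieModule.IsIrreducible k L V] {x : L}
    (hx : x ∈ traceRadical k L V) (v : V) : ⁅x, v⁆ = 0 := by
  set R := traceRadical k L V with hR
  have htr : LieModule.traceForm k R V = 0 := by
    ext x y
    exact mem_traceRadical.mp x.2 y
  have hnil := LieModule.isNilpotent_derivedSeries_of_traceForm_eq_zero htr
  have htop : derivedSeries k R 1 = ⊤ := by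
    rw [LieIdeal.derivedSeries_eq_derivedSeriesOfIdeal_comap, derivedSeriesOfIdeal_succ,
      derivedSeriesOfIdeal_zero, lie_self_of_isKilling]
    ext y
    simp
  let N : LieSubmodule k L V :=
    { carrier := {v | ∀ x ∈ R, ⁅x, v⁆ = 0}
      add_mem' := fun ha hb x hx => by rw [lie_add, ha x hx, hb x hx, add_zero]
      zero_mem' := fun x _ => lie_zero x
      smul_mem' := fun c v h x hx => by rw [lie_smul, h x hx, smul_zero]
      lie_mem := fun {y v} h x hx => by
        rw [leibniz_lie, h x hx, lie_zero, add_zero]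
        exact h _ (lie_mem_left k L R x y hx) }
  have : Nontrivial V := LieModule.nontrivial_of_isIrreducible k L V
  have hnt := LieModule.nontrivial_max_triv_of_isNilpotent k (derivedSeries k R 1) V
  obtain ⟨⟨w, hw⟩, hw0⟩ := exists_ne
    (0 : LieModule.maxTrivSubmodule k (derivedSeries k R 1) V)
  have hwN : w ∈ N := fun x hx =>
    (LieModule.mem_maxTrivSubmodule k _ V w).mp hw ⟨⟨x, hx⟩, by rw [htop]; trivial⟩
  have hN : N = ⊤ := (IsSimpleOrder.eq_bot_or_eq_top N).resolve_left fun h => hw0 <| by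
    rw [h] at hwN
    exact Subtype.ext ((LieSubmodule.mem_bot w).mp hwN)
  exact (hN ▸ LieSubmodule.mem_top v : v ∈ N) x hx

/-- Dual bases with respect to an invariant form define an invariant tensor. -/
lemma sum_lie_dualBasis_eq_zero {k L : Type*} [Field k] [LieRing L] {J W ι : Type*} [AddCommGroup J] [Module k J] [LieRingModule L J]
    [AddCommGroup W] [Module k W] [Fintype ι] [DecidableEq ι]
    (B : LinearMap.BilinForm k J) (hB : B.Nondegenerate) (hsymm : B.IsSymm)
    (hinv : B.lieInvariant L) (b : Module.Basis ι k J)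
    (F : J →ₗ[k] J →ₗ[k] W) (z : L) :
    ∑ i, (F ⁅z, b i⁆ (B.dualBasis hB b i) + F (b i) ⁅z, B.dualBasis hB b i⁆) = 0 := by
  set b' := B.dualBasis hB b with hb'
  have h1 : ∀ x : J, x = ∑ j, B x (b' j) • b j := fun x => by
    conv_lhs => rw [← b.sum_repr x]
    refine Finset.sum_congr rfl fun j _ => ?_
    congr 1
    rw [← LinearMap.BilinForm.dualBasis_dualBasis hB hsymm b,
      LinearMap.BilinForm.dualBasis_repr_apply]
  have h2 : ∀ x : J, x = ∑ j, B x (b j) • b' j := fun x => by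
    conv_lhs => rw [← b'.sum_repr x]
    refine Finset.sum_congr rfl fun j _ => ?_
    rw [hb', LinearMap.BilinForm.dualBasis_repr_apply]
  have e1 : ∑ i, F ⁅z, b i⁆ (b' i) = ∑ i, ∑ j, B ⁅z, b i⁆ (b' j) • F (b j) (b' i) := by
    refine Finset.sum_congr rfl fun i _ => ?_
    conv_lhs => rw [h1 ⁅z, b i⁆]
    simp
  have e2 : ∑ i, F (b i) ⁅z, b' i⁆ = ∑ i, ∑ j, B ⁅z, b' i⁆ (b j) • F (b i) (b' j) := by
    refine Finset.sum_congr rfl fun i _ => ?_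
    conv_lhs => rw [h2 ⁅z, b' i⁆]
    simp
  rw [Finset.sum_add_distrib, e1, e2, Finset.sum_comm (s := Finset.univ), ← Finset.sum_add_distrib]
  refine Finset.sum_eq_zero fun j _ => ?_
  rw [← Finset.sum_add_distrib]
  refine Finset.sum_eq_zero fun i _ => ?_
  -- Invariance makes the matrices of `z` in the two dual bases negative transposes of each other,
  -- so the terms cancel in pairs.
  rw [hinv z (b i) (b' j), hsymm.eq (b i), neg_smul, neg_add_cancel]

variable [CharZero k] [Module.Finite k L] [IsKilling k L] [Module.Finite k V]

/-- The Casimir argument. The radical `R` of the trace form acts by zero and has a complementary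
ideal `J` on which the form is nondegenerate. The Casimir element of `J` commutes with `L` and has
trace `dim J`, so by irreducibility it is invertible unless `J = 0`. In that case the action is
trivial and `d` kills `[L, L] = L`. -/
lemma exists_eq_lie_of_isIrreducible [LieModule.IsIrreducible k L V] (d : L →ₗ[k] V)
    (hd : IsDerivationAlong (k := k) LieHom.id d) : ∃ v, ∀ x, d x = ⁅x, v⁆ := by
  classical
  set R := traceRadical k L V
  obtain ⟨hdisj, hcod⟩ := LieIdeal.isCompl_killingCompl R
  set J := LieIdeal.killingCompl k L R
  have hdec : ∀ x : L, ∃ r ∈ R, ∃ j ∈ J, r + j = x := fun x => by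
    rw [← LieSubmodule.mem_sup, codisjoint_iff.mp hcod]
    trivial
  by_cases hJ : J = ⊥
  · have htriv : ∀ (x : L) (v : V), ⁅x, v⁆ = 0 := by
      intro x v
      obtain ⟨r, hr, j, hj, rfl⟩ := hdec x
      rw [hJ, LieSubmodule.mem_bot] at hj
      rw [hj, add_zero, lie_eq_zero_of_mem_traceRadical hr]
    refine ⟨0, fun x => ?_⟩
    have hx : x ∈ (⁅(⊤ : LieIdeal k L), (⊤ : LieIdeal k L)⁆ : LieIdeal k L) := by
      rw [lie_self_of_isKilling]
      trivial
    rw [lie_zero, ← LinearMap.mem_ker]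
    rw [← LieSubmodule.mem_toSubmodule, LieSubmodule.lieIdeal_oper_eq_linear_span'] at hx
    refine Submodule.span_le.mpr ?_ hx
    rintro _ ⟨y, -, z, -, rfl⟩
    simp [hd y z, htriv]
  -- the trace form restricted to `J` is nondegenerate
  let B : LinearMap.BilinForm k J := (LieModule.traceForm k L V).restrict J.toSubmodule
  have hBapp : ∀ x y : J, B x y = LieModule.traceForm k L V x y := fun x y => rfl
  have hsymm : B.IsSymm := ⟨fun x y => LieModule.traceForm_comm k L V x y⟩
  have hinv : B.lieInvariant L := fun x y z =>
    LieModule.traceForm_lieInvariant k L V x (y : L) (z : L)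
  have hB : B.Nondegenerate := by
    refine hsymm.isRefl.nondegenerate_iff_separatingLeft.mpr fun x hx => ?_
    have hxR : (x : L) ∈ R := mem_traceRadical.mpr fun y => by
      obtain ⟨r, hr, j, hj, rfl⟩ := hdec y
      rw [map_add, hx ⟨j, hj⟩ |> (hBapp x ⟨j, hj⟩).symm.trans, add_zero,
        LieModule.traceForm_comm, mem_traceRadical.mp hr]
    exact Subtype.ext ((LieSubmodule.mem_bot (R := k) (L := L) (x : L)).mp
      (hdisj.eq_bot ▸ (⟨hxR, x.2⟩ : (x : L) ∈ R ⊓ J)))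
  let b := Module.finBasis k J
  let b' := B.dualBasis hB b
  let c : Module.End k V := ∑ i, LieModule.toEnd k L V (b i) * LieModule.toEnd k L V (b' i)
  have hc : ∀ v, c v = ∑ i, ⁅(b i : L), ⁅(b' i : L), v⁆⁆ := fun v => by
    simp [c, LinearMap.sum_apply]
  have hcomm : ∀ (z : L) (v : V), ⁅z, c v⁆ = c ⁅z, v⁆ := by
    intro z v
    let F : J →ₗ[k] J →ₗ[k] V := LinearMap.mk₂ k (fun x y => ⁅(x : L), ⁅(y : L), v⁆⁆)
      (by simp) (by simp) (by simp) (by simp)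
    have h := sum_lie_dualBasis_eq_zero B hB hsymm hinv b F z
    rw [← sub_eq_zero, ← h, hc, hc, lie_sum, ← Finset.sum_sub_distrib]
    refine Finset.sum_congr rfl fun i _ => ?_
    simp only [F, LinearMap.mk₂_apply, LieSubmodule.coe_bracket, lie_lie, lie_sub]
    abel
  have htrace : LinearMap.trace k V c ≠ 0 := by
    have : LinearMap.trace k V c = (Module.finrank k J : k) := by
      simp only [c, map_sum]
      calc _ = ∑ i, B (b i) (b' i) := rfl
        _ = ∑ i : Fin (Module.finrank k J), (1 : k) := Finset.sum_congr rfl fun i _ => by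
          rw [LinearMap.BilinForm.apply_dualBasis_right hB hsymm, if_pos rfl]
        _ = _ := by simp
    rw [this, Nat.cast_ne_zero]
    intro h0
    have : Subsingleton J := Module.finrank_zero_iff.mp h0
    exact hJ (by
      rw [LieSubmodule.eq_bot_iff]
      exact fun x hx => congrArg Subtype.val (Subsingleton.elim (⟨x, hx⟩ : J) 0))
  have hker : LinearMap.ker c = ⊥ := by
    let N : LieSubmodule k L V :=
      { LinearMap.ker c with
        lie_mem := fun {x v} (h : c v = 0) => show c ⁅x, v⁆ = 0 by rw [← hcomm, h, lie_zero] }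
    rcases IsSimpleOrder.eq_bot_or_eq_top N with h | h
    · simpa [N] using congrArg LieSubmodule.toSubmodule h
    · refine absurd ?_ htrace
      have : c = 0 := by
        ext v
        exact (h ▸ LieSubmodule.mem_top v : v ∈ N)
      rw [this, map_zero]
  let e := LinearEquiv.ofInjectiveEndo c (LinearMap.ker_eq_bot.mp hker)
  have he : ∀ v, c (e.symm v) = v := fun v => e.apply_symm_apply v
  -- If `d` is `x ↦ ⁅x, v⁆`, then `∑ ⁅b i, d (b' i)⁆ = c v`; this forces the choice of `v`.
  refine ⟨e.symm (∑ i, ⁅(b i : L), d (b' i)⁆), fun z => ?_⟩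
  apply LinearMap.ker_eq_bot.mp hker
  rw [← hcomm, he, hc, lie_sum]
  let F : J →ₗ[k] J →ₗ[k] V := LinearMap.mk₂ k (fun x y => ⁅(x : L), d (y : L)⁆)
      (by simp) (by simp) (by simp) (by simp)
  have h := sum_lie_dualBasis_eq_zero B hB hsymm hinv b F z
  rw [← sub_eq_zero, ← neg_eq_zero, ← h, ← Finset.sum_sub_distrib, ← Finset.sum_neg_distrib]
  refine Finset.sum_congr rfl fun i _ => ?_
  have h1 : d ⁅z, (b' i : L)⁆ = ⁅z, d (b' i)⁆ - ⁅(b' i : L), d z⁆ := hd z (b' i)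
  change _ = ⁅⁅z, (b i : L)⁆, d (b' i)⁆ + ⁅(b i : L), d ⁅z, (b' i : L)⁆⁆
  rw [lie_lie, h1, lie_sub]
  abel

end Killing

/-- **Whitehead's first lemma**: derivations of a semisimple Lie algebra with values in a
finite-dimensional module are inner. -/
theorem exists_eq_lie_of_isDerivation {k L : Type*} [Field k] [CharZero k] [LieRing L]
    [LieAlgebra k L] [Module.Finite k L] [IsKilling k L] {V : Type*} [AddCommGroup V] [Module k V]
    [LieRingModule L V] [LieModule k L V] [Module.Finite k V] (d : L →ₗ[k] V)
    (hd : IsDerivationAlong (k := k) LieHom.id d) : ∃ v, ∀ x, d x = ⁅x, v⁆ := by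
  induction hn : Module.finrank k V using Nat.strong_induction_on generalizing V with
  | _ n ih =>
  rcases subsingleton_or_nontrivial V with hs | hnt
  · exact ⟨0, fun x => Subsingleton.elim _ _⟩
  by_cases hirr : ∀ N : LieSubmodule k L V, N ≠ ⊥ → N = ⊤
  · have := LieModule.IsIrreducible.mk hirr
    exact exists_eq_lie_of_isIrreducible d hd
  push Not at hirr
  obtain ⟨N, hbot, htop⟩ := hirr
  have hbot' : N.toSubmodule ≠ ⊥ := by simpa using hbot
  have htop' : N.toSubmodule ≠ ⊤ := by simpa using htop
  have h1 : Module.finrank k (V ⧸ N) < n := by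
    have := Submodule.finrank_quotient_add_finrank N.toSubmodule
    have hpos : 0 < Module.finrank k N.toSubmodule :=
      Nat.pos_of_ne_zero fun h => hbot' (Submodule.finrank_eq_zero.mp h)
    change Module.finrank k (V ⧸ N.toSubmodule) < n
    omega
  have h2 : Module.finrank k N < n := hn ▸ Submodule.finrank_lt htop'
  have : Module.Finite k (V ⧸ N) := inferInstanceAs (Module.Finite k (V ⧸ N.toSubmodule))
  -- Modulo the proper submodule `N` the derivation is inner. After correction by a lift of `w` its
  -- values lie in `N`, which is handled by induction again.
  obtain ⟨w, hw⟩ := ih _ h1 (V := V ⧸ N)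
    ((LieSubmodule.Quotient.mk' N : V →ₗ[k] V ⧸ N).comp d) (fun x y => by
      rw [LinearMap.comp_apply, hd x y, map_sub]
      rfl) rfl
  obtain ⟨v, rfl⟩ := LieSubmodule.Quotient.surjective_mk' N w
  have hmem : ∀ x, d x - ⁅x, v⁆ ∈ N := fun x => by
    rw [← LieSubmodule.Quotient.mk_eq_zero, map_sub, sub_eq_zero]
    exact hw x
  obtain ⟨u, hu⟩ := ih _ h2 (V := N)
    { toFun := fun x => (⟨d x - ⁅x, v⁆, hmem x⟩ : N)
      map_add' := fun x y => Subtype.ext (by simp; abel)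
      map_smul' := fun c x => Subtype.ext (by simp [smul_sub]) }
    (fun x y => Subtype.ext (by simp [hd x y, lie_lie]; abel)) rfl
  refine ⟨u + v, fun x => ?_⟩
  have := congrArg Subtype.val (hu x)
  simp only [LinearMap.coe_mk, AddHom.coe_mk, LieSubmodule.coe_bracket] at this
  rw [lie_add, ← this, sub_add_cancel]

end LieAlgebra

/-! ### Modules inflated from a semisimple quotient -/

namespace LieAlgebra

section Inflation

variable {k E L : Type*} [Field k] [CharZero k] [LieRing E] [LieAlgebra k E]
  [LieRing L] [LieAlgebra k L] [Module.Finite k L] [IsKilling k L]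
  {π : E →ₗ⁅k⁆ L}

/-- A derivation of `E` that vanishes on the kernel of a surjection onto a semisimple Lie algebra
is inner. -/
lemma exists_eq_lie_of_vanishing {F : Type*} [AddCommGroup F] [Module k F] [LieRingModule E F]
    [LieModule k E F] [Module.Finite k F] (hπ : Function.Surjective π)
    (hF : ∀ x, π x = 0 → ∀ m : F, ⁅x, m⁆ = 0)
    (d : E →ₗ[k] F) (hd : IsDerivationAlong (k := k) LieHom.id d) (hd0 : ∀ x, π x = 0 → d x = 0) :
    ∃ v, ∀ x, d x = ⁅x, v⁆ := by
  obtain ⟨s, hs⟩ := LinearMap.exists_rightInverse_of_surjective (π : E →ₗ[k] L)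
    (LinearMap.range_eq_top.mpr hπ)
  have hs' : ∀ l, π (s l) = l := fun l => LinearMap.congr_fun hs l
  have hact : ∀ (x y : E) (m : F), π x = π y → ⁅x, m⁆ = ⁅y, m⁆ := fun x y m h => by
    rw [← sub_eq_zero, ← sub_lie]
    exact hF _ (by rw [map_sub, h, sub_self]) m
  have hdd : ∀ x y : E, π x = π y → d x = d y := fun x y h => by
    rw [← sub_eq_zero, ← map_sub]
    exact hd0 _ (by rw [map_sub, h, sub_self])
  -- The kernel of `π` acts by zero, so any linear section `s` of `π` defines the same action of `L`
  -- on `F`; likewise `d` descends to `L`.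
  let _ : LieRingModule L F :=
    { bracket := fun l m => ⁅s l, m⁆
      add_lie := fun a b m => by rw [map_add, add_lie]
      lie_add := fun a m n => lie_add (s a) m n
      leibniz_lie := fun a b m => by
        change ⁅s a, ⁅s b, m⁆⁆ = ⁅s ⁅a, b⁆, m⁆ + ⁅s b, ⁅s a, m⁆⁆
        rw [leibniz_lie, hact ⁅s a, s b⁆ (s ⁅a, b⁆) m (by simp [hs'])] }
  let _ : LieModule k L F :=
    { smul_lie := fun c a m => by change ⁅s (c • a), m⁆ = c • ⁅s a, m⁆; rw [map_smul, smul_lie]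
      lie_smul := fun c a m => lie_smul c (s a) m }
  obtain ⟨v, hv⟩ := exists_eq_lie_of_isDerivation (d.comp s) (fun a b => by
    change d (s ⁅a, b⁆) = ⁅s a, d (s b)⁆ - ⁅s b, d (s a)⁆
    rw [hdd (s ⁅a, b⁆) ⁅s a, s b⁆ (by simp [hs']), hd]
    rfl)
  refine ⟨v, fun x => ?_⟩
  rw [hdd x (s (π x)) (by rw [hs']), hact x (s (π x)) v (by rw [hs'])]
  exact hv (π x)

/-- Averaging an element `w` of an `E`-module that is invariant modulo `T` to an element that is
invariant modulo `S`, if `E` acts on `T / S` through a semisimple quotient. -/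
lemma exists_sub_lie_mem {W : Type*} [AddCommGroup W] [Module k W] [LieRingModule E W]
    [LieModule k E W] (hπ : Function.Surjective π) (S T : LieSubmodule k E W)
    [Module.Finite k T] (w : W) (hw : ∀ x : E, ⁅x, w⁆ ∈ T) (hwS : ∀ x, π x = 0 → ⁅x, w⁆ ∈ S)
    (hTS : ∀ x : E, π x = 0 → ∀ t ∈ T, ⁅x, t⁆ ∈ S) :
    ∃ t ∈ T, ∀ x : E, ⁅x, w - t⁆ ∈ S := by
  let S' : LieSubmodule k E T := S.comap T.incl
  have : Module.Finite k (T ⧸ S') := inferInstanceAs (Module.Finite k (T ⧸ S'.toSubmodule))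
  let d₀ : E →ₗ[k] T :=
    { toFun := fun x => ⟨⁅x, w⁆, hw x⟩
      map_add' := fun x y => Subtype.ext (add_lie x y w)
      map_smul' := fun c x => Subtype.ext (smul_lie c x w) }
  -- Modulo `S`, the map `x ↦ ⁅x, w⁆` is a derivation into the finite-dimensional `T / S` that
  -- vanishes on `ker π`. It is therefore inner, and the element inducing it is the correction `t`.
  obtain ⟨v, hv⟩ := exists_eq_lie_of_vanishing (F := T ⧸ S') hπ
    (fun x hx m => by
      obtain ⟨m, rfl⟩ := LieSubmodule.Quotient.surjective_mk' S' m
      exact (LieSubmodule.Quotient.mk_eq_zero S').mpr (hTS x hx m m.2))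
    ((LieSubmodule.Quotient.mk' S' : T →ₗ[k] T ⧸ S').comp d₀)
    (fun x y => by
      have : d₀ ⁅x, y⁆ = ⁅x, d₀ y⁆ - ⁅y, d₀ x⁆ := Subtype.ext (lie_lie x y w)
      rw [LinearMap.comp_apply, this, map_sub]
      rfl)
    (fun x hx => (LieSubmodule.Quotient.mk_eq_zero S').mpr (hwS x hx))
  obtain ⟨t, rfl⟩ := LieSubmodule.Quotient.surjective_mk' S' v
  refine ⟨t, t.2, fun x => ?_⟩
  have h : d₀ x - ⁅x, t⁆ ∈ S' := by
    rw [← LieSubmodule.Quotient.mk_eq_zero, map_sub, sub_eq_zero]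
    exact hv x
  rw [lie_sub]
  exact h

variable {P M : Type*} [AddCommGroup P] [Module k P] [LieRingModule E P] [LieModule k E P]
  [AddCommGroup M] [Module k M] [LieRingModule E M] [LieModule k E M]

variable (M) in
/-- The linear maps `P → M` that vanish on `N`. -/
def vanishingOn (N : LieSubmodule k E P) : LieSubmodule k E (P →ₗ[k] M) where
  carrier := {φ | ∀ n ∈ N, φ n = 0}
  add_mem' ha hb n hn := by rw [LinearMap.add_apply, ha n hn, hb n hn, add_zero]
  zero_mem' n _ := rfl
  smul_mem' c φ h n hn := by rw [LinearMap.smul_apply, h n hn, smul_zero]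
  lie_mem {x φ} h n hn := by
    rw [LieHom.lie_apply, h n hn, h _ (N.lie_mem hn), lie_zero, sub_zero]

omit [CharZero k] in
-- Such maps factor through the finite-dimensional quotient by `N`.
lemma finite_vanishingOn (N : LieSubmodule k E P) [Module.Finite k (P ⧸ N.toSubmodule)]
    [Module.Finite k M] : Module.Finite k (vanishingOn M N) := by
  have h : (vanishingOn M N).toSubmodule ≤
      LinearMap.range (LinearMap.lcomp k M N.toSubmodule.mkQ) := fun φ hφ =>
    ⟨N.toSubmodule.liftQ φ hφ, by ext; rfl⟩
  have : Module.Finite k (vanishingOn M N).toSubmodule :=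
    Module.Finite.of_injective (Submodule.inclusion h) (Submodule.inclusion_injective h)
  exact this

/-- Extension of an equivariant map from a submodule of finite codimension. -/
lemma exists_equivariant_extension [Module.Finite k M] (hπ : Function.Surjective π)
    (hM : ∀ x, π x = 0 → ∀ m : M, ⁅x, m⁆ = 0)
    (N : LieSubmodule k E P) [Module.Finite k (P ⧸ N.toSubmodule)]
    (f : N →ₗ[k] M) (hf : ∀ (x : E) (n : N), f ⁅x, n⁆ = ⁅x, f n⁆)
    (hN : ∀ x, π x = 0 → ∀ p : P, ∃ h : ⁅x, p⁆ ∈ N, f ⟨⁅x, p⁆, h⟩ = 0) :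
    ∃ g : P →ₗ⁅k, E⁆ M, ∀ n : N, g n = f n := by
  obtain ⟨f', hf'⟩ := LinearMap.exists_extend (p := N.toSubmodule) f
  have hff : ∀ n : N, f' n = f n := fun n => LinearMap.congr_fun hf' n
  have := finite_vanishingOn (M := M) N
  have hK : ∀ x, π x = 0 → ⁅x, f'⁆ = 0 := fun x hx => by
    ext p
    obtain ⟨h, h0⟩ := hN x hx p
    rw [LieHom.lie_apply, hM x hx, zero_sub, LinearMap.zero_apply, neg_eq_zero, ← h0]
    exact hff ⟨_, h⟩
  -- The defect `⁅x, f'⁆` vanishes on `N` because `f` is equivariant, and is zero for `x` in `ker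
  -- π`. Averaging inside the maps that vanish on `N` removes it without changing the restriction to
  -- `N`.
  obtain ⟨t, ht, hinv⟩ := exists_sub_lie_mem hπ ⊥ (vanishingOn M N) f'
    (fun x n hn => by
      have h1 := hff ⟨n, hn⟩
      have h2 := hff ⁅x, (⟨n, hn⟩ : N)⁆
      rw [hf, LieSubmodule.coe_bracket] at h2
      rw [LieHom.lie_apply, h2, h1, sub_self])
    (fun x hx => (LieSubmodule.mem_bot _).mpr (hK x hx))
    (fun x hx φ hφ => by
      rw [LieSubmodule.mem_bot]
      ext p
      rw [LieHom.lie_apply, hM x hx, hφ _ (hN x hx p).choose, sub_zero, LinearMap.zero_apply])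
  refine ⟨{ f' - t with map_lie' := fun {x p} => ?_ }, fun n => ?_⟩
  · have h := LinearMap.congr_fun ((LieSubmodule.mem_bot _).mp (hinv x)) p
    rw [LieHom.lie_apply, LinearMap.zero_apply, sub_eq_zero] at h
    exact h.symm
  · change f' n - t n = f n
    rw [hff, ht n n.2, sub_zero]

variable (E M) in
/-- The inner derivation `x ↦ ⁅x, m⁆`, as a function of `m`. -/
def innerDerivation : M →ₗ⁅k, E⁆ (E →ₗ[k] M) where
  toFun m :=
    { toFun := fun x => ⁅x, m⁆
      map_add' := fun x y => add_lie x y m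
      map_smul' := fun c x => smul_lie c x m }
  map_add' m n := by ext x; exact lie_add x m n
  map_smul' c m := by ext x; exact lie_smul c x m
  map_lie' {x m} := by
    ext y
    change ⁅y, ⁅x, m⁆⁆ = ⁅x, ⁅y, m⁆⁆ - ⁅⁅x, y⁆, m⁆
    rw [lie_lie]
    abel

/-- An equivariant map on the kernel of a surjection onto a semisimple Lie algebra extends to
a derivation. -/
lemma exists_derivation_extension' [Module.Finite k M] (hπ : Function.Surjective π)
    (hM : ∀ x, π x = 0 → ∀ m : M, ⁅x, m⁆ = 0)
    (f : π.ker →ₗ[k] M) (hf : ∀ (x : E) (n : π.ker), f ⁅x, n⁆ = ⁅x, f n⁆) :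
    ∃ D : E →ₗ[k] M, IsDerivationAlong (k := k) LieHom.id D ∧ ∀ n : π.ker, D n = f n := by
  have hker : ∀ {x}, π x = 0 → x ∈ π.ker := fun hx => LieHom.mem_ker.mpr hx
  have hfin : Module.Finite k (E ⧸ (π.ker : LieSubmodule k E E).toSubmodule) := by
    have e := LinearMap.quotKerEquivOfSurjective (π : E →ₗ[k] L) hπ
    exact Module.Finite.equiv e.symm
  -- The invariants `M₀` split off by an equivariant retraction `r`. A derivation into the trivial
  -- module `M₀` is a map killing brackets, so this component of `f` is extended by an equivariant
  -- map `D₀`.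
  let M₀ := LieModule.maxTrivSubmodule k E M
  obtain ⟨r, hr⟩ := exists_equivariant_extension (M := M₀) hπ
    (fun x hx m => Subtype.ext (hM x hx m)) M₀ LinearMap.id (fun _ _ => rfl)
    (fun x hx m => ⟨by rw [hM x hx]; exact zero_mem _, Subtype.ext (hM x hx m)⟩)
  obtain ⟨D₀, hD₀⟩ := exists_equivariant_extension (M := M₀) hπ
    (fun x hx m => Subtype.ext (hM x hx m)) (π.ker : LieSubmodule k E E) ((r : M →ₗ[k] M₀).comp f)
    (fun x n => by rw [LinearMap.comp_apply, hf]; exact r.map_lie x _)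
    (fun x hx y => by
      have hmem : ⁅x, y⁆ ∈ (π.ker : LieSubmodule k E E) :=
        hker (by rw [LieHom.map_lie, hx, zero_lie])
      refine ⟨hmem, ?_⟩
      have h1 : (⟨⁅x, y⁆, hmem⟩ : π.ker) = -⁅y, (⟨x, hker hx⟩ : π.ker)⁆ :=
        Subtype.ext (lie_skew x y).symm
      rw [h1, map_neg, LinearMap.comp_apply, hf, neg_eq_zero]
      exact (r.map_lie y _).trans (Subtype.ext ((r (f ⟨x, hker hx⟩)).2 y)))
  obtain ⟨f', hf'⟩ := LinearMap.exists_extend (p := (π.ker : LieSubmodule k E E).toSubmodule) f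
  have hff : ∀ n : π.ker, f' n = f n := fun n => LinearMap.congr_fun hf' n
  have := finite_vanishingOn (M := M) (π.ker : LieSubmodule k E E)
  -- In `Hom(E, M)` an element `x` of the kernel sends `f'` to the inner derivation given by `f x`.
  -- Averaging modulo inner derivations gives an extension `f₁` such that every `⁅x, f₁⁆` is inner.
  obtain ⟨t, ht, hinn⟩ := exists_sub_lie_mem hπ (innerDerivation E M).range
    (vanishingOn M (π.ker : LieSubmodule k E E)) f'
    (fun x n hn => by
      have h1 := hff ⟨n, hn⟩
      have h2 := hff ⁅x, (⟨n, hn⟩ : π.ker)⁆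
      rw [hf, LieSubmodule.coe_bracket] at h2
      rw [LieHom.lie_apply, h2, h1, sub_self])
    (fun x hx => by
      refine (LieModuleHom.mem_range _ _).mpr ⟨f ⟨x, hker hx⟩, ?_⟩
      ext y
      have h2 := hff ⁅y, (⟨x, hker hx⟩ : π.ker)⁆
      rw [hf, LieSubmodule.coe_bracket] at h2
      rw [LieHom.lie_apply, hM x hx, zero_sub, ← lie_skew, map_neg, neg_neg, h2]
      rfl)
    (fun x hx φ hφ => by
      have : ⁅x, φ⁆ = 0 := by
        ext y
        rw [LieHom.lie_apply, hM x hx, hφ _ (hker (by rw [LieHom.map_lie, hx, zero_lie])),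
          sub_zero, LinearMap.zero_apply]
      rw [this]
      exact zero_mem _)
  let f₁ := f' - t
  have hf₁ : ∀ n : π.ker, f₁ n = f n := fun n => by
    rw [LinearMap.sub_apply, ht n n.2, sub_zero, hff]
  let φ : M →ₗ[k] E →ₗ[k] M := (innerDerivation E M : M →ₗ⁅k, E⁆ (E →ₗ[k] M)).toLinearMap
  have hφ : ∀ x, ∃ m, φ m = ⁅x, f₁⁆ := fun x => (LieModuleHom.mem_range _ _).mp (hinn x)
  obtain ⟨s, hs⟩ := LinearMap.exists_rightInverse_of_surjective φ.rangeRestrict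
    φ.range_rangeRestrict
  let c : E →ₗ[k] LinearMap.range φ :=
    { toFun := fun x => ⟨⁅x, f₁⁆, hφ x⟩
      map_add' := fun x y => Subtype.ext (add_lie x y f₁)
      map_smul' := fun a x => Subtype.ext (smul_lie a x f₁) }
  -- Here `m x` is a linear choice of an element inducing the inner derivation `⁅x, f₁⁆`. It is
  -- determined up to `M₀`, and as `x ↦ ⁅x, f₁⁆` is a derivation, `m` is one modulo `M₀`.
  let m := s.comp c
  have hm : ∀ x y, ⁅y, m x⁆ = ⁅x, f₁ y⁆ - f₁ ⁅x, y⁆ := fun x y => by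
    have h := congrArg Subtype.val (LinearMap.congr_fun hs (c x))
    exact LinearMap.congr_fun h y
  -- The equivariant projection with kernel `M₀` removes the ambiguity in `m`, so `q ∘ m` is an
  -- honest derivation.
  let q : M →ₗ[k] M := LinearMap.id - M₀.incl.toLinearMap.comp (r : M →ₗ[k] M₀)
  have hq : ∀ v, q v = v - r v := fun v => rfl
  have hq0 : ∀ v, (∀ y : E, ⁅y, v⁆ = 0) → q v = 0 := fun v hv => by
    have h := congrArg Subtype.val (hr ⟨v, hv⟩)
    rw [hq, sub_eq_zero]
    exact h.symm
  have hq_lie : ∀ (x : E) v, q ⁅x, v⁆ = ⁅x, q v⁆ := fun x v => by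
    rw [hq, hq, r.map_lie, lie_sub]
    rfl
  refine ⟨q.comp m + M₀.incl.toLinearMap.comp (D₀ : E →ₗ[k] M₀), fun x y => ?_, fun n => ?_⟩
  · have h0 : ∀ x y : E, (D₀ ⁅x, y⁆ : M) = 0 := fun x y => by
      rw [D₀.map_lie]
      exact (D₀ y).2 x
    have h0' : ∀ x y : E, ⁅x, (D₀ y : M)⁆ = 0 := fun x y => (D₀ y).2 x
    have h1 : q (m ⁅x, y⁆ - (⁅x, m y⁆ - ⁅y, m x⁆)) = 0 := hq0 _ fun z => by
      have e1 : ⁅z, ⁅x, m y⁆⁆ = ⁅y, f₁ ⁅z, x⁆⁆ - f₁ ⁅y, ⁅z, x⁆⁆ + ⁅x, ⁅y, f₁ z⁆ - f₁ ⁅y, z⁆⁆ := by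
        rw [leibniz_lie, hm, hm]
      have e2 : ⁅z, ⁅y, m x⁆⁆ = ⁅x, f₁ ⁅z, y⁆⁆ - f₁ ⁅x, ⁅z, y⁆⁆ + ⁅y, ⁅x, f₁ z⁆ - f₁ ⁅x, z⁆⁆ := by
        rw [leibniz_lie, hm, hm]
      rw [lie_sub, lie_sub, e1, e2, hm, ← lie_skew z x, ← lie_skew z y]
      simp only [lie_sub, lie_neg, map_neg, lie_lie, map_sub]
      abel
    change q (m ⁅x, y⁆) + (D₀ ⁅x, y⁆ : M) = ⁅x, q (m y) + (D₀ y : M)⁆ - ⁅y, q (m x) + (D₀ x : M)⁆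
    rw [map_sub, sub_eq_zero, map_sub, hq_lie, hq_lie] at h1
    rw [h1, h0, lie_add, lie_add, h0', h0', add_zero, add_zero, add_zero]
  -- On the kernel, `m n` and `f n` induce the same inner derivation and so differ by an invariant.
  -- Thus `q ∘ m` restricts to `q ∘ f`, and `D₀` supplies the missing `r ∘ f`.
  · have h1 : q (m n - f n) = 0 := hq0 _ fun z => by
      have h2 := hf₁ ⁅z, n⁆
      rw [hf, LieSubmodule.coe_bracket] at h2
      rw [lie_sub, hm, hM _ (LieHom.mem_ker.mp n.2), ← lie_skew, map_neg, h2]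
      abel
    rw [map_sub, sub_eq_zero] at h1
    change q (m n) + (D₀ n : M) = f n
    rw [h1, hD₀ n, hq]
    exact sub_add_cancel _ _

/-- An equivariant map on the kernel of a surjection onto a semisimple Lie algebra extends to
a derivation. -/
theorem exists_derivation_extension {M : Type*} [AddCommGroup M] [Module k M]
    [LieRingModule L M] [LieModule k L M] [Module.Finite k M] (hπ : Function.Surjective π)
    (f : π.ker →ₗ[k] M) (hf : ∀ (x : E) (n : π.ker), f ⁅x, n⁆ = ⁅π x, f n⁆) :
    ∃ D : E →ₗ[k] M, IsDerivationAlong π D ∧ ∀ n : π.ker, D n = f n := by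
  let _ := LieRingModule.compLieHom M π
  let _ := LieModule.compLieHom M π
  exact exists_derivation_extension' hπ
    (fun x hx m => by rw [LieRingModule.compLieHom_apply, hx, zero_lie]) f hf

/-- A derivation along a surjection onto a semisimple Lie algebra that vanishes on the kernel
is inner. -/
theorem exists_eq_lie_of_isDerivationAlong {M : Type*} [AddCommGroup M] [Module k M]
    [LieRingModule L M] [LieModule k L M] [Module.Finite k M] (hπ : Function.Surjective π)
    (d : E →ₗ[k] M) (hd : IsDerivationAlong π d) (hd0 : ∀ x, π x = 0 → d x = 0) :
    ∃ v, ∀ x, d x = ⁅π x, v⁆ := by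
  let _ := LieRingModule.compLieHom M π
  let _ := LieModule.compLieHom M π
  exact exists_eq_lie_of_vanishing hπ
    (fun x hx m => by rw [LieRingModule.compLieHom_apply, hx, zero_lie]) d hd hd0

end Inflation

end LieAlgebra

/-! ### Extensions and derivations -/

namespace EquivMap

section ExtDerivation

attribute [local instance 100] LieRing.ofAssociativeRing

variable {k : Type u} [Field k] {L V₁ V₂ : Type u} [LieRing L] [LieAlgebra k L]
  [AddCommGroup V₁] [Module k V₁] [AddCommGroup V₂] [Module k V₂]
  (ρ₁ : L →ₗ⁅k⁆ Module.End k V₁) (ρ₂ : L →ₗ⁅k⁆ Module.End k V₂)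

/-- The action of `x` on a linear map `V₁ → V₂`. -/
noncomputable def homAction (x : L) : (V₁ →ₗ[k] V₂) →ₗ[k] (V₁ →ₗ[k] V₂) :=
  LinearMap.llcomp k V₁ V₂ V₂ (ρ₂ x) - LinearMap.lcomp k V₂ (ρ₁ x)

lemma homAction_apply (x : L) (T : V₁ →ₗ[k] V₂) (v : V₁) :
    homAction ρ₁ ρ₂ x T v = ρ₂ x (T v) - T (ρ₁ x v) := rfl

/-- The derivations of `L` with values in `Hom(V₁, V₂)`. -/
noncomputable def derivations : Submodule k (L →ₗ[k] V₁ →ₗ[k] V₂) where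
  carrier := {D | ∀ x y, D ⁅x, y⁆ = homAction ρ₁ ρ₂ x (D y) - homAction ρ₁ ρ₂ y (D x)}
  add_mem' ha hb x y := by
    simp only [LinearMap.add_apply, ha x y, hb x y, map_add]
    abel
  zero_mem' x y := by simp
  smul_mem' c D h x y := by simp only [LinearMap.smul_apply, h x y, map_smul, smul_sub]

/-- The inner derivations of `L` with values in `Hom(V₁, V₂)`. -/
noncomputable def innerDerivations : Submodule k (derivations ρ₁ ρ₂) where
  carrier := {D | ∃ T, ∀ x, (D : L →ₗ[k] V₁ →ₗ[k] V₂) x = homAction ρ₁ ρ₂ x T}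
  add_mem' := by
    rintro _ _ ⟨S, hS⟩ ⟨T, hT⟩
    exact ⟨S + T, fun x => by rw [map_add, ← hS, ← hT]; rfl⟩
  zero_mem' := ⟨0, fun x => by rw [map_zero]; rfl⟩
  smul_mem' := by
    rintro c _ ⟨T, hT⟩
    exact ⟨c • T, fun x => by rw [map_smul, ← hT]; rfl⟩


/-- A `k`-linear map between `U(L)`-modules that commutes with the action of `L` is linear. -/
lemma map_smul_of_map_ι_smul {P W : Type u} [AddCommGroup P] [Module k P]
    [Module (UniversalEnvelopingAlgebra k L) P]
    [IsScalarTower k (UniversalEnvelopingAlgebra k L) P]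
    [AddCommGroup W] [Module k W] [Module (UniversalEnvelopingAlgebra k L) W]
    [IsScalarTower k (UniversalEnvelopingAlgebra k L) W] (S : Submodule (UniversalEnvelopingAlgebra k L) P)
    (h : P →ₗ[k] W)
    (hh : ∀ (x : L), ∀ p ∈ S, h (UniversalEnvelopingAlgebra.ι k x • p) =
      UniversalEnvelopingAlgebra.ι k x • h p) (a : UniversalEnvelopingAlgebra k L) {p : P}
    (hp : p ∈ S) : h (a • p) = a • h p := by
  let B : Subalgebra k (UniversalEnvelopingAlgebra k L) :=
    { carrier := {a : UniversalEnvelopingAlgebra k L | ∀ p ∈ S, h (a • p) = a • h p}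
      mul_mem' := fun {a b} ha hb p hp => by
        rw [mul_smul, ha _ (S.smul_mem b hp), hb p hp, mul_smul]
      add_mem' := fun {a b} ha hb p hp => by rw [add_smul, map_add, ha p hp, hb p hp, add_smul]
      algebraMap_mem' := fun c p hp => by
        have hP : algebraMap k (UniversalEnvelopingAlgebra k L) c • p = c • p :=
          algebraMap_smul _ c p
        have hW : algebraMap k (UniversalEnvelopingAlgebra k L) c • h p = c • h p :=
          algebraMap_smul _ c (h p)
        rw [hP, hW, map_smul] }
  let j : L →ₗ⁅k⁆ B :=
    { toFun := fun x => ⟨UniversalEnvelopingAlgebra.ι k x, hh x⟩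
      map_add' := fun x y => Subtype.ext (map_add _ x y)
      map_smul' := fun c x => Subtype.ext (map_smul _ c x)
      map_lie' := fun {x y} => Subtype.ext (LieHom.map_lie _ x y) }
  -- The scalars that commute with `h` form a subalgebra containing `L`; by the universal property
  -- the identity of `U(L)` factors through it.
  have hB : B.val.comp (UniversalEnvelopingAlgebra.lift k j) = AlgHom.id k (UniversalEnvelopingAlgebra k L) := by
    refine UniversalEnvelopingAlgebra.hom_ext k ?_
    ext x
    change B.val (UniversalEnvelopingAlgebra.lift k j (UniversalEnvelopingAlgebra.ι k x)) = _
    rw [UniversalEnvelopingAlgebra.lift_ι_apply]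
    rfl
  have ha : a ∈ B := by
    rw [show a = B.val (UniversalEnvelopingAlgebra.lift k j a) from
      (DFunLike.congr_fun hB a).symm]
    exact Subtype.prop _
  exact ha p hp

/-! ### The extension module defined by a derivation -/

section ExtensionRep

variable {ρ₁ ρ₂}

/-- The extension of `V₁` by `V₂` given by a derivation. -/
noncomputable def extensionRep (D : derivations ρ₁ ρ₂) : L →ₗ⁅k⁆ Module.End k (V₂ × V₁) where
  toFun x := ((ρ₂ x).comp (LinearMap.fst k V₂ V₁) +
    ((D : L →ₗ[k] V₁ →ₗ[k] V₂) x).comp (LinearMap.snd k V₂ V₁)).prod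
      ((ρ₁ x).comp (LinearMap.snd k V₂ V₁))
  map_add' x y := by
    refine LinearMap.ext fun v => Prod.ext ?_ ?_
    · simp
      abel
    · simp
  map_smul' c x := by
    refine LinearMap.ext fun v => Prod.ext ?_ ?_ <;> simp
  map_lie' {x y} := by
    have h := D.2 x y
    refine LinearMap.ext fun v => Prod.ext ?_ ?_
    · simp [h, LieRing.of_associative_ring_bracket, homAction_apply]
      abel
    · simp [LieRing.of_associative_ring_bracket]

/-- The `U(L)`-module underlying `extensionRep`. -/
def ExtensionSpace (_ : derivations ρ₁ ρ₂) : Type u := V₂ × V₁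

namespace ExtensionSpace

variable (D : derivations ρ₁ ρ₂)

instance : AddCommGroup (ExtensionSpace D) := inferInstanceAs (AddCommGroup (V₂ × V₁))

instance : Module k (ExtensionSpace D) := inferInstanceAs (Module k (V₂ × V₁))

noncomputable instance : Module (UniversalEnvelopingAlgebra k L) (ExtensionSpace D) :=
  Module.compHom (V₂ × V₁) (UniversalEnvelopingAlgebra.lift k (extensionRep D)).toRingHom

variable {D}

lemma smul_def (a : UniversalEnvelopingAlgebra k L) (v : ExtensionSpace D) :
    a • v = UniversalEnvelopingAlgebra.lift k (extensionRep D) a v := rfl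

instance : IsScalarTower k (UniversalEnvelopingAlgebra k L) (ExtensionSpace D) :=
  ⟨fun c a v => by rw [smul_def, smul_def, map_smul]; rfl⟩

lemma ι_smul (x : L) (v : ExtensionSpace D) :
    UniversalEnvelopingAlgebra.ι k x • v = extensionRep D x v := by
  rw [smul_def, UniversalEnvelopingAlgebra.lift_ι_apply]

end ExtensionSpace

end ExtensionRep

/-! #### The linear algebra of a presentation -/

section Presentation

open UniversalEnvelopingAlgebra (ι)

variable [Module (UniversalEnvelopingAlgebra k L) V₁]
  [IsScalarTower k (UniversalEnvelopingAlgebra k L) V₁]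
  [Module (UniversalEnvelopingAlgebra k L) V₂]
  [IsScalarTower k (UniversalEnvelopingAlgebra k L) V₂]
  {P : Type u} [AddCommGroup P] [Module k P] [Module (UniversalEnvelopingAlgebra k L) P]
  [IsScalarTower k (UniversalEnvelopingAlgebra k L) P]
  (π : P →ₗ[UniversalEnvelopingAlgebra k L] V₁)

variable (V₂) in
/-- The `k`-linear maps `P → V₂` that are `U(L)`-linear on the kernel of `π`. -/
noncomputable def partialHoms : Submodule k (P →ₗ[k] V₂) where
  carrier := {h | ∀ (x : L), ∀ p ∈ LinearMap.ker π, h (ι k x • p) = ι k x • h p}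
  add_mem' ha hb x p hp := by
    rw [LinearMap.add_apply, LinearMap.add_apply, ha x p hp, hb x p hp, smul_add]
  zero_mem' x p hp := by simp
  smul_mem' c h hh x p hp := by
    rw [LinearMap.smul_apply, LinearMap.smul_apply, hh x p hp]
    rw [← algebraMap_smul (UniversalEnvelopingAlgebra k L) c (ι k x • h p),
      ← algebraMap_smul (UniversalEnvelopingAlgebra k L) c (h p), smul_smul, smul_smul,
      Algebra.commutes]

variable {ρ₁ ρ₂} {π} (h₁ : ∀ x v, ρ₁ x v = ι k x • v) (h₂ : ∀ x v, ρ₂ x v = ι k x • v)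
  (σ : V₁ →ₗ[k] P) (hσ : ∀ v, π (σ v) = v)

omit [IsScalarTower k (UniversalEnvelopingAlgebra k L) V₁]
  [IsScalarTower k (UniversalEnvelopingAlgebra k L) P] in
include h₂ hσ in
-- `σ (π p) - p` lies in the kernel of `π`, where `h` commutes with `L`. Hence the derivation
-- attached to `h` can be computed at `π p` from any lift, not only from the one chosen by `σ`.
lemma section_apply (h : partialHoms V₂ π) (x : L) (p : P) :
    ρ₂ x ((h : P →ₗ[k] V₂) (σ (π p))) - (h : P →ₗ[k] V₂) (ι k x • σ (π p)) =
      ρ₂ x ((h : P →ₗ[k] V₂) p) - (h : P →ₗ[k] V₂) (ι k x • p) := by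
  have h3 := h.2 x (σ (π p) - p) (by rw [LinearMap.mem_ker, map_sub, hσ, sub_self])
  rw [smul_sub, map_sub, map_sub, smul_sub] at h3
  rw [h₂, h₂, sub_eq_sub_iff_sub_eq_sub]
  exact h3.symm

/-- The derivation attached to a map that is `U(L)`-linear on the kernel of `π`. -/
noncomputable def derivationOf : partialHoms V₂ π →ₗ[k] derivations ρ₁ ρ₂ where
  toFun h :=
    ⟨{  toFun := fun x => ρ₂ x ∘ₗ (h : P →ₗ[k] V₂) ∘ₗ σ -
          (h : P →ₗ[k] V₂) ∘ₗ Algebra.lsmul k k P (ι k x) ∘ₗ σ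
        map_add' := fun x y => by
          ext v
          simp
          abel
        map_smul' := fun c x => by
          ext v
          simp [smul_sub] },
      fun x y => by
        ext v
        have key : ∀ (x : L) (p : P), ρ₂ x ((h : P →ₗ[k] V₂) (σ (π p))) -
          (h : P →ₗ[k] V₂) (ι k x • σ (π p)) =
            ρ₂ x ((h : P →ₗ[k] V₂) p) - (h : P →ₗ[k] V₂) (ι k x • p) := section_apply h₂ σ hσ h
        have key' : ∀ x y : L, ρ₂ x ((h : P →ₗ[k] V₂) (σ (ρ₁ y v))) -
          (h : P →ₗ[k] V₂) (ι k x • σ (ρ₁ y v)) = ρ₂ x ((h : P →ₗ[k] V₂) (ι k y • σ v)) -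
            (h : P →ₗ[k] V₂) (ι k x • ι k y • σ v) := fun x y => by
          rw [← key x (ι k y • σ v), map_smul π, hσ, h₁]
        simp only [LinearMap.coe_mk, AddHom.coe_mk, homAction_apply, LinearMap.sub_apply,
          LinearMap.comp_apply, Algebra.lsmul_coe, LieHom.map_lie, map_sub,
          LieRing.of_associative_ring_bracket, mul_smul, Module.End.mul_apply]
        linear_combination (norm := abel) key' y x - key' x y⟩
  map_add' h g := by
    ext x v
    simp
    abel
  map_smul' c h := by
    ext x v
    simp [smul_sub]

omit [IsScalarTower k (UniversalEnvelopingAlgebra k L) V₁] in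
lemma derivationOf_apply (h : partialHoms V₂ π) (x : L) (p : P) :
    (derivationOf h₁ h₂ σ hσ h : L →ₗ[k] V₁ →ₗ[k] V₂) x (π p) =
      ρ₂ x ((h : P →ₗ[k] V₂) p) - (h : P →ₗ[k] V₂) (ι k x • p) :=
  section_apply h₂ σ hσ h x p

/-- By projectivity, `π` lifts to a `U(L)`-linear map from `P` to the extension defined by `D`. Its
`V₂`-component, up to sign, is the required partial homomorphism. -/
lemma derivationOf_surjective [Module.Projective (UniversalEnvelopingAlgebra k L) P] :
    Function.Surjective (derivationOf h₁ h₂ σ hσ) := by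
  intro D
  let E := ExtensionSpace D
  let q₀ : E →ₗ[k] V₁ := LinearMap.snd k V₂ V₁
  let q : E →ₗ[UniversalEnvelopingAlgebra k L] V₁ :=
    { q₀ with
      map_smul' := fun a v => map_smul_of_map_ι_smul ⊤ q₀
        (fun x v _ => by rw [ExtensionSpace.ι_smul, ← h₁]; rfl) a (p := v) trivial }
  obtain ⟨g, hg⟩ := Module.projective_lifting_property q π (fun v => ⟨((0 : V₂), v), rfl⟩)
  have hg2 : ∀ p, (g p).2 = π p := fun p => LinearMap.congr_fun hg p
  -- The sign is needed because `D` enters the action on the extension with a plus, while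
  -- `derivationOf` measures `ρ₂ x (h p) - h (x p)`.
  let h : P →ₗ[k] V₂ := -(LinearMap.fst k V₂ V₁ ∘ₗ (g.restrictScalars k : P →ₗ[k] E))
  have hh : ∀ p, h p = -(g p).1 := fun p => rfl
  have hgx : ∀ (x : L) p, h (ι k x • p) =
      ρ₂ x (h p) - (D : L →ₗ[k] V₁ →ₗ[k] V₂) x (π p) := fun x p => by
    have e : (ι k x • g p : ExtensionSpace D).1 =
        ρ₂ x (g p).1 + (D : L →ₗ[k] V₁ →ₗ[k] V₂) x (g p).2 := by
      rw [ExtensionSpace.ι_smul]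
      rfl
    rw [hh, map_smul, e, hg2, hh, map_neg]
    abel
  refine ⟨⟨h, fun x p hp => ?_⟩, ?_⟩
  · rw [hgx, LinearMap.mem_ker.mp hp, map_zero, sub_zero, h₂]
  · ext x v
    obtain ⟨p, rfl⟩ : ∃ p, π p = v := ⟨σ v, hσ v⟩
    rw [derivationOf_apply, hgx]
    abel

/-- The derivation of `h` is induced by `T` exactly when `h - T ∘ π` is `U(L)`-linear, and
subtracting `T ∘ π` does not change `h` on `ker π`. Conversely `h - g` vanishes on the kernel and so
descends to a suitable `T`. -/
lemma derivationOf_mem_inner_iff (h : partialHoms V₂ π) :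
    derivationOf h₁ h₂ σ hσ h ∈ innerDerivations ρ₁ ρ₂ ↔
      ∃ g : P →ₗ[UniversalEnvelopingAlgebra k L] V₂,
        ∀ p ∈ LinearMap.ker π, (h : P →ₗ[k] V₂) p = g p := by
  constructor
  · rintro ⟨T, hT⟩
    let g₀ : P →ₗ[k] V₂ := h - T ∘ₗ (π.restrictScalars k)
    refine ⟨{ g₀ with
      map_smul' := fun a p => map_smul_of_map_ι_smul ⊤ g₀ (fun x p _ => ?_) a (p := p) trivial }, fun p hp => ?_⟩
    · have := LinearMap.congr_fun (hT x) (π p)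
      rw [derivationOf_apply, homAction_apply] at this
      change (h : P →ₗ[k] V₂) (ι k x • p) - T (π (ι k x • p)) =
        ι k x • ((h : P →ₗ[k] V₂) p - T (π p))
      rw [smul_sub, ← h₂, ← h₂, map_smul π, ← h₁]
      rw [sub_eq_sub_iff_add_eq_add] at this ⊢
      rw [add_comm, this, add_comm]
    · change _ = (h : P →ₗ[k] V₂) p - T (π p)
      rw [LinearMap.mem_ker.mp hp, map_zero, sub_zero]
  · rintro ⟨g, hg⟩
    have hgσ : ∀ p, (h : P →ₗ[k] V₂) (σ (π p)) - g (σ (π p)) = (h : P →ₗ[k] V₂) p - g p :=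
      fun p => by
        have h3 := hg (σ (π p) - p) (by rw [LinearMap.mem_ker, map_sub, hσ, sub_self])
        rw [map_sub, map_sub] at h3
        rw [sub_eq_sub_iff_sub_eq_sub]
        exact h3
    refine ⟨((h : P →ₗ[k] V₂) - g.restrictScalars k) ∘ₗ σ, fun x => ?_⟩
    ext v
    obtain ⟨p, rfl⟩ : ∃ p, π p = v := ⟨σ v, hσ v⟩
    rw [derivationOf_apply, homAction_apply]
    change _ = ρ₂ x ((h : P →ₗ[k] V₂) (σ (π p)) - g (σ (π p))) -
      ((h : P →ₗ[k] V₂) (σ (ρ₁ x (π p))) - g (σ (ρ₁ x (π p))))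
    rw [hgσ, h₁, ← map_smul π, hgσ, map_sub, map_smul g, h₂ x (g p)]
    abel

/-- The `U(L)`-linear restriction to the kernel of `π`. -/
noncomputable def restrictKer (h : partialHoms V₂ π) :
    LinearMap.ker π →ₗ[UniversalEnvelopingAlgebra k L] V₂ where
  toFun p := (h : P →ₗ[k] V₂) p
  map_add' _ _ := map_add _ _ _
  map_smul' a p := map_smul_of_map_ι_smul (LinearMap.ker π) (h : P →ₗ[k] V₂) h.2 a p.2

omit [Module k V₁] [IsScalarTower k (UniversalEnvelopingAlgebra k L) V₁] in
lemma restrictKer_surjective : Function.Surjective (restrictKer (V₂ := V₂) (π := π)) := by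
  intro f
  obtain ⟨h, hh⟩ := LinearMap.exists_extend (p := (LinearMap.ker π).restrictScalars k)
    (f.restrictScalars k)
  have hf : ∀ p : LinearMap.ker π, h p = f p := fun p => LinearMap.congr_fun hh p
  refine ⟨⟨h, fun x p hp => ?_⟩, LinearMap.ext hf⟩
  have h1 := hf ⟨p, hp⟩
  have h2 := hf (ι k x • ⟨p, hp⟩)
  rw [map_smul, ← h1] at h2
  exact h2

end Presentation

/-! ### The connecting homomorphism of a presentation -/

open scoped ModuleCat in
/-- The connecting map attached to a presentation of `V₁`. -/
noncomputable def extOfPartialHom {X Y P : Type u} [AddCommGroup X]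
    [Module (UniversalEnvelopingAlgebra k L) X] [AddCommGroup Y] [Module k Y]
    [Module (UniversalEnvelopingAlgebra k L) Y] [IsScalarTower k (UniversalEnvelopingAlgebra k L) Y]
    [AddCommGroup P] [Module k P] [Module (UniversalEnvelopingAlgebra k L) P]
    [IsScalarTower k (UniversalEnvelopingAlgebra k L) P]
    {π : P →ₗ[UniversalEnvelopingAlgebra k L] X} (hπ : Function.Surjective π) :
    partialHoms Y π →ₗ[k]
      Abelian.Ext.{u} (ModuleCat.of (UniversalEnvelopingAlgebra k L) X)
        (ModuleCat.of (UniversalEnvelopingAlgebra k L) Y) 1 where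
  toFun h := (LinearMap.shortExact_shortComplexKer hπ).extClass.comp
    (Abelian.Ext.mk₀ (ModuleCat.ofHom (restrictKer h))) (add_zero 1)
  map_add' h g := by
    rw [← Abelian.Ext.comp_add, ← Abelian.Ext.mk₀_add]
    rfl
  map_smul' c h := by
    rw [RingHom.id_apply, ← Abelian.Ext.comp_smul, ← Abelian.Ext.mk₀_smul]
    congr 2
    ext p
    exact (algebraMap_smul (UniversalEnvelopingAlgebra k L) c ((h : P →ₗ[k] Y) p)).symm

open scoped ModuleCat in
-- In the long exact sequence `Ext¹(P, Y) = 0`, so every class comes from a map on `ker π`, and such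
-- a map extends `k`-linearly to `P`.
lemma extOfPartialHom_surjective {X Y P : Type u} [AddCommGroup X]
    [Module (UniversalEnvelopingAlgebra k L) X] [AddCommGroup Y] [Module k Y]
    [Module (UniversalEnvelopingAlgebra k L) Y] [IsScalarTower k (UniversalEnvelopingAlgebra k L) Y]
    [AddCommGroup P] [Module k P] [Module (UniversalEnvelopingAlgebra k L) P]
    [IsScalarTower k (UniversalEnvelopingAlgebra k L) P]
    [Module.Projective (UniversalEnvelopingAlgebra k L) P]
    {π : P →ₗ[UniversalEnvelopingAlgebra k L] X} (hπ : Function.Surjective π) :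
    Function.Surjective (extOfPartialHom (Y := Y) hπ) := by
  intro e
  have hS := LinearMap.shortExact_shortComplexKer hπ
  have : Projective (ModuleCat.of (UniversalEnvelopingAlgebra k L) P) :=
    (IsProjective.iff_projective P).mp inferInstance
  obtain ⟨f, hf⟩ := Abelian.Ext.contravariant_sequence_exact₃ hS (ModuleCat.of _ Y) e
    (Abelian.Ext.eq_zero_of_projective (P := ModuleCat.of (UniversalEnvelopingAlgebra k L) P) _)
    (add_zero 1)
  obtain ⟨f, rfl⟩ := (Abelian.Ext.mk₀_bijective _ _).2 f
  obtain ⟨h, hh⟩ := restrictKer_surjective (V₂ := Y) (π := π) f.hom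
  refine ⟨h, ?_⟩
  rw [← hf]
  change hS.extClass.comp (Abelian.Ext.mk₀ (ModuleCat.ofHom (restrictKer h))) (add_zero 1) = _
  rw [hh]
  rfl

open scoped ModuleCat in
-- Exactness at `Hom(ker π, Y)`: the connecting map kills exactly the restrictions of maps from `P`.
lemma extOfPartialHom_eq_zero_iff {X Y P : Type u} [AddCommGroup X]
    [Module (UniversalEnvelopingAlgebra k L) X] [AddCommGroup Y] [Module k Y]
    [Module (UniversalEnvelopingAlgebra k L) Y] [IsScalarTower k (UniversalEnvelopingAlgebra k L) Y]
    [AddCommGroup P] [Module k P] [Module (UniversalEnvelopingAlgebra k L) P]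
    [IsScalarTower k (UniversalEnvelopingAlgebra k L) P]
    {π : P →ₗ[UniversalEnvelopingAlgebra k L] X} (hπ : Function.Surjective π)
    (h : partialHoms Y π) : extOfPartialHom hπ h = 0 ↔
      ∃ g : P →ₗ[UniversalEnvelopingAlgebra k L] Y,
        ∀ p ∈ LinearMap.ker π, (h : P →ₗ[k] Y) p = g p := by
  have hS := LinearMap.shortExact_shortComplexKer hπ
  constructor
  · intro h0
    obtain ⟨g, hg⟩ := Abelian.Ext.contravariant_sequence_exact₁ hS (ModuleCat.of _ Y)
      (Abelian.Ext.mk₀ (ModuleCat.ofHom (restrictKer h))) (add_zero 1) h0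
    obtain ⟨g, rfl⟩ := (Abelian.Ext.mk₀_bijective _ _).2 g
    rw [Abelian.Ext.mk₀_comp_mk₀] at hg
    have hg' := (Abelian.Ext.mk₀_bijective _ _).1 hg
    refine ⟨g.hom, fun p hp => ?_⟩
    exact (LinearMap.congr_fun (congrArg ModuleCat.Hom.hom hg') ⟨p, hp⟩).symm
  · rintro ⟨g, hg⟩
    have e : ModuleCat.ofHom (restrictKer h) =
        (LinearMap.shortComplexKer π).f ≫ ModuleCat.ofHom g := by
      ext p
      exact hg p p.2
    change hS.extClass.comp (Abelian.Ext.mk₀ (ModuleCat.ofHom (restrictKer h))) (add_zero 1) = 0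
    rw [e, ← Abelian.Ext.mk₀_comp_mk₀, ← Abelian.Ext.comp_assoc_of_second_deg_zero,
      hS.extClass_comp, Abelian.Ext.zero_comp]

/-- Two surjections with the same kernel have isomorphic targets. -/
lemma nonempty_equiv_of_surjective {X Y Z : Type*} [AddCommGroup X] [Module k X]
    [AddCommGroup Y] [Module k Y] [AddCommGroup Z] [Module k Z] (f : X →ₗ[k] Y) (g : X →ₗ[k] Z)
    (hf : Function.Surjective f) (hg : Function.Surjective g) (h : ∀ x, f x = 0 ↔ g x = 0) :
    Nonempty (Y ≃ₗ[k] Z) :=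
  ⟨(LinearMap.quotKerEquivOfSurjective f hf).symm ≪≫ₗ
    Submodule.quotEquivOfEq _ _ (by ext x; exact h x) ≪≫ₗ
    LinearMap.quotKerEquivOfSurjective g hg⟩

/-- `Ext¹(V₁, V₂)` is the space of derivations with values in `Hom(V₁, V₂)`, modulo the inner
derivations. -/
theorem nonempty_ext1_equiv {Z : Type*} [AddCommGroup Z] [Module k Z]
    (Φ : derivations ρ₁ ρ₂ →ₗ[k] Z) (hΦ : Function.Surjective Φ)
    (hΦ0 : ∀ D, Φ D = 0 ↔ D ∈ innerDerivations ρ₁ ρ₂) :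
    Nonempty (Ext1 ρ₁ ρ₂ ≃ₗ[k] Z) := by
  let _ : Module (UniversalEnvelopingAlgebra k L) V₁ :=
    Module.compHom V₁ (UniversalEnvelopingAlgebra.lift k ρ₁).toRingHom
  let _ : Module (UniversalEnvelopingAlgebra k L) V₂ :=
    Module.compHom V₂ (UniversalEnvelopingAlgebra.lift k ρ₂).toRingHom
  have hs₁ : ∀ (a : UniversalEnvelopingAlgebra k L) (v : V₁),
    a • v = UniversalEnvelopingAlgebra.lift k ρ₁ a v := fun _ _ => rfl
  have hs₂ : ∀ (a : UniversalEnvelopingAlgebra k L) (v : V₂),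
    a • v = UniversalEnvelopingAlgebra.lift k ρ₂ a v := fun _ _ => rfl
  have _ : IsScalarTower k (UniversalEnvelopingAlgebra k L) V₁ :=
    ⟨fun c a v => by rw [hs₁, hs₁, map_smul]; rfl⟩
  have _ : IsScalarTower k (UniversalEnvelopingAlgebra k L) V₂ :=
    ⟨fun c a v => by rw [hs₂, hs₂, map_smul]; rfl⟩
  have h₁ : ∀ x v, ρ₁ x v = UniversalEnvelopingAlgebra.ι k x • v := fun x v => by
    rw [hs₁, UniversalEnvelopingAlgebra.lift_ι_apply]
  have h₂ : ∀ x v, ρ₂ x v = UniversalEnvelopingAlgebra.ι k x • v := fun x v => by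
    rw [hs₂, UniversalEnvelopingAlgebra.lift_ι_apply]
  -- The free module on the underlying set of `V₁` serves as projective presentation.
  let π : (V₁ →₀ UniversalEnvelopingAlgebra k L) →ₗ[UniversalEnvelopingAlgebra k L] V₁ :=
    Finsupp.linearCombination (UniversalEnvelopingAlgebra k L) id
  have hπ : Function.Surjective π := fun v =>
    ⟨Finsupp.single v 1, by simp [π]⟩
  obtain ⟨σ, hσ⟩ := LinearMap.exists_rightInverse_of_surjective (π.restrictScalars k)
    (LinearMap.range_eq_top.mpr hπ)
  have hσ' : ∀ v, π (σ v) = v := LinearMap.congr_fun hσ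
  -- Both `Ext¹` and `Z` are quotients of the partial homomorphisms, by the same subspace: those
  -- agreeing on `ker π` with a `U(L)`-linear map on all of `P`.
  exact nonempty_equiv_of_surjective
    (extOfPartialHom (X := V₁) (Y := V₂) (π := π) hπ)
    (Φ ∘ₗ derivationOf h₁ h₂ σ hσ') (extOfPartialHom_surjective hπ)
    (hΦ.comp (derivationOf_surjective h₁ h₂ σ hσ'))
    (fun h => (extOfPartialHom_eq_zero_iff hπ h).trans
      ((derivationOf_mem_inner_iff h₁ h₂ σ hσ' h).symm.trans (hΦ0 _).symm))

end ExtDerivation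

end EquivMap

/-! ### Extensions of evaluation modules and equivariant maps on the kernel -/

namespace EquivMap

section KerHoms

attribute [local instance 100] LieRing.ofAssociativeRing

/-- Equivariant linear maps on the kernel of `π : E → L` with values in an `L`-module. -/
noncomputable def kerHoms {k E L : Type*} [Field k] [LieRing E] [LieAlgebra k E] [LieRing L]
    [LieAlgebra k L] (π : E →ₗ⁅k⁆ L) (M : Type*) [AddCommGroup M] [Module k M]
    [LieRingModule L M] [LieModule k L M] : Submodule k (π.ker →ₗ[k] M) where
  carrier := {f | ∀ (α : E) (n : π.ker), f ⁅α, n⁆ = ⁅π α, f n⁆}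
  add_mem' ha hb α n := by
    rw [LinearMap.add_apply, LinearMap.add_apply, ha α n, hb α n, lie_add]
  zero_mem' α n := by simp
  smul_mem' c f h α n := by rw [LinearMap.smul_apply, LinearMap.smul_apply, h α n, lie_smul]

variable {k : Type u} [Field k] [CharZero k] {E L V₁ V₂ M : Type u} [LieRing E] [LieAlgebra k E]
  [LieRing L] [LieAlgebra k L] [Module.Finite k L] [LieAlgebra.IsKilling k L]
  [AddCommGroup V₁] [Module k V₁] [LieRingModule L V₁] [LieModule k L V₁]
  [AddCommGroup V₂] [Module k V₂] [LieRingModule L V₂] [LieModule k L V₂]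
  [AddCommGroup M] [Module k M] [LieRingModule L M] [LieModule k L M] [Module.Finite k M]
  {π : E →ₗ⁅k⁆ L}

/-- For modules over a semisimple quotient `L` of `E`, the extensions of `E`-modules are given by
the equivariant maps from the kernel of `E → L` to `Hom(V₁, V₂)`. -/
theorem nonempty_ext1_equiv_kerHoms (hπ : Function.Surjective π) (e : M ≃ₗ[k] (V₁ →ₗ[k] V₂))
    (he : ∀ (l : L) (m : M) (v : V₁), e ⁅l, m⁆ v = ⁅l, e m v⁆ - e m ⁅l, v⁆) :
    Nonempty (Ext1 ((LieModule.toEnd k L V₁).comp π) ((LieModule.toEnd k L V₂).comp π) ≃ₗ[k]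
      kerHoms π M) := by
  set ρ₁ := (LieModule.toEnd k L V₁).comp π
  set ρ₂ := (LieModule.toEnd k L V₂).comp π
  have hact : ∀ (y : E) (m : M), e ⁅π y, m⁆ = homAction ρ₁ ρ₂ y (e m) := fun y m => by
    ext v
    exact he _ _ _
  have hact' : ∀ (y : E) (T : V₁ →ₗ[k] V₂), e.symm (homAction ρ₁ ρ₂ y T) = ⁅π y, e.symm T⁆ :=
    fun y T => by rw [LinearEquiv.symm_apply_eq, hact, e.apply_symm_apply]
  have hder : ∀ D : derivations ρ₁ ρ₂, LieAlgebra.IsDerivationAlong π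
      (e.symm.toLinearMap ∘ₗ (D : E →ₗ[k] V₁ →ₗ[k] V₂)) := fun D y z => by
    simp only [LinearMap.comp_apply, LinearEquiv.coe_coe]
    rw [D.2 y z, map_sub, hact', hact']
  -- For `n` in the kernel the term `⁅π n, D α⁆` drops out of the derivation rule, and what remains
  -- is equivariance.
  let Φ : derivations ρ₁ ρ₂ →ₗ[k] kerHoms π M :=
    { toFun := fun D => ⟨e.symm.toLinearMap ∘ₗ (D : E →ₗ[k] V₁ →ₗ[k] V₂) ∘ₗ
          (π.ker.toSubmodule.subtype), fun α n => by
        have := hder D α n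
        rw [LieHom.mem_ker.mp n.2, zero_lie, sub_zero] at this
        exact this⟩
      map_add' := fun D D' => by
        ext n
        exact map_add e.symm _ _
      map_smul' := fun c D => by
        ext n
        exact map_smul e.symm _ _ }
  have hΦ : ∀ D n, (Φ D : π.ker →ₗ[k] M) n = e.symm ((D : E →ₗ[k] V₁ →ₗ[k] V₂) n) :=
    fun _ _ => rfl
  refine nonempty_ext1_equiv ρ₁ ρ₂ Φ (fun f => ?_) (fun D => ⟨fun h => ?_, ?_⟩)
  · obtain ⟨D, hD, hDf⟩ := LieAlgebra.exists_derivation_extension hπ (f : π.ker →ₗ[k] M) f.2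
    refine ⟨⟨e.toLinearMap ∘ₗ D, fun y z => ?_⟩, ?_⟩
    · simp only [LinearMap.comp_apply, LinearEquiv.coe_coe]
      rw [hD y z, map_sub, hact, hact]
    · ext n
      rw [hΦ, ← hDf]
      exact e.symm_apply_apply _
  · obtain ⟨m, hm⟩ := LieAlgebra.exists_eq_lie_of_isDerivationAlong hπ _ (hder D) (fun y hy =>
      DFunLike.congr_fun (congrArg Subtype.val h) (⟨y, LieHom.mem_ker.mpr hy⟩ : π.ker))
    exact ⟨e m, fun y => by rw [← hact, ← hm y]; exact (e.apply_symm_apply _).symm⟩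
  · rintro ⟨T, hT⟩
    ext n
    rw [hΦ, hT, hact', LieHom.mem_ker.mp n.2, zero_lie]
    rfl

omit [CharZero k] [Module.Finite k L] [LieAlgebra.IsKilling k L] in
lemma dualTensorHomEquiv_lie [Module.Finite k V₁] (l : L) (t : Module.Dual k V₁ ⊗[k] V₂) (v : V₁) :
    dualTensorHomEquiv (R := k) (M := V₁) (N := V₂) ⁅l, t⁆ v =
      ⁅l, dualTensorHomEquiv (R := k) (M := V₁) (N := V₂) t v⁆ -
        dualTensorHomEquiv (R := k) (M := V₁) (N := V₂) t ⁅l, v⁆ := by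
  induction t using TensorProduct.induction_on with
  | zero =>
    have h : ⁅l, (0 : Module.Dual k V₁ ⊗[k] V₂)⁆ = 0 :=
      map_zero (LieModule.toEnd k L (Module.Dual k V₁ ⊗[k] V₂) l)
    rw [h]
    simp
  | add s t hs ht =>
    have h : ⁅l, s + t⁆ = ⁅l, s⁆ + ⁅l, t⁆ := lie_add l s t
    rw [h]
    simp only [map_add, LinearMap.add_apply, hs, ht, lie_add]
    abel
  | tmul f w => simp [TensorProduct.LieModule.lie_tmul_right, add_comm, sub_eq_add_neg]

omit [CharZero k] in
/-- A linear surjection with kernel `W` splits. -/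
lemma nonempty_equiv_prod_of_surjective {X Z : Type*} [AddCommGroup X] [Module k X]
    [AddCommGroup Z] [Module k Z] (f : X →ₗ[k] Z) (hf : Function.Surjective f) :
    Nonempty (X ≃ₗ[k] Z × LinearMap.ker f) := by
  obtain ⟨W, hW⟩ := Submodule.exists_isCompl (LinearMap.ker f)
  exact ⟨(Submodule.prodEquivOfIsCompl _ _ hW).symm ≪≫ₗ LinearEquiv.prodComm k _ _ ≪≫ₗ
    ((Submodule.quotientEquivOfIsCompl _ _ hW).symm ≪≫ₗ
      LinearMap.quotKerEquivOfSurjective f hf).prodCongr (LinearEquiv.refl k _)⟩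

end KerHoms

end EquivMap

/-! ### Averaging -/

namespace EquivMap

section Averaging

/-- `A / J` is a quotient of the image of `f`, so it is finite-dimensional; `J / J²` is finite over
it because `A` is Noetherian. -/
lemma finite_cotangent {k A W : Type*} [Field k] [CommRing A] [Algebra k A] [IsNoetherianRing A]
    [AddCommGroup W] [Module k W] [Module.Finite k W] (J : Ideal A) (f : A →ₗ[k] W)
    (hf : ∀ a, f a = 0 → a ∈ J) : Module.Finite k J.Cotangent := by
  have h1 : Module.Finite k (A ⧸ LinearMap.ker f) :=
    Module.Finite.equiv f.quotKerEquivRange.symm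
  have h2 : Module.Finite k (A ⧸ J) := by
    refine Module.Finite.of_surjective (Submodule.mapQ (LinearMap.ker f) (J.restrictScalars k)
      LinearMap.id (fun a ha => hf a ha)) ?_
    intro y
    obtain ⟨a, rfl⟩ := Submodule.Quotient.mk_surjective _ y
    exact ⟨Submodule.Quotient.mk a, rfl⟩
  have h3 : Module.Finite A J.Cotangent :=
    Module.Finite.of_surjective J.toCotangent J.toCotangent_surjective
  have h4 : Module.Finite (A ⧸ J) J.Cotangent := Module.Finite.of_restrictScalars_finite A _ _
  have h5 : IsScalarTower k (A ⧸ J) J.Cotangent := ⟨fun c y m => by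
    obtain ⟨a, rfl⟩ := Ideal.Quotient.mk_surjective y
    have h : ∀ b : A, (Ideal.Quotient.mk J b) • m = b • m := fun b => algebraMap_smul (A ⧸ J) b m
    rw [h, show c • Ideal.Quotient.mk J a = Ideal.Quotient.mk J (c • a) from rfl, h, smul_assoc]⟩
  exact Module.Finite.trans (A ⧸ J) _

variable {k : Type u} [Field k] {Γ : Type*} [CommGroup Γ]
  {A : Type u} [CommRing A] [Algebra k A]
  {𝔤 : Type u} [LieRing 𝔤] [LieAlgebra k 𝔤]

lemma tmul_mem_tensorIdeal {J : Ideal A} {a : A} (ha : a ∈ J) (u : 𝔤) :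
    a ⊗ₜ[k] u ∈ tensorIdeal k 𝔤 J :=
  ⟨(⟨a, ha⟩ : J.restrictScalars k) ⊗ₜ u, rfl⟩

lemma tensorIdeal_le {J : Ideal A} {S : Submodule k (A ⊗[k] 𝔤)}
    (h : ∀ a ∈ J, ∀ u : 𝔤, a ⊗ₜ[k] u ∈ S) : tensorIdeal k 𝔤 J ≤ S := by
  rintro _ ⟨t, rfl⟩
  induction t using TensorProduct.induction_on with
  | zero => simp
  | add s t hs ht => rw [map_add]; exact add_mem hs ht
  | tmul a u => exact h a a.2 u

lemma lie_mem_tensorIdeal_mul {J J' : Ideal A} {s t : A ⊗[k] 𝔤} (hs : s ∈ tensorIdeal k 𝔤 J)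
    (ht : t ∈ tensorIdeal k 𝔤 J') : ⁅s, t⁆ ∈ tensorIdeal k 𝔤 (J * J') := by
  have h1 : ∀ a ∈ J, ∀ u : 𝔤, ⁅a ⊗ₜ[k] u, t⁆ ∈ tensorIdeal k 𝔤 (J * J') := fun a ha u => by
    refine tensorIdeal_le (S := (tensorIdeal k 𝔤 (J * J')).comap
      (LieModule.toEnd k (A ⊗[k] 𝔤) (A ⊗[k] 𝔤) (a ⊗ₜ[k] u))) (fun b hb v => ?_) ht
    rw [Submodule.mem_comap, LieModule.toEnd_apply_apply, LieAlgebra.ExtendScalars.bracket_tmul]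
    exact tmul_mem_tensorIdeal (Ideal.mul_mem_mul ha hb) _
  rw [← lie_skew, Submodule.neg_mem_iff]
  refine tensorIdeal_le (S := (tensorIdeal k 𝔤 (J * J')).comap
    (LieModule.toEnd k (A ⊗[k] 𝔤) (A ⊗[k] 𝔤) t)) (fun a ha u => ?_) hs
  rw [Submodule.mem_comap, LieModule.toEnd_apply_apply, ← lie_skew, Submodule.neg_mem_iff]
  exact h1 a ha u

variable [MulSemiringAction Γ A] [SMulCommClass Γ k A]
  [DistribMulAction Γ 𝔤] [SMulCommClass Γ k 𝔤]

lemma smul_mem_orbitIdeal' (x : A →ₐ[k] k) (γ : Γ) {a : A} (ha : a ∈ orbitIdeal Γ x) :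
    γ • a ∈ orbitIdeal Γ x := smul_mem_orbitIdeal x γ ha

lemma smul_mem_orbitIdeal_sq (x : A →ₐ[k] k) (γ : Γ) {a : A} (ha : a ∈ orbitIdeal Γ x ^ 2) :
    γ • a ∈ orbitIdeal Γ x ^ 2 := by
  have := Ideal.mem_map_of_mem (MulSemiringAction.toAlgHom k A γ) ha
  rw [Ideal.map_pow] at this
  exact Ideal.pow_right_mono (Ideal.map_le_iff_le_comap.mpr (smul_mem_orbitIdeal x γ)) 2 this

lemma diag_mul (γ δ : Γ) (t : A ⊗[k] 𝔤) :
    diag k 𝔤 A (γ * δ) t = diag k 𝔤 A γ (diag k 𝔤 A δ t) := by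
  induction t using TensorProduct.induction_on with
  | zero => simp
  | add s t hs ht => rw [map_add, map_add, map_add, hs, ht]
  | tmul a u => simp [mul_smul]

lemma diag_mem_tensorIdeal {J : Ideal A} (γ : Γ) (hJ : ∀ a ∈ J, γ • a ∈ J) {t : A ⊗[k] 𝔤}
    (ht : t ∈ tensorIdeal k 𝔤 J) : diag k 𝔤 A γ t ∈ tensorIdeal k 𝔤 J :=
  tensorIdeal_le (S := (tensorIdeal k 𝔤 J).comap (diag k 𝔤 A γ))
    (fun a ha _ => tmul_mem_tensorIdeal (hJ a ha) _) ht

omit [DistribMulAction Γ 𝔤] [SMulCommClass Γ k 𝔤] in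
lemma evalAt_eq_zero (x : A →ₐ[k] k) {t : A ⊗[k] 𝔤}
    (ht : t ∈ tensorIdeal k 𝔤 (orbitIdeal Γ x)) : evalAt 𝔤 x t = 0 :=
  tensorIdeal_le (S := LinearMap.ker (evalAt 𝔤 x : A ⊗[k] 𝔤 →ₗ[k] 𝔤)) (fun a ha _ => by
    have := (mem_orbitIdeal x a).mp ha 1
    rw [inv_one, one_smul] at this
    rw [LinearMap.mem_ker, LieHom.coe_toLinearMap, evalAt_tmul, this, zero_smul]) ht

omit [DistribMulAction Γ 𝔤] [SMulCommClass Γ k 𝔤] in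
-- In terms of a basis of `𝔤`, evaluation acts coefficientwise. Vanishing along the orbit therefore
-- puts every coefficient in `I`.
lemma mem_tensorIdeal_of_evalAt (x : A →ₐ[k] k) {t : A ⊗[k] 𝔤}
    (ht : ∀ γ : Γ, evalAt 𝔤 (translate γ x) t = 0) : t ∈ tensorIdeal k 𝔤 (orbitIdeal Γ x) := by
  let b := Module.Basis.ofVectorSpace k 𝔤
  let B := Algebra.TensorProduct.basis A b
  have h0 : ∀ y : A →ₐ[k] k, ∀ t, (B.repr t).sum (fun i a => y a • b i) = evalAt 𝔤 y t := by
    intro y t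
    conv_rhs => rw [← B.linearCombination_repr t, Finsupp.linearCombination_apply, Finsupp.sum,
      map_sum]
    refine Finset.sum_congr rfl fun i _ => ?_
    rw [Algebra.TensorProduct.basis_apply, TensorProduct.smul_tmul', smul_eq_mul, mul_one,
      evalAt_tmul]
  have h1 : ∀ γ : Γ, ∀ i, translate γ x (B.repr t i) = 0 := fun γ i => by
    have h2 := h0 (translate γ x) t
    rw [ht γ] at h2
    by_cases hi : i ∈ (B.repr t).support
    · exact linearIndependent_iff'.mp b.linearIndependent _ _ h2 i hi
    · rw [Finsupp.notMem_support_iff.mp hi, map_zero]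
  rw [← B.linearCombination_repr t, Finsupp.linearCombination_apply, Finsupp.sum]
  refine Submodule.sum_mem _ fun i _ => ?_
  rw [Algebra.TensorProduct.basis_apply, TensorProduct.smul_tmul', smul_eq_mul, mul_one]
  exact tmul_mem_tensorIdeal ((mem_orbitIdeal x _).mpr fun γ => h1 γ i) _

variable [IsLieAction Γ 𝔤]

/-- An equivariant map that vanishes at `x` vanishes on the whole orbit. -/
lemma coe_mem_tensorIdeal (x : A →ₐ[k] k) {α : mapAlgebra k Γ A 𝔤} (hα : ev Γ 𝔤 x α = 0) :
    (α : A ⊗[k] 𝔤) ∈ tensorIdeal k 𝔤 (orbitIdeal Γ x) := by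
  refine mem_tensorIdeal_of_evalAt x fun γ => ?_
  have h := evalAt_diag 𝔤 x γ⁻¹ (α : A ⊗[k] 𝔤)
  rw [α.2, ← coe_ev, hα, inv_inv] at h
  rw [← smul_inv_smul γ (evalAt 𝔤 (translate γ x) _), ← h]
  exact smul_zero _

lemma idealK'_le_idealQ (x : A →ₐ[k] k) : idealK' Γ 𝔤 x ≤ idealQ Γ 𝔤 x := by
  refine LieSubmodule.lieIdeal_oper_eq_span _ _ |>.trans_le (LieSubmodule.lieSpan_le.mpr ?_)
  rintro _ ⟨α, β, rfl⟩
  change _ ∈ idealQ Γ 𝔤 x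
  rw [mem_idealQ, sq]
  exact lie_mem_tensorIdeal_mul (coe_mem_tensorIdeal x (LieHom.mem_ker.mp α.2))
    (coe_mem_tensorIdeal x (LieHom.mem_ker.mp β.2))

variable [Fintype Γ]

variable (k Γ A 𝔤) in
/-- The map `t ↦ ∑ γ, γ t` from `A ⊗ 𝔤` to its invariants. -/
noncomputable def av : A ⊗[k] 𝔤 →ₗ[k] mapAlgebra k Γ A 𝔤 :=
  LinearMap.codRestrict (mapAlgebra k Γ A 𝔤).toSubmodule (∑ γ : Γ, diag k 𝔤 A γ) (fun t δ => by
    rw [LinearMap.sum_apply, map_sum]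
    exact Fintype.sum_equiv (Equiv.mulLeft δ) _ _ fun γ => (diag_mul δ γ t).symm)

lemma coe_av (t : A ⊗[k] 𝔤) : (av k Γ A 𝔤 t : A ⊗[k] 𝔤) = ∑ γ : Γ, diag k 𝔤 A γ t :=
  LinearMap.sum_apply _ _ _

lemma lie_av (α : mapAlgebra k Γ A 𝔤) (t : A ⊗[k] 𝔤) :
    ⁅α, av k Γ A 𝔤 t⁆ = av k Γ A 𝔤 ⁅(α : A ⊗[k] 𝔤), t⁆ := by
  apply Subtype.ext
  rw [coe_av, LieSubalgebra.coe_bracket, coe_av, lie_sum]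
  refine Finset.sum_congr rfl fun γ _ => ?_
  rw [diag_lie, α.2 γ]

lemma av_diag (γ : Γ) (t : A ⊗[k] 𝔤) : av k Γ A 𝔤 (diag k 𝔤 A γ t) = av k Γ A 𝔤 t := by
  apply Subtype.ext
  rw [coe_av, coe_av]
  exact Fintype.sum_equiv (Equiv.mulRight γ) _ _ fun δ => (diag_mul δ γ t).symm

lemma av_coe (α : mapAlgebra k Γ A 𝔤) :
    av k Γ A 𝔤 (α : A ⊗[k] 𝔤) = (Fintype.card Γ : k) • α := by
  apply Subtype.ext
  rw [coe_av]
  simp only [α.2 _]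
  simp [Nat.cast_smul_eq_nsmul]

lemma ev_av (x : A →ₐ[k] k) {t : A ⊗[k] 𝔤} (ht : t ∈ tensorIdeal k 𝔤 (orbitIdeal Γ x)) :
    ev Γ 𝔤 x (av k Γ A 𝔤 t) = 0 := by
  refine Subtype.ext ((coe_ev 𝔤 x _).trans (evalAt_eq_zero (Γ := Γ) x ?_))
  rw [coe_av]
  exact Submodule.sum_mem _ fun γ _ =>
    diag_mem_tensorIdeal γ (fun a ha => smul_mem_orbitIdeal' x γ ha) ht

lemma av_mem_idealQ (x : A →ₐ[k] k) {t : A ⊗[k] 𝔤}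
    (ht : t ∈ tensorIdeal k 𝔤 (orbitIdeal Γ x ^ 2)) : av k Γ A 𝔤 t ∈ idealQ Γ 𝔤 x := by
  rw [mem_idealQ, coe_av]
  refine Submodule.sum_mem _ fun γ _ => ?_
  exact diag_mem_tensorIdeal γ (fun a ha => smul_mem_orbitIdeal_sq x γ ha) ht

variable (Γ) in
/-- The ideal `𝔔_x` as a submodule of the kernel of evaluation. -/
noncomputable def kerQ (x : A →ₐ[k] k) : LieSubmodule k (mapAlgebra k Γ A 𝔤) (ev Γ 𝔤 x).ker :=
  LieSubmodule.comap (LieSubmodule.incl (ev Γ 𝔤 x).ker) (idealQ Γ 𝔤 x)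

omit [Fintype Γ] in
lemma mem_kerQ (x : A →ₐ[k] k) (n : (ev Γ 𝔤 x).ker) :
    n ∈ kerQ Γ x ↔ (n : mapAlgebra k Γ A 𝔤) ∈ idealQ Γ 𝔤 x := Iff.rfl

omit [Fintype Γ] in
lemma finite_orbit_cotangent [Finite Γ] [Algebra.FiniteType k A] (x : A →ₐ[k] k) :
    Module.Finite k (orbitIdeal Γ x).Cotangent := by
  have : IsNoetherianRing A := Algebra.FiniteType.isNoetherianRing k A
  refine finite_cotangent _ (LinearMap.pi fun γ : Γ => (translate γ x).toLinearMap) fun a ha => ?_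
  exact (mem_orbitIdeal x a).mpr fun γ => congrFun ha γ

/-- Averaging maps the finite-dimensional space `I/I² ⊗ 𝔤` onto `K / 𝔔_x`. -/
lemma finite_quotient_kerQ [CharZero k] [Module.Finite k 𝔤] [Algebra.FiniteType k A]
    (x : A →ₐ[k] k) : Module.Finite k ((ev Γ 𝔤 x).ker ⧸ (kerQ (𝔤 := 𝔤) Γ x).toSubmodule) := by
  have := finite_orbit_cotangent (Γ := Γ) x
  set I := orbitIdeal Γ x
  obtain ⟨s, hs⟩ := LinearMap.exists_rightInverse_of_surjective
    (I.toCotangent.restrictScalars k) (LinearMap.range_eq_top.mpr I.toCotangent_surjective)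
  have hs' : ∀ c, I.toCotangent (s c) = c := LinearMap.congr_fun hs
  let i : I.Cotangent →ₗ[k] A := (I.subtype.restrictScalars k) ∘ₗ s
  let j : I.Cotangent ⊗[k] 𝔤 →ₗ[k] A ⊗[k] 𝔤 := LinearMap.rTensor 𝔤 i
  have hj : ∀ t, j t ∈ tensorIdeal k 𝔤 I := fun t => by
    induction t using TensorProduct.induction_on with
    | zero => simp
    | add s t hs ht => rw [map_add]; exact add_mem hs ht
    | tmul c u => exact tmul_mem_tensorIdeal (s c).2 u
  let φ : I.Cotangent ⊗[k] 𝔤 →ₗ[k] (ev Γ 𝔤 x).ker :=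
    LinearMap.codRestrict (ev Γ 𝔤 x).ker.toSubmodule (av k Γ A 𝔤 ∘ₗ j)
      (fun t => LieHom.mem_ker.mpr (ev_av x (hj t)))
  have key : ∀ t ∈ tensorIdeal k 𝔤 I, ∃ c, av k Γ A 𝔤 t - av k Γ A 𝔤 (j c) ∈ idealQ Γ 𝔤 x := by
    intro t ht
    have h := tensorIdeal_le (J := I) (S := (LinearMap.range (av k Γ A 𝔤 ∘ₗ j) ⊔
      (idealQ Γ 𝔤 x).toSubmodule).comap (av k Γ A 𝔤)) (fun a ha u => ?_) ht
    · obtain ⟨_, ⟨c, rfl⟩, q, hq, h⟩ := Submodule.mem_sup.mp h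
      exact ⟨c, by rw [← h]; simpa using hq⟩
    · rw [Submodule.mem_comap]
      refine Submodule.mem_sup.mpr ⟨_, ⟨I.toCotangent ⟨a, ha⟩ ⊗ₜ u, rfl⟩,
        av k Γ A 𝔤 ((a - i (I.toCotangent ⟨a, ha⟩)) ⊗ₜ u), ?_, ?_⟩
      · refine av_mem_idealQ x (tmul_mem_tensorIdeal ?_ u)
        exact (Ideal.toCotangent_eq (x := ⟨a, ha⟩) (y := s (I.toCotangent ⟨a, ha⟩))).mp
          (hs' _).symm
      · rw [LinearMap.comp_apply, ← map_add]
        congr 1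
        change i _ ⊗ₜ[k] u + _ = _
        rw [TensorProduct.sub_tmul]
        abel
  refine Module.Finite.of_surjective ((kerQ (𝔤 := 𝔤) Γ x).toSubmodule.mkQ ∘ₗ φ) fun y => ?_
  obtain ⟨n, rfl⟩ := Submodule.Quotient.mk_surjective _ y
  obtain ⟨c, hc⟩ := key _ (coe_mem_tensorIdeal x (LieHom.mem_ker.mp n.2))
  have hΓ : (Fintype.card Γ : k) ≠ 0 := by exact_mod_cast Fintype.card_ne_zero
  -- Averaging multiplies an invariant element by `|Γ|`.
  refine ⟨(Fintype.card Γ : k)⁻¹ • c, ?_⟩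
  rw [map_smul, inv_smul_eq_iff₀ hΓ, LinearMap.comp_apply, Submodule.mkQ_apply,
    ← Submodule.Quotient.mk_smul, eq_comm, Submodule.Quotient.eq]
  change _ ∈ idealQ Γ 𝔤 x
  rw [av_coe] at hc
  exact hc

end Averaging

/-! ### Restriction of equivariant maps to `𝔔_x` -/

section RestrictToQ

variable {k : Type u} [Field k] [CharZero k] {Γ : Type*} [CommGroup Γ] [Finite Γ]
  {A : Type u} [CommRing A] [Algebra k A] [MulSemiringAction Γ A] [SMulCommClass Γ k A]
  {𝔤 : Type u} [LieRing 𝔤] [LieAlgebra k 𝔤] [DistribMulAction Γ 𝔤] [SMulCommClass Γ k 𝔤]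
  [IsLieAction Γ 𝔤] (x : A →ₐ[k] k)
  (M : Type u) [AddCommGroup M] [Module k M] [LieRingModule (fixedAt Γ 𝔤 x) M]
  [LieModule k (fixedAt Γ 𝔤 x) M]

/-- The equivariant maps on the kernel of evaluation that vanish on `𝔔_x`. -/
noncomputable def kerHomsMod : Submodule k (kerHoms (ev Γ 𝔤 x) M) where
  carrier := {f | ∀ n ∈ kerQ Γ x, (f : (ev Γ 𝔤 x).ker →ₗ[k] M) n = 0}
  add_mem' ha hb n hn := by
    rw [Submodule.coe_add, LinearMap.add_apply, ha n hn, hb n hn, add_zero]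
  zero_mem' n hn := rfl
  smul_mem' c f h n hn := by
    rw [Submodule.coe_smul, LinearMap.smul_apply, h n hn, smul_zero]

variable {M} in
omit [CharZero k] [Finite Γ] in
-- By equivariance `f ⁅a, b⁆ = ⁅ev a, f b⁆`, which is zero for `a` in the kernel.
lemma kerHoms_apply_of_mem_idealK' (f : kerHoms (ev Γ 𝔤 x) M) (n : (ev Γ 𝔤 x).ker)
    (hn : (n : mapAlgebra k Γ A 𝔤) ∈ idealK' Γ 𝔤 x) : (f : (ev Γ 𝔤 x).ker →ₗ[k] M) n = 0 := by
  have h : ∀ m ∈ idealK' Γ 𝔤 x, ∃ hm : m ∈ (ev Γ 𝔤 x).ker,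
      (f : (ev Γ 𝔤 x).ker →ₗ[k] M) ⟨m, hm⟩ = 0 := by
    intro m hm
    rw [idealK', ← LieSubmodule.mem_toSubmodule, LieSubmodule.lieIdeal_oper_eq_linear_span] at hm
    induction hm using Submodule.span_induction with
    | mem y hy =>
      obtain ⟨a, b, rfl⟩ := hy
      refine ⟨LieSubmodule.lie_mem _ b.2, ?_⟩
      refine (f.2 a b).trans ?_
      rw [LieHom.mem_ker.mp a.2, zero_lie]
    | zero => exact ⟨zero_mem _, map_zero _⟩
    | add a b _ _ ha hb =>
      obtain ⟨ha, ha'⟩ := ha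
      obtain ⟨hb, hb'⟩ := hb
      refine ⟨add_mem ha hb, ?_⟩
      have := map_add (f : (ev Γ 𝔤 x).ker →ₗ[k] M) ⟨a, ha⟩ ⟨b, hb⟩
      rw [ha', hb', add_zero] at this
      exact this
    | smul c a _ ha =>
      obtain ⟨ha, ha'⟩ := ha
      refine ⟨Submodule.smul_mem (ev Γ 𝔤 x).ker.toSubmodule c ha, ?_⟩
      have := map_smul (f : (ev Γ 𝔤 x).ker →ₗ[k] M) c ⟨a, ha⟩
      rw [ha', smul_zero] at this
      exact this
  exact (h n hn).2

variable {M} in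
-- `𝔔_x` has finite codimension in `K`, and `K` maps itself into `K' ≤ 𝔔_x`, where `g` vanishes.
-- These are the hypotheses of `exists_equivariant_extension`.
lemma exists_kerHoms_extension [Module.Finite k 𝔤] [Algebra.FiniteType k A] [Module.Finite k M]
    [LieAlgebra.IsKilling k (fixedAt Γ 𝔤 x)] (g : kerQ (𝔤 := 𝔤) Γ x →ₗ[k] M)
    (hg : ∀ (α : mapAlgebra k Γ A 𝔤) n, g ⁅α, n⁆ = ⁅ev Γ 𝔤 x α, g n⁆)
    (hg0 : ∀ n : kerQ (𝔤 := 𝔤) Γ x, (n.1 : mapAlgebra k Γ A 𝔤) ∈ idealK' Γ 𝔤 x → g n = 0) :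
    ∃ f : kerHoms (ev Γ 𝔤 x) M,
      ∀ n : kerQ (𝔤 := 𝔤) Γ x, (f : (ev Γ 𝔤 x).ker →ₗ[k] M) n = g n := by
  have := Fintype.ofFinite Γ
  let _ := LieRingModule.compLieHom M (ev Γ 𝔤 x)
  let _ := LieModule.compLieHom M (ev Γ 𝔤 x)
  have hact : ∀ (α : mapAlgebra k Γ A 𝔤) (m : M), ⁅α, m⁆ = ⁅ev Γ 𝔤 x α, m⁆ := fun _ _ => rfl
  have := finite_quotient_kerQ (𝔤 := 𝔤) (Γ := Γ) x
  obtain ⟨h, hh⟩ := LieAlgebra.exists_equivariant_extension (M := M) (ev_surjective 𝔤 x)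
    (fun α hα m => by rw [hact, hα, zero_lie]) (kerQ Γ x) g hg
    (fun α hα n => by
      have h1 : ⁅α, (n : mapAlgebra k Γ A 𝔤)⁆ ∈ idealK' Γ 𝔤 x :=
        LieSubmodule.lie_mem_lie (I := idealK Γ 𝔤 x) (N := idealK Γ 𝔤 x) (LieHom.mem_ker.mpr hα) n.2
      exact ⟨idealK'_le_idealQ x h1, hg0 ⟨_, _⟩ h1⟩)
  exact ⟨⟨h, fun α n => h.map_lie α n⟩, hh⟩

set_option maxHeartbeats 2000000 in
/-- The equivariant maps on the kernel of evaluation decompose according to their restriction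
to `𝔔_x`. -/
theorem nonempty_kerHoms_equiv [Module.Finite k 𝔤] [Algebra.FiniteType k A] [Module.Finite k M]
    [LieAlgebra.IsKilling k (fixedAt Γ 𝔤 x)] :
    Nonempty (kerHoms (ev Γ 𝔤 x) M ≃ₗ[k]
      (QModK' Γ 𝔤 x →ₗ⁅k, fixedAt Γ 𝔤 x⁆ M) × kerHomsMod (Γ := Γ) (𝔤 := 𝔤) x M) := by
  obtain ⟨p, hp, hp0, hplie⟩ : ∃ p : idealQ Γ 𝔤 x →ₗ[k] QModK' Γ 𝔤 x, Function.Surjective p ∧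
      (∀ q : idealQ Γ 𝔤 x, p q = 0 ↔ (q : mapAlgebra k Γ A 𝔤) ∈ idealK' Γ 𝔤 x) ∧
      ∀ (α : mapAlgebra k Γ A 𝔤) (q : idealQ Γ 𝔤 x), ⁅ev Γ 𝔤 x α, p q⁆ = p ⁅α, q⁆ := by
    let p : idealQ Γ 𝔤 x →ₗ[k] QModK' Γ 𝔤 x := (LieSubmodule.comap
      (LieSubmodule.incl (idealQ Γ 𝔤 x)) (idealK' Γ 𝔤 x)).toSubmodule.mkQ
    exact ⟨p, Submodule.mkQ_surjective _, fun q => Submodule.Quotient.mk_eq_zero _,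
      fun α q => QModK'.ev_lie α (p q)⟩
  obtain ⟨s, hs⟩ := LinearMap.exists_rightInverse_of_surjective p (LinearMap.range_eq_top.mpr hp)
  have hs' : ∀ q, p (s q) = q := LinearMap.congr_fun hs
  obtain ⟨i, hi⟩ : ∃ i : idealQ Γ 𝔤 x →ₗ[k] (ev Γ 𝔤 x).ker,
      ∀ q, (i q : mapAlgebra k Γ A 𝔤) = q :=
    ⟨Submodule.inclusion (LieSubmodule.toSubmodule_le_toSubmodule _ _ |>.mpr
      (idealQ_le_idealK 𝔤 x)), fun q => rfl⟩
  have hilie : ∀ (α : mapAlgebra k Γ A 𝔤) q, i ⁅α, q⁆ = ⁅α, i q⁆ := fun α q =>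
    Subtype.ext (by rw [hi, LieSubmodule.coe_bracket, LieSubmodule.coe_bracket, hi])
  -- Since `f` kills `K'`, its restriction to `𝔔_x` does not depend on the lift `s` from `𝔔_x / K'`.
  have hf : ∀ (f : kerHoms (ev Γ 𝔤 x) M) (q : idealQ Γ 𝔤 x),
      (f : (ev Γ 𝔤 x).ker →ₗ[k] M) (i (s (p q))) = (f : (ev Γ 𝔤 x).ker →ₗ[k] M) (i q) := by
    intro f q
    rw [← sub_eq_zero, ← map_sub, ← map_sub]
    refine kerHoms_apply_of_mem_idealK' x f _ ?_
    rw [hi]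
    exact (hp0 (s (p q) - q)).mp (by rw [map_sub, hs', sub_self])
  obtain ⟨Ψ, hΨ⟩ : ∃ Ψ : kerHoms (ev Γ 𝔤 x) M →ₗ[k] (QModK' Γ 𝔤 x →ₗ⁅k, fixedAt Γ 𝔤 x⁆ M),
      ∀ f q, Ψ f (p q) = (f : (ev Γ 𝔤 x).ker →ₗ[k] M) (i q) := by
    refine ⟨{ toFun := fun f =>
                { (f : (ev Γ 𝔤 x).ker →ₗ[k] M) ∘ₗ i ∘ₗ s with
                  map_lie' := fun {l y} => ?_ }
              map_add' := fun f g => rfl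
              map_smul' := fun c f => rfl }, hf⟩
    obtain ⟨α, rfl⟩ := ev_surjective 𝔤 x l
    obtain ⟨q, rfl⟩ := hp y
    rw [hplie]
    change (f : (ev Γ 𝔤 x).ker →ₗ[k] M) (i (s (p _))) =
      ⁅_, (f : (ev Γ 𝔤 x).ker →ₗ[k] M) (i (s (p _)))⁆
    rw [hf, hf, ← f.2, hilie]
  have hker : LinearMap.ker Ψ = kerHomsMod (Γ := Γ) (𝔤 := 𝔤) x M := by
    ext f
    rw [LinearMap.mem_ker]
    constructor
    · intro h n hn
      have h1 := hΨ f ⟨n, hn⟩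
      rw [h, show i ⟨n, hn⟩ = n from Subtype.ext (hi _)] at h1
      exact h1.symm
    · intro h
      ext y
      obtain ⟨q, rfl⟩ := hp y
      rw [hΨ]
      refine h (i q) ?_
      rw [mem_kerQ, hi]
      exact q.2
  obtain ⟨j, hj⟩ : ∃ j : kerQ (𝔤 := 𝔤) Γ x →ₗ[k] idealQ Γ 𝔤 x,
      ∀ n, (j n : mapAlgebra k Γ A 𝔤) = n.1 :=
    ⟨{  toFun := fun n => ⟨n.1.1, n.2⟩
        map_add' := fun _ _ => rfl
        map_smul' := fun _ _ => rfl }, fun n => rfl⟩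
  have hjlie : ∀ (α : mapAlgebra k Γ A 𝔤) n, j ⁅α, n⁆ = ⁅α, j n⁆ := fun α n =>
    Subtype.ext (by
      rw [hj, LieSubmodule.coe_bracket, LieSubmodule.coe_bracket, LieSubmodule.coe_bracket, hj])
  have hsurj : Function.Surjective Ψ := by
    intro g
    obtain ⟨f, hf⟩ := exists_kerHoms_extension x ((g : QModK' Γ 𝔤 x →ₗ[k] M) ∘ₗ p ∘ₗ j)
      (fun α n => by
        simp only [LinearMap.comp_apply, LieModuleHom.coe_toLinearMap]
        rw [hjlie, ← hplie, LieModuleHom.map_lie])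
      (fun n hn => by
        simp only [LinearMap.comp_apply, LieModuleHom.coe_toLinearMap]
        rw [(hp0 (j n)).mpr (by rw [hj]; exact hn), map_zero])
    refine ⟨f, ?_⟩
    ext y
    obtain ⟨q, rfl⟩ := hp y
    have hq : i q ∈ kerQ Γ x := by
      rw [mem_kerQ, hi]
      exact q.2
    rw [hΨ]
    refine (hf ⟨i q, hq⟩).trans ?_
    simp only [LinearMap.comp_apply, LieModuleHom.coe_toLinearMap]
    rw [show j ⟨i q, hq⟩ = q from Subtype.ext ((hj _).trans (hi q))]
  obtain ⟨e⟩ := nonempty_equiv_prod_of_surjective Ψ hsurj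
  exact ⟨e ≪≫ₗ (LinearEquiv.refl k _).prodCongr (LinearEquiv.ofEq _ _ hker)⟩

end RestrictToQ

end EquivMap

/-! ### Equivariant maps on the kernel modulo `𝔔_x` -/

namespace EquivMap

section Cotangent

variable {k : Type u} [Field k] {Γ : Type*} [CommGroup Γ]
  {A : Type u} [CommRing A] [Algebra k A] [MulSemiringAction Γ A] [SMulCommClass Γ k A]
  (x : A →ₐ[k] k)

/-- The action of `Γ` on `I/I²`. -/
noncomputable def cotangentAct (γ : Γ) :
    (orbitIdeal Γ x).Cotangent →ₗ[k] (orbitIdeal Γ x).Cotangent :=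
  Ideal.mapCotangent _ _ (MulSemiringAction.toAlgHom k A γ) (smul_mem_orbitIdeal x γ)

lemma cotangentAct_mk (γ : Γ) (b : orbitIdeal Γ x) :
    cotangentAct x γ ((orbitIdeal Γ x).toCotangent b) =
      (orbitIdeal Γ x).toCotangent ⟨γ • (b : A), smul_mem_orbitIdeal' x γ b.2⟩ := rfl

lemma cotangentAct_mul (γ δ : Γ) (c : (orbitIdeal Γ x).Cotangent) :
    cotangentAct x (γ * δ) c = cotangentAct x γ (cotangentAct x δ c) := by
  obtain ⟨b, rfl⟩ := (orbitIdeal Γ x).toCotangent_surjective c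
  simp only [cotangentAct_mk, mul_smul]

lemma cotangentAct_smul (γ : Γ) (a : A) (c : (orbitIdeal Γ x).Cotangent) :
    cotangentAct x γ (a • c) = (γ • a) • cotangentAct x γ c := by
  obtain ⟨b, rfl⟩ := (orbitIdeal Γ x).toCotangent_surjective c
  rw [← map_smul, cotangentAct_mk, cotangentAct_mk, ← map_smul]
  congr 1
  apply Subtype.ext
  simp [smul_mul']

lemma mem_cotangentComponent {ξ : Γ →* kˣ} {c : (orbitIdeal Γ x).Cotangent} :
    c ∈ cotangentComponent Γ x ξ ↔ ∀ γ, cotangentAct x γ c = (ξ γ : k) • c := Iff.rfl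

variable {x}

lemma smul_cotangent_congr {a a' : A} (h : a - a' ∈ orbitIdeal Γ x)
    (c : (orbitIdeal Γ x).Cotangent) : a • c = a' • c := by
  rw [← sub_eq_zero, ← sub_smul]
  exact Ideal.Cotangent.smul_eq_zero_of_mem h c

/-- An element of `A` with the value `1` at `x` and the value `0` at the other points of the
orbit of `x`. -/
structure IsSeparating (Γ : Type*) [CommGroup Γ] {A : Type u} [CommRing A] [Algebra k A]
    [MulSemiringAction Γ A] [SMulCommClass Γ k A] (x : A →ₐ[k] k) (e : A) : Prop where
  apply_smul_of_mem : ∀ γ ∈ isotropy Γ x, x (γ • e) = 1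
  apply_smul_of_notMem : ∀ γ ∉ isotropy Γ x, x (γ • e) = 0

variable (Γ x) in
lemma exists_isSeparating [Finite Γ] : ∃ e : A, IsSeparating Γ x e := by
  obtain ⟨e, h1, h0⟩ := exists_separating (Γ := Γ) x
  refine ⟨e, fun γ hγ => ?_, fun γ hγ => ?_⟩
  · have h := DFunLike.congr_fun ((isotropy Γ x).inv_mem hγ : translate γ⁻¹ x = x) e
    rwa [translate_apply, inv_inv, h1] at h
  · have h := h0 γ⁻¹ fun h => hγ ((isotropy Γ x).inv_mem_iff.mp h)
    rwa [translate_apply, inv_inv] at h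

namespace IsSeparating

variable {e : A} (he : IsSeparating Γ x e)
include he

/-- Modulo `I`, `A` becomes an algebra of functions on the orbit, and `e` is the indicator function
of `x`. This relation and the following ones are checked at each point of the orbit. -/
lemma mul_sub_mem (a : A) : e * a - x a • e ∈ orbitIdeal Γ x := by
  rw [mem_orbitIdeal]
  intro γ
  rw [smul_sub, smul_mul', smul_comm γ⁻¹ (x a) e, map_sub, map_mul, map_smul x (x a)]
  by_cases h : γ⁻¹ ∈ isotropy Γ x
  · have h2 := DFunLike.congr_fun ((isotropy Γ x).inv_mem_iff.mp h : translate γ x = x) a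
    rw [translate_apply] at h2
    rw [he.apply_smul_of_mem _ h, h2]
    simp
  · rw [he.apply_smul_of_notMem _ h]
    simp

lemma mul_self_sub_mem : e * e - e ∈ orbitIdeal Γ x := by
  have h := he.mul_sub_mem e
  have h1 := he.apply_smul_of_mem 1 (one_mem _)
  rw [one_smul] at h1
  rwa [h1, one_smul] at h

lemma smul_sub_mem {γ : Γ} (hγ : γ ∈ isotropy Γ x) : γ • e - e ∈ orbitIdeal Γ x := by
  rw [mem_orbitIdeal]
  intro δ
  rw [smul_sub, smul_smul, map_sub]
  by_cases h : δ⁻¹ ∈ isotropy Γ x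
  · rw [he.apply_smul_of_mem _ h, he.apply_smul_of_mem _ (mul_mem h hγ), sub_self]
  · rw [he.apply_smul_of_notMem _ h, he.apply_smul_of_notMem _ (fun h' => h
      ((Subgroup.mul_mem_cancel_right _ hγ).mp h')), sub_self]

lemma mul_smul_mem {γ : Γ} (hγ : γ ∉ isotropy Γ x) : e * γ • e ∈ orbitIdeal Γ x := by
  rw [mem_orbitIdeal]
  intro δ
  rw [smul_mul', smul_smul, map_mul]
  by_cases h : δ⁻¹ ∈ isotropy Γ x
  · rw [he.apply_smul_of_notMem (δ⁻¹ * γ) (fun h' => hγ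
      ((Subgroup.mul_mem_cancel_left _ h).mp h')), mul_zero]
  · rw [he.apply_smul_of_notMem _ h, zero_mul]

/-- The translates of `e` are the indicators of the orbit points, and each point occurs `|Γ_x|`
times. -/
lemma sum_smul_sub_mem [Fintype Γ] :
    ∑ γ : Γ, γ • e - algebraMap k A (Nat.card (isotropy Γ x)) ∈ orbitIdeal Γ x := by
  classical
  rw [mem_orbitIdeal]
  intro δ
  rw [smul_sub, Finset.smul_sum, map_sub, map_sum, smul_algebraMap, AlgHom.commutes]
  have : ∑ γ : Γ, x (δ⁻¹ • γ • e) = ∑ γ : Γ, x (γ • e) :=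
    Fintype.sum_equiv (Equiv.mulLeft δ⁻¹) _ _ fun γ => by rw [smul_smul]; rfl
  rw [this, sub_eq_zero]
  have h : ∀ γ : Γ, x (γ • e) = if γ ∈ isotropy Γ x then 1 else 0 := fun γ => by
    split_ifs with h
    · exact he.apply_smul_of_mem γ h
    · exact he.apply_smul_of_notMem γ h
  simp_rw [h]
  rw [Finset.sum_boole, ← Fintype.card_subtype, ← Nat.card_eq_fintype_card]
  rfl

lemma mul_smul_eq (a : A) (c : (orbitIdeal Γ x).Cotangent) : e • a • c = x a • e • c := by
  rw [smul_smul, smul_cotangent_congr (he.mul_sub_mem a), smul_assoc]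

lemma smul_smul_self (c : (orbitIdeal Γ x).Cotangent) : e • e • c = e • c := by
  rw [smul_smul, smul_cotangent_congr he.mul_self_sub_mem]

lemma cotangentAct_smul_of_mem {γ : Γ} (hγ : γ ∈ isotropy Γ x) (c : (orbitIdeal Γ x).Cotangent) :
    cotangentAct x γ (e • c) = e • cotangentAct x γ c := by
  rw [cotangentAct_smul, smul_cotangent_congr (he.smul_sub_mem hγ)]

lemma smul_cotangentAct_of_notMem {γ : Γ} (hγ : γ ∉ isotropy Γ x)
    (c : (orbitIdeal Γ x).Cotangent) : e • cotangentAct x γ (e • c) = 0 := by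
  rw [cotangentAct_smul, smul_smul]
  exact Ideal.Cotangent.smul_eq_zero_of_mem (he.mul_smul_mem hγ) _

end IsSeparating

end Cotangent

/-! ### Equivariant maps on `K / 𝔔_x` as maps on the cotangent space at `x` -/

section LocalHoms

variable {k : Type u} [Field k] {Γ : Type*} [CommGroup Γ]
  {A : Type u} [CommRing A] [Algebra k A] [MulSemiringAction Γ A] [SMulCommClass Γ k A]
  {𝔤 : Type u} [LieRing 𝔤] [LieAlgebra k 𝔤] [DistribMulAction Γ 𝔤] [SMulCommClass Γ k 𝔤]
  [IsLieAction Γ 𝔤] (x : A →ₐ[k] k) (e : A)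
  (M : Type u) [AddCommGroup M] [Module k M] [LieRingModule (fixedAt Γ 𝔤 x) M]
  [LieModule k (fixedAt Γ 𝔤 x) M]

variable (Γ 𝔤) in
/-- The maps on `I/I²` that factor through the cotangent space at `x` and are equivariant under
the isotropy group. -/
noncomputable def localHoms :
    Submodule k ((orbitIdeal Γ x).Cotangent →ₗ[k] (𝔤 →ₗ⁅k, fixedAt Γ 𝔤 x⁆ M)) where
  carrier := {G | (∀ c, G (e • c) = G c) ∧
    ∀ γ ∈ isotropy Γ x, ∀ c u, G (cotangentAct x γ c) (γ • u) = G c u}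
  add_mem' := fun {G H} hG hH => ⟨fun c => by
    rw [LinearMap.add_apply, LinearMap.add_apply, hG.1, hH.1], fun γ hγ c u => by
    rw [LinearMap.add_apply, LinearMap.add_apply, LieModuleHom.add_apply, LieModuleHom.add_apply,
      hG.2 γ hγ, hH.2 γ hγ]⟩
  zero_mem' := ⟨fun _ => rfl, fun _ _ _ _ => rfl⟩
  smul_mem' := fun a G hG => ⟨fun c => by
    rw [LinearMap.smul_apply, LinearMap.smul_apply, hG.1], fun γ hγ c u => by
    rw [LinearMap.smul_apply, LinearMap.smul_apply, LieModuleHom.smul_apply,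
      LieModuleHom.smul_apply, hG.2 γ hγ]⟩

variable {x e M}

variable (Γ x) in
/-- The properties of the map `t ↦ f (∑ γ, γ t)` for an equivariant `f` that vanishes
on `𝔔_x`. -/
structure IsAveraged (F : A ⊗[k] 𝔤 →ₗ[k] M) : Prop where
  apply_eq_zero : ∀ t ∈ tensorIdeal k 𝔤 (orbitIdeal Γ x ^ 2), F t = 0
  apply_lie : ∀ (α : mapAlgebra k Γ A 𝔤), ∀ t ∈ tensorIdeal k 𝔤 (orbitIdeal Γ x),
    F ⁅(α : A ⊗[k] 𝔤), t⁆ = ⁅ev Γ 𝔤 x α, F t⁆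
  apply_diag : ∀ γ : Γ, ∀ t ∈ tensorIdeal k 𝔤 (orbitIdeal Γ x), F (diag k 𝔤 A γ t) = F t

namespace IsAveraged

variable {F : A ⊗[k] 𝔤 →ₗ[k] M} (hF : IsAveraged Γ x F)
include hF

lemma congr_left {a a' : A} (h : a - a' ∈ orbitIdeal Γ x) {b : A} (hb : b ∈ orbitIdeal Γ x)
    (u : 𝔤) : F ((a * b) ⊗ₜ u) = F ((a' * b) ⊗ₜ u) := by
  rw [← sub_eq_zero, ← map_sub, ← TensorProduct.sub_tmul, ← sub_mul]
  refine hF.apply_eq_zero _ (tmul_mem_tensorIdeal ?_ u)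
  rw [sq]
  exact Ideal.mul_mem_mul h hb

lemma congr_right (a : A) {b b' : orbitIdeal Γ x}
    (h : (orbitIdeal Γ x).toCotangent b = (orbitIdeal Γ x).toCotangent b')
    (u : 𝔤) : F ((a * b) ⊗ₜ u) = F ((a * b') ⊗ₜ u) := by
  rw [← sub_eq_zero, ← map_sub, ← TensorProduct.sub_tmul, ← mul_sub]
  exact hF.apply_eq_zero _ (tmul_mem_tensorIdeal
    (Ideal.mul_mem_left _ _ ((orbitIdeal Γ x).toCotangent_eq.mp h)) u)

lemma apply_smul {γ : Γ} {b : A} (hb : b ∈ orbitIdeal Γ x) (u : 𝔤) :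
    F ((γ • b) ⊗ₜ (γ • u)) = F (b ⊗ₜ u) := by
  rw [← diag_tmul]
  exact hF.apply_diag γ _ (tmul_mem_tensorIdeal hb u)

/-- Lift `l` to some `α` in `𝔐`. The factor `e` replaces the coefficients of `α` by their values at
`x`, up to terms in `I² ⊗ 𝔤`. -/
lemma apply_lie_tmul (he : IsSeparating Γ x e) [CharZero k] [Finite Γ] (l : fixedAt Γ 𝔤 x) {b : A}
    (hb : b ∈ orbitIdeal Γ x) (u : 𝔤) :
    F ((e * b) ⊗ₜ ⁅l, u⁆) = ⁅l, F ((e * b) ⊗ₜ u)⁆ := by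
  obtain ⟨α, rfl⟩ := ev_surjective 𝔤 x l
  rw [← hF.apply_lie α _ (tmul_mem_tensorIdeal (Ideal.mul_mem_left _ _ hb) u)]
  rw [LieSubalgebra.coe_bracket_of_module, coe_ev]
  induction (α : A ⊗[k] 𝔤) using TensorProduct.induction_on with
  | zero => simp
  | add s t hs ht => rw [map_add, add_lie, TensorProduct.tmul_add, map_add, hs, ht, add_lie, map_add]
  | tmul a w =>
    rw [evalAt_tmul, smul_lie, TensorProduct.tmul_smul, TensorProduct.smul_tmul',
      LieAlgebra.ExtendScalars.bracket_tmul, ← smul_mul_assoc, ← mul_assoc, mul_comm a e]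
    exact (hF.congr_left (he.mul_sub_mem a) hb _).symm

/-- Insert `∑ γ • e`, which is `|Γ_x|` modulo `I`, and move each `γ` off `e` by invariance. Hence
`F` is determined on `I ⊗ 𝔤` by its values on `e I ⊗ 𝔤`. -/
lemma card_smul_apply (he : IsSeparating Γ x e) [Fintype Γ] {b : A} (hb : b ∈ orbitIdeal Γ x)
    (u : 𝔤) : (Nat.card (isotropy Γ x) : k) • F (b ⊗ₜ u) =
      ∑ γ : Γ, F ((e * γ⁻¹ • b) ⊗ₜ (γ⁻¹ • u)) := by
  have h := hF.congr_left he.sum_smul_sub_mem hb u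
  rw [← Algebra.smul_def, ← TensorProduct.smul_tmul', map_smul] at h
  rw [← h, Finset.sum_mul, TensorProduct.sum_tmul, map_sum]
  refine Finset.sum_congr rfl fun γ _ => ?_
  rw [← hF.apply_smul (γ := γ) (Ideal.mul_mem_left _ _ (smul_mem_orbitIdeal' x γ⁻¹ hb)),
    smul_mul', smul_inv_smul, smul_inv_smul]

end IsAveraged

variable (x M) in
-- A linear retraction of `𝔐` onto the kernel extends `t ↦ f (∑ γ t)` to all of `A ⊗ 𝔤`; only the
-- values on `I ⊗ 𝔤` are canonical.
lemma exists_averaging [Fintype Γ] :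
    ∃ Θ : kerHomsMod (Γ := Γ) (𝔤 := 𝔤) x M →ₗ[k] (A ⊗[k] 𝔤 →ₗ[k] M),
      ∀ f, ∀ t ∈ tensorIdeal k 𝔤 (orbitIdeal Γ x), ∀ n : (ev Γ 𝔤 x).ker,
        (n : mapAlgebra k Γ A 𝔤) = av k Γ A 𝔤 t → Θ f t = (f.1 : (ev Γ 𝔤 x).ker →ₗ[k] M) n := by
  obtain ⟨q, hq⟩ : ∃ q : mapAlgebra k Γ A 𝔤 →ₗ[k] (ev Γ 𝔤 x).ker,
      ∀ n : (ev Γ 𝔤 x).ker, q n = n := by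
    obtain ⟨q, hq⟩ := LinearMap.exists_leftInverse_of_injective
      (ev Γ 𝔤 x).ker.toSubmodule.subtype (Submodule.ker_subtype _)
    exact ⟨q, LinearMap.congr_fun hq⟩
  refine ⟨LinearMap.lcomp k M (q ∘ₗ av k Γ A 𝔤) ∘ₗ (kerHoms (ev Γ 𝔤 x) M).subtype ∘ₗ
    (kerHomsMod (Γ := Γ) (𝔤 := 𝔤) x M).subtype, fun f t ht n hn => ?_⟩
  have h : q (av k Γ A 𝔤 t) = n := by rw [← hn, hq]
  exact congrArg (f.1 : (ev Γ 𝔤 x).ker →ₗ[k] M) h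

lemma isAveraged_of_apply_eq [Fintype Γ] (f : kerHomsMod (Γ := Γ) (𝔤 := 𝔤) x M)
    (F : A ⊗[k] 𝔤 →ₗ[k] M) (hF : ∀ t ∈ tensorIdeal k 𝔤 (orbitIdeal Γ x), ∀ n : (ev Γ 𝔤 x).ker,
        (n : mapAlgebra k Γ A 𝔤) = av k Γ A 𝔤 t → F t = (f.1 : (ev Γ 𝔤 x).ker →ₗ[k] M) n) :
    IsAveraged Γ x F := by
  have hex : ∀ t ∈ tensorIdeal k 𝔤 (orbitIdeal Γ x), ∃ n : (ev Γ 𝔤 x).ker,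
    (n : mapAlgebra k Γ A 𝔤) = av k Γ A 𝔤 t := fun t ht =>
      ⟨⟨_, LieHom.mem_ker.mpr (ev_av x ht)⟩, rfl⟩
  refine ⟨fun t ht => ?_, fun α t ht => ?_, fun γ t ht => ?_⟩
  · have hle : tensorIdeal k 𝔤 (orbitIdeal Γ x ^ 2) ≤ tensorIdeal k 𝔤 (orbitIdeal Γ x) :=
      tensorIdeal_le fun a ha u => tmul_mem_tensorIdeal (Ideal.pow_le_self two_ne_zero ha) u
    obtain ⟨n, hn⟩ := hex t (hle ht)
    rw [hF t (hle ht) n hn]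
    refine f.2 n ?_
    rw [mem_kerQ, hn]
    exact av_mem_idealQ x ht
  · obtain ⟨n, hn⟩ := hex t ht
    rw [hF t ht n hn, ← f.1.2]
    refine hF _ (lie_mem_tensorIdeal 𝔤 _ _ ht) _ ?_
    rw [LieSubmodule.coe_bracket, hn, lie_av]
  · obtain ⟨n, hn⟩ := hex t ht
    rw [hF t ht n hn]
    refine hF _ (diag_mem_tensorIdeal γ (fun a ha => smul_mem_orbitIdeal' x γ ha) ht) n ?_
    rw [hn, av_diag]

/-- As `Θ f` kills `I² ⊗ 𝔤`, its value at `e b ⊗ u` depends only on the class of `b` in `I/I²`.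
Idempotence and `Γ_x`-invariance of `e` modulo `I` give the two conditions on local maps. -/
lemma exists_localHom [CharZero k] [Finite Γ] {X : Type*} [AddCommGroup X] [Module k X]
    (he : IsSeparating Γ x e) (Θ : X →ₗ[k] (A ⊗[k] 𝔤 →ₗ[k] M)) (hΘ : ∀ f, IsAveraged Γ x (Θ f)) :
    ∃ Ψ : X →ₗ[k] localHoms Γ 𝔤 x e M, ∀ f (b : orbitIdeal Γ x) u,
      (Ψ f).1 ((orbitIdeal Γ x).toCotangent b) u = Θ f ((e * b) ⊗ₜ u) := by
  set I := orbitIdeal Γ x with hI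
  obtain ⟨s, hs⟩ : ∃ s : I.Cotangent →ₗ[k] I, ∀ c, I.toCotangent (s c) = c := by
    obtain ⟨s, hs⟩ := LinearMap.exists_rightInverse_of_surjective
      (I.toCotangent.restrictScalars k) (LinearMap.range_eq_top.mpr I.toCotangent_surjective)
    exact ⟨s, LinearMap.congr_fun hs⟩
  obtain ⟨j, hj⟩ : ∃ j : I.Cotangent →ₗ[k] A, ∀ c, j c = e * s c :=
    ⟨LinearMap.mulLeft k e ∘ₗ (I.subtype.restrictScalars k) ∘ₗ s, fun c => rfl⟩
  have hlift : ∀ f (b : I) (u : 𝔤), Θ f (j (I.toCotangent b) ⊗ₜ u) = Θ f ((e * b) ⊗ₜ u) :=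
    fun f b u => by
      rw [hj]
      exact (hΘ f).congr_right e (hs _) u
  obtain ⟨Ψ, hΨ⟩ : ∃ Ψ : X →ₗ[k] (I.Cotangent →ₗ[k] (𝔤 →ₗ⁅k, fixedAt Γ 𝔤 x⁆ M)),
      ∀ f c u, Ψ f c u = Θ f (j c ⊗ₜ u) := by
    refine ⟨{ toFun := fun f =>
                { toFun := fun c =>
                    { Θ f ∘ₗ TensorProduct.mk k A 𝔤 (j c) with
                      map_lie' := fun {l u} => ?_ }
                  map_add' := fun c d => ?_
                  map_smul' := fun a c => ?_ }
              map_add' := fun f g => ?_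
              map_smul' := fun a f => ?_ }, fun f b u => rfl⟩
    · change Θ f (j c ⊗ₜ _) = ⁅l, Θ f (j c ⊗ₜ u)⁆
      rw [hj]
      exact (hΘ f).apply_lie_tmul he l (s c).2 u
    · ext u
      change Θ f (j (c + d) ⊗ₜ u) = Θ f (j c ⊗ₜ u) + Θ f (j d ⊗ₜ u)
      rw [map_add, TensorProduct.add_tmul, map_add]
    · ext u
      change Θ f (j (a • c) ⊗ₜ u) = a • Θ f (j c ⊗ₜ u)
      rw [map_smul j, ← TensorProduct.smul_tmul', map_smul]
    · ext c u
      change Θ (f + g) _ = Θ f _ + Θ g _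
      rw [map_add]
      rfl
    · ext c u
      change Θ (a • f) _ = a • Θ f _
      rw [map_smul]
      rfl
  have hΨ' : ∀ f (b : I) u, Ψ f (I.toCotangent b) u = Θ f ((e * b) ⊗ₜ u) := fun f b u => by
    rw [hΨ, hlift]
  refine ⟨Ψ.codRestrict _ fun f => ⟨fun c => ?_, fun γ hγ c u => ?_⟩, hΨ'⟩
  · obtain ⟨b, rfl⟩ := I.toCotangent_surjective c
    ext u
    rw [← map_smul, hΨ', hΨ']
    rw [Submodule.coe_smul, smul_eq_mul, ← mul_assoc]
    exact (hΘ f).congr_left he.mul_self_sub_mem b.2 u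
  · obtain ⟨b, rfl⟩ := I.toCotangent_surjective c
    rw [cotangentAct_mk, hΨ', hΨ']
    rw [← (hΘ f).apply_smul (γ := γ) (Ideal.mul_mem_left _ _ b.2), smul_mul']
    exact ((hΘ f).congr_left (he.smul_sub_mem hγ) (smul_mem_orbitIdeal' x γ b.2) _).symm

lemma IsAveraged.eq_zero_of_tmul [CharZero k] [Fintype Γ] (he : IsSeparating Γ x e)
    {F : A ⊗[k] 𝔤 →ₗ[k] M} (hF : IsAveraged Γ x F)
    (h : ∀ b ∈ orbitIdeal Γ x, ∀ u : 𝔤, F ((e * b) ⊗ₜ u) = 0) :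
    ∀ t ∈ tensorIdeal k 𝔤 (orbitIdeal Γ x), F t = 0 := fun t ht => by
  have hN : (Nat.card (isotropy Γ x) : k) ≠ 0 := by exact_mod_cast Nat.card_pos.ne'
  refine tensorIdeal_le (S := LinearMap.ker F) (fun b hb u => ?_) ht
  rw [LinearMap.mem_ker, ← smul_eq_zero_iff_right hN, hF.card_smul_apply he hb]
  exact Finset.sum_eq_zero fun γ _ => h _ (smul_mem_orbitIdeal' x _ hb) _

/-- The map `A ⊗ 𝔤 → M` attached to a map on the cotangent space. -/
lemma exists_lift_localHom (he : IsSeparating Γ x e) (G : localHoms Γ 𝔤 x e M) :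
    ∃ H : A ⊗[k] 𝔤 →ₗ[k] M,
      (∀ (b : orbitIdeal Γ x) (u : 𝔤),
        H ((b : A) ⊗ₜ u) = G.1 ((orbitIdeal Γ x).toCotangent b) u) ∧
      (∀ t ∈ tensorIdeal k 𝔤 (orbitIdeal Γ x ^ 2), H t = 0) ∧
      ∀ (α : mapAlgebra k Γ A 𝔤), ∀ t ∈ tensorIdeal k 𝔤 (orbitIdeal Γ x),
        H ⁅(α : A ⊗[k] 𝔤), t⁆ = ⁅ev Γ 𝔤 x α, H t⁆ := by
  have hG := G.2.1
  set I := orbitIdeal Γ x with hI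
  obtain ⟨r, hr⟩ : ∃ r : A →ₗ[k] I.Cotangent, ∀ b : I, r b = I.toCotangent b := by
    obtain ⟨r, hr⟩ := LinearMap.exists_extend (p := I.restrictScalars k)
      (I.toCotangent.restrictScalars k)
    exact ⟨r, LinearMap.congr_fun hr⟩
  obtain ⟨H, hH⟩ : ∃ H : A ⊗[k] 𝔤 →ₗ[k] M, ∀ a u, H (a ⊗ₜ u) = G.1 (r a) u :=
    ⟨TensorProduct.lift
      { toFun := fun a => (G.1 (r a) : 𝔤 →ₗ[k] M)
        map_add' := fun a b => by rw [map_add, map_add]; rfl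
        map_smul' := fun c a => by rw [map_smul, map_smul]; rfl }, fun a u => rfl⟩
  -- Because `G (e • c) = G c`, an element `a` of `A` acts under `G` as the scalar `x a`, so a
  -- bracket sees only the value of `t` at `x`.
  have hHlie : ∀ (t : A ⊗[k] 𝔤) (b : I) (u : 𝔤),
      H ⁅t, (b : A) ⊗ₜ u⁆ = G.1 (I.toCotangent b) ⁅evalAt 𝔤 x t, u⁆ := by
    intro t b u
    induction t using TensorProduct.induction_on with
    | zero => simp
    | add s t hs ht => rw [map_add, add_lie, map_add, hs, ht, add_lie, map_add]
    | tmul a w =>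
      rw [LieAlgebra.ExtendScalars.bracket_tmul, hH, evalAt_tmul, smul_lie, map_smul]
      have h1 : r (a * b) = a • I.toCotangent b := by
        rw [← map_smul]
        exact hr (a • b)
      rw [h1, ← hG, he.mul_smul_eq, map_smul, hG]
      rfl
  refine ⟨H, fun b u => by rw [hH, hr], fun t ht => ?_, fun α t ht => ?_⟩
  · refine tensorIdeal_le (S := LinearMap.ker H) (fun b hb u => ?_) ht
    have hb' : b ∈ I := Ideal.pow_le_self two_ne_zero hb
    rw [LinearMap.mem_ker, hH, hr ⟨b, hb'⟩, (I.toCotangent_eq_zero ⟨b, hb'⟩).mpr hb, map_zero]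
    rfl
  · refine tensorIdeal_le (S := LinearMap.eqLocus
      (H ∘ₗ LieModule.toEnd k (A ⊗[k] 𝔤) (A ⊗[k] 𝔤) (α : A ⊗[k] 𝔤))
      (LieModule.toEnd k _ M (ev Γ 𝔤 x α) ∘ₗ H)) (fun b hb u => ?_) ht
    change H ⁅(α : A ⊗[k] 𝔤), _⁆ = ⁅ev Γ 𝔤 x α, H _⁆
    rw [hHlie _ ⟨b, hb⟩, hH, hr ⟨b, hb⟩, ← LieModuleHom.map_lie]
    rfl

/-- The factor `|Γ_x|⁻¹` makes this a section of the passage to local maps; see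
`lift_localHom_apply_av`. -/
lemma exists_kerHomsMod_of_localHom [Finite Γ] (he : IsSeparating Γ x e)
    (G : localHoms Γ 𝔤 x e M) :
    ∃ (f : kerHomsMod (Γ := Γ) (𝔤 := 𝔤) x M) (H : A ⊗[k] 𝔤 →ₗ[k] M),
      (∀ (b : orbitIdeal Γ x) (u : 𝔤),
        H ((b : A) ⊗ₜ u) = G.1 ((orbitIdeal Γ x).toCotangent b) u) ∧
      ∀ n : (ev Γ 𝔤 x).ker, (f.1 : (ev Γ 𝔤 x).ker →ₗ[k] M) n =
        (Nat.card (isotropy Γ x) : k)⁻¹ • H ((n : mapAlgebra k Γ A 𝔤) : A ⊗[k] 𝔤) := by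
  obtain ⟨H, hH, hH0, hHlie⟩ := exists_lift_localHom he G
  obtain ⟨f₀, hf₀⟩ : ∃ f₀ : (ev Γ 𝔤 x).ker →ₗ[k] M, ∀ n, f₀ n =
      (Nat.card (isotropy Γ x) : k)⁻¹ • H ((n : mapAlgebra k Γ A 𝔤) : A ⊗[k] 𝔤) :=
    ⟨(Nat.card (isotropy Γ x) : k)⁻¹ •
      (H ∘ₗ (mapAlgebra k Γ A 𝔤).toSubmodule.subtype ∘ₗ (ev Γ 𝔤 x).ker.toSubmodule.subtype),
      fun n => rfl⟩
  refine ⟨⟨⟨f₀, fun α n => ?_⟩, fun n hn => ?_⟩, H, hH, hf₀⟩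
  · rw [hf₀, hf₀, lie_smul, ← hHlie α _ (coe_mem_tensorIdeal x (LieHom.mem_ker.mp n.2)),
      LieSubmodule.coe_bracket, LieSubalgebra.coe_bracket]
  · change f₀ n = 0
    have h0 : H ((n : mapAlgebra k Γ A 𝔤) : A ⊗[k] 𝔤) = 0 := hH0 _ hn
    rw [hf₀, h0, smul_zero]

/-- Each `γ` in `Γ_x` contributes the same term. For the others `γ • e` is orthogonal to `e` modulo
`I`, so their terms vanish. -/
lemma lift_localHom_apply_av [CharZero k] [Fintype Γ] (he : IsSeparating Γ x e)
    (G : localHoms Γ 𝔤 x e M) (H : A ⊗[k] 𝔤 →ₗ[k] M)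
    (hH : ∀ (b : orbitIdeal Γ x) (u : 𝔤),
        H ((b : A) ⊗ₜ u) = G.1 ((orbitIdeal Γ x).toCotangent b) u)
    (b : orbitIdeal Γ x) (u : 𝔤) :
    H (av k Γ A 𝔤 ((e * b) ⊗ₜ u) : A ⊗[k] 𝔤) = (Nat.card (isotropy Γ x) : k) •
      G.1 ((orbitIdeal Γ x).toCotangent b) u := by
  classical
  have hG1 := G.2.1
  have hG2 := G.2.2
  rw [coe_av, map_sum]
  have h1 : ∀ γ : Γ, H (diag k 𝔤 A γ ((e * b) ⊗ₜ u)) =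
      if γ ∈ isotropy Γ x then G.1 ((orbitIdeal Γ x).toCotangent b) u else 0 := by
    intro γ
    have h2 : H (diag k 𝔤 A γ ((e * b) ⊗ₜ u)) =
        G.1 (cotangentAct x γ (e • (orbitIdeal Γ x).toCotangent b)) (γ • u) := by
      rw [diag_tmul, ← map_smul (orbitIdeal Γ x).toCotangent, cotangentAct_mk, ← hH]
      rfl
    rw [h2]
    split_ifs with h
    · rw [hG2 γ h, hG1]
    · rw [← hG1, he.smul_cotangentAct_of_notMem h, map_zero]
      rfl
  simp_rw [h1]
  rw [← Finset.sum_filter, Finset.sum_const, ← Fintype.card_subtype, ← Nat.card_eq_fintype_card,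
    ← Nat.cast_smul_eq_nsmul k]

set_option maxHeartbeats 1000000 in
variable (𝔤 M) in
/-- An equivariant map on the kernel of evaluation that vanishes on `𝔔_x` is the same as a map
on the cotangent space. -/
theorem nonempty_kerHomsMod_equiv [CharZero k] [Finite Γ] (he : IsSeparating Γ x e) :
    Nonempty (kerHomsMod (Γ := Γ) (𝔤 := 𝔤) x M ≃ₗ[k] localHoms Γ 𝔤 x e M) := by
  have := Fintype.ofFinite Γ
  have hN : (Nat.card (isotropy Γ x) : k) ≠ 0 := by exact_mod_cast Nat.card_pos.ne'
  have hΓ : (Fintype.card Γ : k) ≠ 0 := by exact_mod_cast Fintype.card_ne_zero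
  obtain ⟨Θ, hΘ⟩ := exists_averaging (𝔤 := 𝔤) (Γ := Γ) x M
  have hΘ' : ∀ f, IsAveraged Γ x (Θ f) := fun f => isAveraged_of_apply_eq f _ (hΘ f)
  obtain ⟨Ψ, hΨ⟩ := exists_localHom (X := kerHomsMod (Γ := Γ) (𝔤 := 𝔤) x M) he Θ hΘ'
  refine ⟨LinearEquiv.ofBijective Ψ
    ⟨(injective_iff_map_eq_zero _).mpr fun f hf => ?_, fun G => ?_⟩⟩
  · have h2 := (hΘ' f).eq_zero_of_tmul he fun b hb u => by
      rw [← hΨ f ⟨b, hb⟩ u, hf]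
      rfl
    apply Subtype.ext
    apply Subtype.ext
    refine LinearMap.ext fun n => ?_
    -- Averaging `n` gives `|Γ| n`, so `f n` is recovered from `Θ f`, which vanishes on `I ⊗ 𝔤`.
    have hn := coe_mem_tensorIdeal x (LieHom.mem_ker.mp n.2)
    have h3 := hΘ f _ hn ((Fintype.card Γ : k) • n) (av_coe _).symm
    rw [h2 _ hn, map_smul] at h3
    exact (smul_eq_zero_iff_right hΓ).mp h3.symm
  · obtain ⟨f, H, hH, hf⟩ := exists_kerHomsMod_of_localHom he G
    refine ⟨f, Subtype.ext (LinearMap.ext fun c => LieModuleHom.ext fun u => ?_)⟩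
    obtain ⟨b, rfl⟩ := (orbitIdeal Γ x).toCotangent_surjective c
    have ht : (e * b) ⊗ₜ u ∈ tensorIdeal k 𝔤 (orbitIdeal Γ x) :=
      tmul_mem_tensorIdeal (Ideal.mul_mem_left _ _ b.2) u
    obtain ⟨n, hn⟩ : ∃ n : (ev Γ 𝔤 x).ker, (n : mapAlgebra k Γ A 𝔤) = av k Γ A 𝔤 ((e * b) ⊗ₜ u) :=
      ⟨⟨_, LieHom.mem_ker.mpr (ev_av x ht)⟩, rfl⟩
    refine (hΨ f b u).trans ((hΘ f _ ht n hn).trans ((hf n).trans ?_))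
    rw [inv_smul_eq_iff₀ hN, hn]
    exact lift_localHom_apply_av he G H hH b u

end LocalHoms

end EquivMap

/-! ### Decomposition according to the characters -/

namespace EquivMap

section Characters

variable {k : Type u} [Field k] [CharZero k] {Γ : Type*} [CommGroup Γ] [Finite Γ]
  {A : Type u} [CommRing A] [Algebra k A] [MulSemiringAction Γ A] [SMulCommClass Γ k A]
  {𝔤 : Type u} [LieRing 𝔤] [LieAlgebra k 𝔤] [DistribMulAction Γ 𝔤] [SMulCommClass Γ k 𝔤]
  [IsLieAction Γ 𝔤] {x : A →ₐ[k] k} {e : A}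
  {M : Type u} [AddCommGroup M] [Module k M] [LieRingModule (fixedAt Γ 𝔤 x) M]
  [LieModule k (fixedAt Γ 𝔤 x) M]

/-- Concentrate `c` at `x` with `e`, then spread it over the orbit with the weights `χ γ`. On the
`χ⁻¹`-component each weighted term is `(γ • e) • c`, and these sum to `|Γ_x| c`. -/
lemma exists_cotangent_projection (he : IsSeparating Γ x e) (χ : Γ →* kˣ) :
    ∃ P : (orbitIdeal Γ x).Cotangent →ₗ[k] cotangentComponent Γ x χ⁻¹,
      (∀ c : cotangentComponent Γ x χ⁻¹, P c = c) ∧ (∀ c, P (e • c) = P c) ∧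
      (∀ γ ∈ isotropy Γ x, ∀ c, P (cotangentAct x γ c) = (χ γ : k)⁻¹ • P c) ∧
      ∀ c, (P c : (orbitIdeal Γ x).Cotangent) = (Nat.card (isotropy Γ x) : k)⁻¹ •
        ∑ᶠ γ : Γ, (χ γ : k) • cotangentAct x γ (e • c) := by
  have := Fintype.ofFinite Γ
  have hN : (Nat.card (isotropy Γ x) : k) ≠ 0 := by exact_mod_cast Nat.card_pos.ne'
  obtain ⟨p, hp⟩ : ∃ p : (orbitIdeal Γ x).Cotangent →ₗ[k] (orbitIdeal Γ x).Cotangent,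
      ∀ c, p c = (Nat.card (isotropy Γ x) : k)⁻¹ •
        ∑ γ : Γ, (χ γ : k) • cotangentAct x γ (e • c) :=
    ⟨{  toFun := fun c => (Nat.card (isotropy Γ x) : k)⁻¹ •
          ∑ γ : Γ, (χ γ : k) • cotangentAct x γ (e • c)
        map_add' := fun c d => by
          simp only [smul_add, map_add, Finset.sum_add_distrib]
        map_smul' := fun a c => by
          rw [RingHom.id_apply, smul_comm a, Finset.smul_sum (r := a)]
          congr 1
          refine Finset.sum_congr rfl fun γ _ => ?_
          rw [smul_comm e a c, map_smul, smul_comm] }, fun c => rfl⟩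
  have hmem : ∀ c, p c ∈ cotangentComponent Γ x χ⁻¹ := fun c => by
    rw [mem_cotangentComponent]
    intro δ
    rw [hp, map_smul, smul_comm, map_sum]
    congr 1
    rw [Finset.smul_sum]
    refine Fintype.sum_equiv (Equiv.mulLeft δ) _ _ fun γ => ?_
    rw [Equiv.coe_mulLeft, map_smul, ← cotangentAct_mul, smul_smul, map_mul]
    congr 1
    simp
  refine ⟨p.codRestrict _ hmem, fun c => Subtype.ext ?_, fun c => Subtype.ext ?_,
    fun γ hγ c => Subtype.ext ?_, fun c => ?_⟩
  · rw [LinearMap.codRestrict_apply, hp, inv_smul_eq_iff₀ hN]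
    have h : ∀ γ : Γ, (χ γ : k) • cotangentAct x γ (e • (c : (orbitIdeal Γ x).Cotangent)) =
        (γ • e) • (c : (orbitIdeal Γ x).Cotangent) := fun γ => by
      rw [cotangentAct_smul, (mem_cotangentComponent x).mp c.2 γ, smul_comm, smul_smul]
      simp
    simp_rw [h]
    rw [← Finset.sum_smul, smul_cotangent_congr he.sum_smul_sub_mem, algebraMap_smul]
  · rw [LinearMap.codRestrict_apply, LinearMap.codRestrict_apply, hp, hp, he.smul_smul_self]
  · rw [LinearMap.codRestrict_apply, Submodule.coe_smul, LinearMap.codRestrict_apply, hp, hp,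
      smul_comm]
    congr 1
    rw [Finset.smul_sum]
    refine Fintype.sum_equiv (Equiv.mulRight γ) _ _ fun δ => ?_
    rw [← he.cotangentAct_smul_of_mem hγ, ← cotangentAct_mul, Equiv.coe_mulRight, smul_smul,
      map_mul]
    congr 1
    simp
    field_simp
  · rw [LinearMap.codRestrict_apply, hp, finsum_eq_sum_of_fintype]

/-- On the elements on which the isotropy group acts through `χ`, a local homomorphism is
determined by its restriction to the component of `χ⁻¹`. -/
lemma localHoms_apply_projection (he : IsSeparating Γ x e) (χ : Γ →* kˣ)
    (G : localHoms Γ 𝔤 x e M) {c c' : (orbitIdeal Γ x).Cotangent}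
    (h : c' = (Nat.card (isotropy Γ x) : k)⁻¹ •
        ∑ᶠ γ : Γ, (χ γ : k) • cotangentAct x γ (e • c)) {u : 𝔤}
    (hu : ∀ γ ∈ isotropy Γ x, γ • u = (χ γ : k) • u) : G.1 c' u = G.1 c u := by
  classical
  have := Fintype.ofFinite Γ
  have hN : (Nat.card (isotropy Γ x) : k) ≠ 0 := by exact_mod_cast Nat.card_pos.ne'
  have hG1 := G.2.1
  have hG2 := G.2.2
  rw [h, finsum_eq_sum_of_fintype, map_smul, map_sum, LieModuleHom.smul_apply,
    inv_smul_eq_iff₀ hN]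
  -- For `γ` in `Γ_x` the weight `χ γ` cancels the action of `γ⁻¹` on `u`; outside `Γ_x`
  -- orthogonality of `e` and `γ • e` gives zero.
  have h1 : ∀ γ : Γ, G.1 ((χ γ : k) • cotangentAct x γ (e • c)) u =
      if γ ∈ isotropy Γ x then G.1 c u else 0 := by
    intro γ
    split_ifs with h
    · have h2 := hG2 γ h (e • c) (γ⁻¹ • u)
      rw [smul_inv_smul, hu _ ((isotropy Γ x).inv_mem h), hG1, map_smul (G.1 c)] at h2
      rw [map_smul, LieModuleHom.smul_apply, h2, smul_smul]
      simp
    · rw [map_smul, ← hG1, he.smul_cotangentAct_of_notMem h, map_zero, smul_zero]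
      rfl
  let ev' : (𝔤 →ₗ⁅k, fixedAt Γ 𝔤 x⁆ M) →ₗ[k] M :=
    { toFun := fun T => T u
      map_add' := fun _ _ => rfl
      map_smul' := fun _ _ => rfl }
  change ev' (∑ γ : Γ, G.1 ((χ γ : k) • cotangentAct x γ (e • c))) = _
  rw [map_sum]
  change ∑ γ : Γ, G.1 ((χ γ : k) • cotangentAct x γ (e • c)) u = _
  simp_rw [h1]
  rw [← Finset.sum_filter, Finset.sum_const, ← Fintype.card_subtype, ← Nat.card_eq_fintype_card,
    ← Nat.cast_smul_eq_nsmul k]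

variable [IsAlgClosed k]

variable (a : (Γ →* kˣ) ⧸ charSubgroup Γ x → (Γ →* kˣ))
  (ha : ∀ ω, (QuotientGroup.mk (a ω) : (Γ →* kˣ) ⧸ charSubgroup Γ x) = ω)
include ha

omit [CharZero k] [Finite Γ] [IsAlgClosed k] in
lemma apply_eq_of_mem_isotropy {ω : (Γ →* kˣ) ⧸ charSubgroup Γ x} {ξ : Γ →* kˣ}
    (hξ : (QuotientGroup.mk ξ : (Γ →* kˣ) ⧸ charSubgroup Γ x) = ω) {γ : Γ}
    (hγ : γ ∈ isotropy Γ x) : a ω γ = ξ γ := by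
  have h := QuotientGroup.eq.mp ((ha ω).trans hξ.symm) γ hγ
  simpa [inv_mul_eq_one] using h

lemma mem_cosetSpace_iff {ω : (Γ →* kˣ) ⧸ charSubgroup Γ x} {u : 𝔤} :
    u ∈ cosetSpace Γ 𝔤 x ω ↔ ∀ γ ∈ isotropy Γ x, γ • u = (a ω γ : k) • u := by
  have h := ha ω
  constructor
  · intro hu
    refine smul_of_mem_iSup_weightSpace 𝔤 x (a ω) ?_
    rw [h]
    exact hu
  · intro hu
    have := mem_iSup_weightSpace_of_isotropy 𝔤 x (a ω) hu
    rw [h] at this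
    exact this

/-- Orthogonality of the characters of `Γ_x`, represented by the cosets: translation by a character
`η` with `η δ ≠ 1` permutes the cosets and multiplies the sum by `η δ`. -/
lemma sum_coset_apply_eq_zero [Fintype ((Γ →* kˣ) ⧸ charSubgroup Γ x)] {δ : Γ}
    (hδ : δ ∈ isotropy Γ x) (h1 : δ ≠ 1) :
    ∑ ω : (Γ →* kˣ) ⧸ charSubgroup Γ x, (a ω δ : k) = 0 := by
  have : NeZero (Monoid.exponent Γ) := ⟨Monoid.exponent_ne_zero_of_finite⟩
  have : NeZero ((Monoid.exponent Γ : ℕ) : k) :=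
    ⟨by exact_mod_cast Monoid.exponent_ne_zero_of_finite⟩
  obtain ⟨η, hη⟩ := CommGroup.exists_apply_ne_one_of_hasEnoughRootsOfUnity Γ k h1
  have h : (η δ : k) * ∑ ω : (Γ →* kˣ) ⧸ charSubgroup Γ x, (a ω δ : k) =
      ∑ ω : (Γ →* kˣ) ⧸ charSubgroup Γ x, (a ω δ : k) := by
    rw [Finset.mul_sum]
    refine Fintype.sum_equiv (MulAction.toPerm η) _ _ fun ω => ?_
    have := apply_eq_of_mem_isotropy a ha (ω := η • ω) (ξ := η * a ω)
      (by conv_rhs => rw [← ha ω]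
          rfl) hδ
    rw [MulAction.toPerm_apply, this]
    simp
  have h' : ((η δ : k) - 1) * ∑ ω : (Γ →* kˣ) ⧸ charSubgroup Γ x, (a ω δ : k) = 0 := by
    rw [sub_mul, one_mul, h, sub_self]
  exact (mul_eq_zero.mp h').resolve_left fun h0 => hη (Units.ext (sub_eq_zero.mp h0))

/-- These are the isotypic projections for `Γ_x`. They commute with `𝔤^x` because `Γ_x` fixes it
pointwise. -/
lemma exists_cosetSpace_projection [Fintype ((Γ →* kˣ) ⧸ charSubgroup Γ x)] :
    ∃ pr : ∀ ω, 𝔤 →ₗ⁅k, fixedAt Γ 𝔤 x⁆ cosetSpace Γ 𝔤 x ω,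
      (∀ u, ∑ ω, (pr ω u : 𝔤) = u) ∧
      (∀ ω, ∀ u ∈ cosetSpace Γ 𝔤 x ω, ∀ ω', ω' ≠ ω → pr ω' u = 0) ∧
      (∀ ω, ∀ γ ∈ isotropy Γ x, ∀ u, pr ω (γ • u) = (a ω γ : k) • pr ω u) := by
  classical
  have := Fintype.ofFinite Γ
  -- The normalisation is the number of cosets, which is the coefficient left at `δ = 1` when the
  -- projections are added up. Its equality with `|Γ_x|` is not needed.
  set m : k := (Fintype.card ((Γ →* kˣ) ⧸ charSubgroup Γ x) : k) with hm
  have hm0 : m ≠ 0 := by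
    rw [hm]
    exact_mod_cast Fintype.card_ne_zero
  obtain ⟨p, hp⟩ : ∃ p : ((Γ →* kˣ) ⧸ charSubgroup Γ x) → 𝔤 →ₗ[k] 𝔤, ∀ ω u, p ω u =
      m⁻¹ • ∑ δ : isotropy Γ x, (a ω (δ : Γ)⁻¹ : k) • ((δ : Γ) • u) :=
    ⟨fun ω => m⁻¹ • ∑ δ : isotropy Γ x, (a ω (δ : Γ)⁻¹ : k) •
      DistribSMul.toLinearMap k 𝔤 (δ : Γ), fun ω u => by simp⟩
  have hp1 : ∀ ω, ∀ γ ∈ isotropy Γ x, ∀ u, p ω (γ • u) = (a ω γ : k) • p ω u := by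
    intro ω γ hγ u
    rw [hp, hp, smul_comm _ m⁻¹, Finset.smul_sum (r := (a ω γ : k))]
    congr 1
    refine Fintype.sum_equiv (Equiv.mulRight (⟨γ, hγ⟩ : isotropy Γ x)) _ _ fun δ => ?_
    rw [Equiv.coe_mulRight, smul_smul, smul_smul, Subgroup.coe_mul]
    congr 1
    simp
  have hp2 : ∀ ω, ∀ γ ∈ isotropy Γ x, ∀ u, γ • p ω u = (a ω γ : k) • p ω u := by
    intro ω γ hγ u
    rw [← hp1 ω γ hγ, hp, hp, smul_comm γ m⁻¹, Finset.smul_sum (r := γ)]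
    congr 1
    refine Finset.sum_congr rfl fun δ _ => ?_
    rw [smul_comm γ, smul_smul, smul_smul, mul_comm]
  have hsum : ∀ u, ∑ ω, p ω u = u := by
    intro u
    simp only [hp]
    rw [← Finset.smul_sum, inv_smul_eq_iff₀ hm0, Finset.sum_comm]
    simp only [← Finset.sum_smul]
    rw [Finset.sum_eq_single 1]
    · simp [hm]
    · intro δ _ hδ
      rw [sum_coset_apply_eq_zero a ha ((isotropy Γ x).inv_mem δ.2)
        (fun h => hδ (Subtype.ext (inv_eq_one.mp h))), zero_smul]
    · simp
  have hlie : ∀ ω (l : fixedAt Γ 𝔤 x) u, p ω ⁅l, u⁆ = ⁅l, p ω u⁆ := by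
    intro ω l u
    rw [hp, hp, lie_smul, lie_sum]
    congr 1
    refine Finset.sum_congr rfl fun δ _ => ?_
    rw [lie_smul, LieSubalgebra.coe_bracket_of_module, LieSubalgebra.coe_bracket_of_module,
      IsLieAction.smul_lie', l.2 δ δ.2]
  refine ⟨fun ω =>
    { (p ω).codRestrict (cosetSpace Γ 𝔤 x ω).toSubmodule fun u =>
        (mem_cosetSpace_iff a ha).mpr fun γ hγ => hp2 ω γ hγ u with
      map_lie' := fun {l u} => Subtype.ext (hlie ω l u) }, hsum, fun ω u hu ω' hω => ?_,
    fun ω γ hγ u => Subtype.ext (hp1 ω γ hγ u)⟩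
  obtain ⟨γ, hγ, hne⟩ : ∃ γ ∈ isotropy Γ x, a ω' γ ≠ a ω γ := by
    by_contra! h
    refine hω ?_
    rw [← ha ω', ← ha ω]
    refine QuotientGroup.eq.mpr fun γ hγ => ?_
    simp [h γ hγ]
  have h1 := hp1 ω' γ hγ u
  rw [(mem_cosetSpace_iff a ha).mp hu γ hγ, map_smul, ← sub_eq_zero, ← sub_smul] at h1
  exact Subtype.ext ((smul_eq_zero.mp h1).resolve_left fun h0 =>
    hne (Units.ext (sub_eq_zero.mp h0).symm))

omit ha in
variable (𝔤 M) in
lemma exists_restriction_to_components :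
    ∃ R : localHoms Γ 𝔤 x e M →ₗ[k] (∀ ω : (Γ →* kˣ) ⧸ charSubgroup Γ x,
      cotangentComponent Γ x (a ω)⁻¹ →ₗ[k] (cosetSpace Γ 𝔤 x ω →ₗ⁅k, fixedAt Γ 𝔤 x⁆ M)),
      ∀ G ω (c : cotangentComponent Γ x (a ω)⁻¹) (u : cosetSpace Γ 𝔤 x ω),
        R G ω c u = G.1 c u :=
  ⟨{  toFun := fun G ω =>
        { toFun := fun c => (G.1 c).comp (cosetSpace Γ 𝔤 x ω).incl
          map_add' := fun c d => by rw [Submodule.coe_add, map_add]; rfl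
          map_smul' := fun b c => by rw [Submodule.coe_smul, map_smul]; rfl }
      map_add' := fun G H => rfl
      map_smul' := fun b G => rfl }, fun G ω c u => rfl⟩

variable (𝔤 M) in
-- The map is restriction to the pairs `(I/I²)_{-a_ω}`, `𝔤_ω`. It is injective since on `𝔤_ω` a
-- local map sees `c` only through the projection `P ω c`; the inverse is `∑ F ω (P ω c) (pr ω u)`.
theorem nonempty_localHoms_equiv (he : IsSeparating Γ x e) :
    Nonempty (localHoms Γ 𝔤 x e M ≃ₗ[k] (∀ ω : (Γ →* kˣ) ⧸ charSubgroup Γ x,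
      cotangentComponent Γ x (a ω)⁻¹ →ₗ[k] (cosetSpace Γ 𝔤 x ω →ₗ⁅k, fixedAt Γ 𝔤 x⁆ M))) := by
  classical
  have := Fintype.ofFinite ((Γ →* kˣ) ⧸ charSubgroup Γ x)
  obtain ⟨R, hR⟩ := exists_restriction_to_components 𝔤 M (e := e) a
  obtain ⟨pr, hpr, hpr0, hprγ⟩ := exists_cosetSpace_projection (𝔤 := 𝔤) a ha
  choose P hP hPe hPγ hPdef using fun ω => exists_cotangent_projection he (a ω)
  refine ⟨LinearEquiv.ofBijective R
    ⟨(injective_iff_map_eq_zero _).mpr fun G hG => ?_, fun F => ?_⟩⟩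
  · refine Subtype.ext (LinearMap.ext fun c => LieModuleHom.ext fun u => ?_)
    rw [← hpr u, map_sum]
    refine Finset.sum_eq_zero fun ω _ => ?_
    rw [← localHoms_apply_projection he (a ω) G (hPdef ω c)
      ((mem_cosetSpace_iff a ha).mp (pr ω u).2), ← hR, hG]
    rfl
  · obtain ⟨G, hG⟩ : ∃ G : (orbitIdeal Γ x).Cotangent →ₗ[k] (𝔤 →ₗ⁅k, fixedAt Γ 𝔤 x⁆ M),
        ∀ c u, G c u = ∑ ω, F ω (P ω c) (pr ω u) := by
      refine ⟨{ toFun := fun c =>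
                  { toFun := fun u => ∑ ω, F ω (P ω c) (pr ω u)
                    map_add' := fun u v => ?_
                    map_smul' := fun b u => ?_
                    map_lie' := fun {l u} => ?_ }
                map_add' := fun c d => LieModuleHom.ext fun u => ?_
                map_smul' := fun b c => LieModuleHom.ext fun u => ?_ }, fun c u => rfl⟩
      · simp only [map_add, Finset.sum_add_distrib]
      · simp only [map_smul, Finset.smul_sum, RingHom.id_apply]
      · change ∑ ω, F ω (P ω c) (pr ω ⁅l, u⁆) = ⁅l, ∑ ω, F ω (P ω c) (pr ω u)⁆
        rw [lie_sum]
        refine Finset.sum_congr rfl fun ω _ => ?_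
        rw [LieModuleHom.map_lie, LieModuleHom.map_lie]
      · change ∑ ω, F ω (P ω (c + d)) (pr ω u) =
          ∑ ω, F ω (P ω c) (pr ω u) + ∑ ω, F ω (P ω d) (pr ω u)
        rw [← Finset.sum_add_distrib]
        refine Finset.sum_congr rfl fun ω _ => ?_
        rw [map_add, map_add]
        rfl
      · change ∑ ω, F ω (P ω (b • c)) (pr ω u) = b • ∑ ω, F ω (P ω c) (pr ω u)
        rw [Finset.smul_sum]
        refine Finset.sum_congr rfl fun ω _ => ?_
        rw [map_smul, map_smul]
        rfl
    have hGmem : G ∈ localHoms Γ 𝔤 x e M := by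
      refine ⟨fun c => LieModuleHom.ext fun u => ?_, fun γ hγ c u => ?_⟩
      · rw [hG, hG]
        simp only [hPe]
      · rw [hG, hG]
        refine Finset.sum_congr rfl fun ω _ => ?_
        -- `γ` scales `P ω` by the inverse of the factor by which it scales `pr ω`.
        rw [hPγ ω γ hγ, hprγ ω γ hγ, map_smul, map_smul, LieModuleHom.smul_apply, smul_smul]
        simp
    refine ⟨⟨G, hGmem⟩, ?_⟩
    refine funext fun ω => LinearMap.ext fun c => LieModuleHom.ext fun u => ?_
    rw [hR]
    refine (hG c u).trans ?_
    rw [Finset.sum_eq_single ω]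
    · have h : (pr ω u : 𝔤) = u := by
        conv_rhs => rw [← hpr u]
        rw [Finset.sum_eq_single ω]
        · intro ω' _ h
          rw [hpr0 ω u u.2 ω' h]
          rfl
        · simp
      rw [hP, show pr ω u = u from Subtype.ext h]
    · intro ω' _ h
      rw [hpr0 ω u u.2 ω' h, map_zero]
    · simp

end Characters

/-! ### Assembly for semisimple `𝔤^x` -/

section MainSemisimple

lemma nonempty_homs_equiv_tensor {k C N : Type*} [Field k] [AddCommGroup C] [Module k C]
    [Module.Finite k C] [AddCommGroup N] [Module k N] :
    Nonempty ((C →ₗ[k] N) ≃ₗ[k] N ⊗[k] Module.Dual k C) :=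
  ⟨(dualTensorHomEquiv (R := k) (M := C) (N := N)).symm ≪≫ₗ TensorProduct.comm k _ _⟩

variable {k : Type u} [Field k] [IsAlgClosed k] [CharZero k] {Γ : Type*} [CommGroup Γ] [Finite Γ]
  {A : Type u} [CommRing A] [Algebra k A] [Algebra.FiniteType k A]
  [MulSemiringAction Γ A] [SMulCommClass Γ k A]
  {𝔤 : Type u} [LieRing 𝔤] [LieAlgebra k 𝔤] [Module.Finite k 𝔤]
  [DistribMulAction Γ 𝔤] [SMulCommClass Γ k 𝔤] [IsLieAction Γ 𝔤] (x : A →ₐ[k] k)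

theorem nonempty_ext1_evalRep_equiv [LieAlgebra.IsKilling k (fixedAt Γ 𝔤 x)]
    {V₁ V₂ M : Type u} [AddCommGroup V₁] [Module k V₁]
    [LieRingModule (fixedAt Γ 𝔤 x) V₁] [LieModule k (fixedAt Γ 𝔤 x) V₁]
    [AddCommGroup V₂] [Module k V₂]
    [LieRingModule (fixedAt Γ 𝔤 x) V₂] [LieModule k (fixedAt Γ 𝔤 x) V₂]
    [AddCommGroup M] [Module k M] [Module.Finite k M]
    [LieRingModule (fixedAt Γ 𝔤 x) M] [LieModule k (fixedAt Γ 𝔤 x) M]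
    (f : M ≃ₗ[k] (V₁ →ₗ[k] V₂))
    (hf : ∀ (l : fixedAt Γ 𝔤 x) (m : M) (v : V₁), f ⁅l, m⁆ v = ⁅l, f m v⁆ - f m ⁅l, v⁆)
    (a : (Γ →* kˣ) ⧸ charSubgroup Γ x → (Γ →* kˣ))
    (ha : ∀ ω, (QuotientGroup.mk (a ω) : (Γ →* kˣ) ⧸ charSubgroup Γ x) = ω) :
    Nonempty (Ext1 (evalRep Γ 𝔤 x V₁) (evalRep Γ 𝔤 x V₂) ≃ₗ[k]
      (QModK' Γ 𝔤 x →ₗ⁅k, fixedAt Γ 𝔤 x⁆ M) ×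
        ⨁ ω : (Γ →* kˣ) ⧸ charSubgroup Γ x,
          (cosetSpace Γ 𝔤 x ω →ₗ⁅k, fixedAt Γ 𝔤 x⁆ M) ⊗[k]
            Module.Dual k (cotangentComponent Γ x (a ω)⁻¹)) := by
  classical
  have := finite_orbit_cotangent (Γ := Γ) x
  have := Fintype.ofFinite ((Γ →* kˣ) ⧸ charSubgroup Γ x)
  obtain ⟨e, he⟩ := exists_isSeparating Γ x
  obtain ⟨e₁⟩ := nonempty_ext1_equiv_kerHoms (ev_surjective 𝔤 x) f hf
  obtain ⟨e₂⟩ := nonempty_kerHoms_equiv (𝔤 := 𝔤) (Γ := Γ) x M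
  obtain ⟨e₃⟩ := nonempty_kerHomsMod_equiv 𝔤 M he
  obtain ⟨e₄⟩ := nonempty_localHoms_equiv 𝔤 M a ha he
  have e₅ := fun ω : (Γ →* kˣ) ⧸ charSubgroup Γ x =>
    (nonempty_homs_equiv_tensor (k := k) (C := cotangentComponent Γ x (a ω)⁻¹)
      (N := cosetSpace Γ 𝔤 x ω →ₗ⁅k, fixedAt Γ 𝔤 x⁆ M)).some
  exact ⟨e₁ ≪≫ₗ e₂ ≪≫ₗ (LinearEquiv.refl k _).prodCongr
    (e₃ ≪≫ₗ e₄ ≪≫ₗ LinearEquiv.piCongrRight e₅ ≪≫ₗ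
      (DirectSum.linearEquivFunOnFintype k _ _).symm)⟩

end MainSemisimple

end EquivMap

/-! ### Free actions -/

namespace EquivMap

/-! ### Separating the diagonal from the graphs of a free action -/

section Nullstellensatz

variable {k : Type u} [Field k] [IsAlgClosed k]
  {A : Type u} [CommRing A] [Algebra k A] [Algebra.FiniteType k A]

/-- A proper ideal of a finitely generated algebra vanishes at some rational point. -/
lemma exists_point_of_ne_top {J : Ideal A} (hJ : J ≠ ⊤) : ∃ y : A →ₐ[k] k, ∀ a ∈ J, y a = 0 := by
  obtain ⟨n, hn, hle⟩ := Ideal.exists_le_maximal J hJ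
  let _ : Field (A ⧸ n) := Ideal.Quotient.field n
  have hfin : Module.Finite k (A ⧸ n) := finite_of_finite_type_of_isJacobsonRing k (A ⧸ n)
  have hbij : Function.Bijective (algebraMap k (A ⧸ n)) :=
    IsAlgClosed.algebraMap_bijective_of_isIntegral
  let f := AlgEquiv.ofBijective (Algebra.ofId k (A ⧸ n)) hbij
  refine ⟨(f.symm : (A ⧸ n) →ₐ[k] k).comp (Ideal.Quotient.mkₐ k n), fun a ha => ?_⟩
  have h : Ideal.Quotient.mkₐ k n a = 0 := Ideal.Quotient.eq_zero_iff_mem.mpr (hle ha)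
  rw [AlgHom.comp_apply, h, map_zero]

variable {Γ : Type*} [CommGroup Γ] [MulSemiringAction Γ A] [SMulCommClass Γ k A]

variable (k A) in
/-- The map `a ⊗ b ↦ a γ(b)`. -/
noncomputable def twistedMul (γ : Γ) : A ⊗[k] A →ₐ[k] A :=
  Algebra.TensorProduct.productMap (AlgHom.id k A) (MulSemiringAction.toAlgHom k A γ)

omit [IsAlgClosed k] [Algebra.FiniteType k A] in
lemma twistedMul_tmul (γ : Γ) (a b : A) : twistedMul k A γ (a ⊗ₜ b) = a * γ • b := rfl

/-- The diagonal and the graph of `γ` do not meet: the image ideal contains all `a - γ • a`, so a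
common zero would be a rational point fixed by `γ`. By the Nullstellensatz the ideal is the unit
ideal. -/
lemma exists_separating_tensor_of_ne_one (hfree : ActsFreely k Γ A) {γ : Γ} (hγ : γ ≠ 1) :
    ∃ t : A ⊗[k] A, twistedMul k A (1 : Γ) t = 1 ∧ twistedMul k A γ t = 0 := by
  have hsurj : Function.Surjective (twistedMul k A (1 : Γ)) := fun a =>
    ⟨a ⊗ₜ 1, by rw [twistedMul_tmul, smul_one, mul_one]⟩
  have htop : Ideal.map (twistedMul k A (1 : Γ)) (RingHom.ker (twistedMul k A γ)) = ⊤ := by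
    by_contra h
    obtain ⟨y, hy⟩ := exists_point_of_ne_top (k := k) h
    refine hγ ?_
    have h1 : γ⁻¹ ∈ isotropy Γ y := by
      refine AlgHom.ext fun a => ?_
      rw [translate_apply, inv_inv]
      have h2 : (1 : A) ⊗ₜ[k] a - (γ • a) ⊗ₜ[k] (1 : A) ∈ RingHom.ker (twistedMul k A γ) := by
        rw [RingHom.mem_ker, map_sub, twistedMul_tmul, twistedMul_tmul, smul_one, one_mul,
          mul_one, sub_self]
      have h3 := hy _ (Ideal.mem_map_of_mem (twistedMul k A (1 : Γ)) h2)
      rw [map_sub, twistedMul_tmul, twistedMul_tmul, one_smul, one_smul, one_mul, mul_one,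
        map_sub, sub_eq_zero] at h3
      exact h3.symm
    rw [hfree y, Subgroup.mem_bot, inv_eq_one] at h1
    exact h1
  obtain ⟨t, ht, ht1⟩ := (Ideal.mem_map_iff_of_surjective _ hsurj).mp
    (htop ▸ Submodule.mem_top : (1 : A) ∈ _)
  exact ⟨t, ht1, ht⟩

lemma exists_separating_tensor [Finite Γ] (hfree : ActsFreely k Γ A) :
    ∃ t : A ⊗[k] A, twistedMul k A (1 : Γ) t = 1 ∧ ∀ γ : Γ, γ ≠ 1 → twistedMul k A γ t = 0 := by
  classical
  have := Fintype.ofFinite Γ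
  suffices h : ∀ s : Finset Γ, ∃ t : A ⊗[k] A, twistedMul k A (1 : Γ) t = 1 ∧
      ∀ γ ∈ s, γ ≠ 1 → twistedMul k A γ t = 0 by
    obtain ⟨t, ht1, ht⟩ := h Finset.univ
    exact ⟨t, ht1, fun γ => ht γ (Finset.mem_univ γ)⟩
  intro s
  induction s using Finset.induction_on with
  | empty => exact ⟨1, map_one _, by simp⟩
  | insert δ s _ ih =>
    obtain ⟨t, ht1, ht⟩ := ih
    by_cases hδ : δ = 1
    · refine ⟨t, ht1, fun γ hγ hγ1 => ht γ ?_ hγ1⟩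
      exact (Finset.mem_insert.mp hγ).resolve_left fun h => hγ1 (h.trans hδ)
    · obtain ⟨r, hr1, hr⟩ := exists_separating_tensor_of_ne_one (A := A) hfree hδ
      refine ⟨r * t, by rw [map_mul, hr1, ht1, one_mul], fun γ hγ hγ1 => ?_⟩
      rw [map_mul]
      rcases Finset.mem_insert.mp hγ with rfl | hγ
      · rw [hr, zero_mul]
      · rw [ht γ hγ hγ1, mul_zero]

end Nullstellensatz

/-! ### The equality of `𝔔_x` and `𝔎_x'`, and the extensions for a free action -/

section Free

variable {k : Type u} [Field k] [CharZero k] {Γ : Type*} [CommGroup Γ]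
  {A : Type u} [CommRing A] [Algebra k A] [MulSemiringAction Γ A] [SMulCommClass Γ k A]
  {𝔤 : Type u} [LieRing 𝔤] [LieAlgebra k 𝔤]
  [DistribMulAction Γ 𝔤] [SMulCommClass Γ k 𝔤] [IsLieAction Γ 𝔤] (x : A →ₐ[k] k)

/-- For `t = p ⊗ q` this is the bracket of the averages of `a p ⊗ v` and `b q ⊗ w`, two elements of
`𝔎_x`; the expression is linear in `t`. -/
lemma mem_idealK'_av_sum [Fintype Γ] {a b : A} (ha : a ∈ orbitIdeal Γ x) (hb : b ∈ orbitIdeal Γ x)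
    (v w : 𝔤) (t : A ⊗[k] A) :
    av k Γ A 𝔤 (∑ γ : Γ, (γ • a * b * γ • twistedMul k A γ⁻¹ t) ⊗ₜ ⁅γ • v, w⁆) ∈
      idealK' Γ 𝔤 x := by
  induction t using TensorProduct.induction_on with
  | zero => simp
  | add s t hs ht =>
    have := add_mem hs ht
    rw [← map_add, ← Finset.sum_add_distrib] at this
    simpa only [map_add, smul_add, mul_add, TensorProduct.add_tmul] using this
  | tmul p q =>
    have h1 : av k Γ A 𝔤 ((a * p) ⊗ₜ v) ∈ idealK Γ 𝔤 x := LieHom.mem_ker.mpr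
      (ev_av x (tmul_mem_tensorIdeal (Ideal.mul_mem_right _ _ ha) v))
    have h2 : av k Γ A 𝔤 ((b * q) ⊗ₜ w) ∈ idealK Γ 𝔤 x := LieHom.mem_ker.mpr
      (ev_av x (tmul_mem_tensorIdeal (Ideal.mul_mem_right _ _ hb) w))
    have h3 : ⁅av k Γ A 𝔤 ((a * p) ⊗ₜ v), av k Γ A 𝔤 ((b * q) ⊗ₜ w)⁆ ∈ idealK' Γ 𝔤 x :=
      LieSubmodule.lie_mem_lie (I := idealK Γ 𝔤 x) (N := idealK Γ 𝔤 x) h1 h2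
    rw [lie_av, coe_av, sum_lie] at h3
    convert h3 using 3 with γ
    rw [diag_tmul, LieAlgebra.ExtendScalars.bracket_tmul, twistedMul_tmul, smul_mul', smul_mul',
      smul_inv_smul]
    congr 1
    ring

/-- With a separating tensor only the term `γ = 1` survives in `mem_idealK'_av_sum`, so the average
of `ab ⊗ [v, w]` lies in `𝔎_x'`. Since `𝔤` is perfect and averaging is `|Γ|` on invariants, this
covers `𝔔_x`. -/
lemma idealQ_le_idealK' [IsAlgClosed k] [Finite Γ] [Module.Finite k 𝔤] [LieAlgebra.IsKilling k 𝔤]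
    [Algebra.FiniteType k A]
    (hfree : ActsFreely k Γ A) : idealQ Γ 𝔤 x ≤ idealK' Γ 𝔤 x := by
  have := Fintype.ofFinite Γ
  obtain ⟨t, ht1, ht0⟩ := exists_separating_tensor (A := A) hfree
  have h1 : ∀ a ∈ orbitIdeal Γ x, ∀ b ∈ orbitIdeal Γ x, ∀ v w : 𝔤,
      av k Γ A 𝔤 ((a * b) ⊗ₜ ⁅v, w⁆) ∈ idealK' Γ 𝔤 x := by
    intro a ha b hb v w
    have h := mem_idealK'_av_sum x ha hb v w t
    rw [Finset.sum_eq_single 1] at h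
    · simpa [ht1] using h
    · intro γ _ hγ
      rw [ht0 _ (inv_ne_one.mpr hγ), smul_zero, mul_zero, TensorProduct.zero_tmul]
    · simp
  have h2 : ∀ a ∈ orbitIdeal Γ x, ∀ b ∈ orbitIdeal Γ x, ∀ u : 𝔤,
      av k Γ A 𝔤 ((a * b) ⊗ₜ u) ∈ idealK' Γ 𝔤 x := by
    intro a ha b hb u
    have hu : u ∈ (⁅(⊤ : LieIdeal k 𝔤), (⊤ : LieIdeal k 𝔤)⁆ : LieIdeal k 𝔤) := by
      rw [LieAlgebra.lie_self_of_isKilling]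
      trivial
    rw [← LieSubmodule.mem_toSubmodule, LieSubmodule.lieIdeal_oper_eq_linear_span] at hu
    induction hu using Submodule.span_induction with
    | mem y hy =>
      obtain ⟨v, w, rfl⟩ := hy
      exact h1 a ha b hb v w
    | zero => simp
    | add u v _ _ hu hv =>
      rw [TensorProduct.tmul_add, map_add]
      exact add_mem hu hv
    | smul c u _ hu =>
      rw [TensorProduct.tmul_smul, map_smul]
      exact (idealK' Γ 𝔤 x).smul_mem c hu
  have h3 : ∀ t ∈ tensorIdeal k 𝔤 (orbitIdeal Γ x ^ 2), av k Γ A 𝔤 t ∈ idealK' Γ 𝔤 x := by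
    intro t ht
    refine tensorIdeal_le (S := (idealK' Γ 𝔤 x).toSubmodule.comap (av k Γ A 𝔤))
      (fun a ha u => ?_) ht
    rw [sq] at ha
    change av k Γ A 𝔤 (a ⊗ₜ u) ∈ idealK' Γ 𝔤 x
    induction ha using Submodule.mul_induction_on' with
    | mem_mul_mem a ha b hb => exact h2 a ha b hb u
    | add a _ b _ ha hb =>
      rw [TensorProduct.add_tmul, map_add]
      exact add_mem ha hb
  intro α hα
  have hΓ : (Fintype.card Γ : k) ≠ 0 := by exact_mod_cast Fintype.card_ne_zero
  have h4 := h3 _ ((mem_idealQ 𝔤 x α).mp hα)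
  rw [av_coe] at h4
  exact (Submodule.smul_mem_iff (idealK' Γ 𝔤 x).toSubmodule hΓ).mp h4

lemma subsingleton_QModK' [IsAlgClosed k] [Finite Γ] [Module.Finite k 𝔤]
    [LieAlgebra.IsKilling k 𝔤] [Algebra.FiniteType k A] (hfree : ActsFreely k Γ A) :
    Subsingleton (QModK' Γ 𝔤 x) := by
  refine subsingleton_of_forall_eq 0 fun q => ?_
  obtain ⟨q, rfl⟩ := LieSubmodule.Quotient.surjective_mk' _ q
  exact (LieSubmodule.Quotient.mk_eq_zero _).mpr (idealQ_le_idealK' x hfree q.2)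

variable {x}

omit [CharZero k] in
lemma fixedAt_eq_top (hx : isotropy Γ x = ⊥) : fixedAt Γ 𝔤 x = ⊤ := by
  refine eq_top_iff.mpr fun u _ γ hγ => ?_
  rw [hx, Subgroup.mem_bot] at hγ
  rw [hγ, one_smul]

/-- The cotangent space at `x`, seen inside `I/I²`. -/
lemma exists_cotangent_inclusion {e : A} (he : IsSeparating Γ x e) (hx : isotropy Γ x = ⊥) :
    ∃ (i : (orbitIdeal Γ x).Cotangent →ₗ[k] (RingHom.ker x).Cotangent)
      (j : (RingHom.ker x).Cotangent →ₗ[k] (orbitIdeal Γ x).Cotangent),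
      (∀ m, i (j m) = m) ∧ (∀ c, j (i c) = e • c) ∧ ∀ c, i (e • c) = i c := by
  have he1 : x e = 1 := by
    have := he.apply_smul_of_mem 1 (one_mem _)
    rwa [one_smul] at this
  have hle : orbitIdeal Γ x ≤ RingHom.ker x := fun a ha => by
    have := (mem_orbitIdeal x a).mp ha 1
    rwa [inv_one, one_smul] at this
  have hmem : ∀ b ∈ RingHom.ker x, e * b ∈ orbitIdeal Γ x := fun b hb => by
    rw [mem_orbitIdeal]
    intro γ
    rw [smul_mul', map_mul]
    by_cases h : γ⁻¹ ∈ isotropy Γ x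
    · rw [hx, Subgroup.mem_bot] at h
      rw [h, one_smul, one_smul, RingHom.mem_ker.mp hb, mul_zero]
    · rw [he.apply_smul_of_notMem _ h, zero_mul]
  have hsub : e - 1 ∈ RingHom.ker x := by
    rw [RingHom.mem_ker, map_sub, he1, map_one, sub_self]
  let i : (orbitIdeal Γ x).Cotangent →ₗ[k] (RingHom.ker x).Cotangent :=
    Ideal.mapCotangent _ _ (AlgHom.id k A) hle
  have hi : ∀ b : orbitIdeal Γ x, i ((orbitIdeal Γ x).toCotangent b) =
    (RingHom.ker x).toCotangent ⟨b, hle b.2⟩ := fun b => rfl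
  have hker : ∀ (b : RingHom.ker x), e • (RingHom.ker x).toCotangent b =
      (RingHom.ker x).toCotangent b := fun b => by
    rw [← sub_eq_zero, ← one_smul A ((RingHom.ker x).toCotangent b), smul_smul, mul_one,
      ← sub_smul]
    exact Ideal.Cotangent.smul_eq_zero_of_mem hsub _
  let f : RingHom.ker x →ₗ[A] orbitIdeal Γ x :=
    { toFun := fun b => ⟨e * b, hmem b b.2⟩
      map_add' := fun b c => Subtype.ext (mul_add e (b : A) c)
      map_smul' := fun a b => Subtype.ext (mul_left_comm e a (b : A)) }
  have hf : ∀ b, (f b : A) = e * b := fun b => rfl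
  -- The second factor `e` turns the image of `b * c` into `(e b)(e c)`, which lies in `I²`, so the
  -- map descends to the quotient.
  let j₀ : (RingHom.ker x).Cotangent →ₗ[A] (orbitIdeal Γ x).Cotangent :=
    Ideal.Cotangent.lift (e • ((orbitIdeal Γ x).toCotangent ∘ₗ f)) (fun b c => by
      rw [LinearMap.smul_apply, LinearMap.comp_apply, ← map_smul, Ideal.toCotangent_eq_zero, sq]
      rw [show ((e • f (b * c) : orbitIdeal Γ x) : A) = (e * b) * (e * c) by
        change e * (e * ((b : A) * c)) = _
        ring]
      exact Ideal.mul_mem_mul (hmem b b.2) (hmem c c.2))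
  have hj : ∀ b, j₀ ((RingHom.ker x).toCotangent b) = e • (orbitIdeal Γ x).toCotangent (f b) :=
    fun b => rfl
  refine ⟨i, j₀.restrictScalars k, fun m => ?_, fun c => ?_, fun c => ?_⟩
  · obtain ⟨b, rfl⟩ := (RingHom.ker x).toCotangent_surjective m
    rw [LinearMap.restrictScalars_apply, hj, ← map_smul, hi]
    have : (⟨((e • f b : orbitIdeal Γ x) : A), hle (e • f b).2⟩ : RingHom.ker x) = e • e • b := rfl
    rw [this, map_smul, map_smul, hker, hker]
  · obtain ⟨b, rfl⟩ := (orbitIdeal Γ x).toCotangent_surjective c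
    rw [hi, LinearMap.restrictScalars_apply, hj]
    have : f ⟨b, hle b.2⟩ = e • b := rfl
    rw [this, map_smul, he.smul_smul_self]
  · obtain ⟨b, rfl⟩ := (orbitIdeal Γ x).toCotangent_surjective c
    rw [← map_smul, hi, hi]
    have : (⟨((e • b : orbitIdeal Γ x) : A), hle (e • b).2⟩ : RingHom.ker x) = e • ⟨b, hle b.2⟩ :=
      rfl
    rw [this, map_smul, hker]

variable (𝔤) in
-- With trivial isotropy the equivariance condition is empty, and invariance under `e` says that the
-- map factors through `𝔪_x/𝔪_x²`.
lemma nonempty_localHoms_equiv_of_isotropy_eq_bot (M : Type u) [AddCommGroup M] [Module k M]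
    [LieRingModule (fixedAt Γ 𝔤 x) M] [LieModule k (fixedAt Γ 𝔤 x) M]
    {e : A} (he : IsSeparating Γ x e) (hx : isotropy Γ x = ⊥) :
    Nonempty (localHoms Γ 𝔤 x e M ≃ₗ[k]
      ((RingHom.ker x).Cotangent →ₗ[k] (𝔤 →ₗ⁅k, fixedAt Γ 𝔤 x⁆ M))) := by
  obtain ⟨i, j, hij, hji, hi⟩ := exists_cotangent_inclusion he hx
  have hact : ∀ c, cotangentAct x (1 : Γ) c = c := fun c => by
    obtain ⟨b, rfl⟩ := (orbitIdeal Γ x).toCotangent_surjective c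
    rw [cotangentAct_mk]
    congr 1
    exact Subtype.ext (one_smul Γ (b : A))
  refine ⟨LinearEquiv.ofLinearMap
    (LinearMap.lcomp k _ j ∘ₗ (localHoms Γ 𝔤 x e M).subtype)
    ((LinearMap.lcomp k _ i).codRestrict _ fun T => ⟨fun c => ?_, fun γ hγ c u => ?_⟩)
    (LinearMap.ext fun T => LinearMap.ext fun m => ?_)
    (LinearMap.ext fun G => Subtype.ext (LinearMap.ext fun c => ?_))⟩
  · rw [LinearMap.lcomp_apply, LinearMap.lcomp_apply, hi]
  · rw [hx, Subgroup.mem_bot] at hγ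
    rw [hγ, hact, one_smul]
  · change T (i (j m)) = T m
    rw [hij]
  · change G.1 (j (i c)) = G.1 c
    rw [hji, G.2.1]

variable [LieAlgebra.IsKilling k 𝔤]

omit [CharZero k] in
lemma isKilling_fixedAt (hx : isotropy Γ x = ⊥) : LieAlgebra.IsKilling k (fixedAt Γ 𝔤 x) := by
  rw [fixedAt_eq_top hx]
  exact LieAlgebra.isKilling_of_equiv (R := k) (LieSubalgebra.topEquiv (R := k) (L := 𝔤)).symm

variable (𝔤) in
/-- Over a point with trivial isotropy, all of `𝔤` acts. -/
def lieModuleHomEquiv (M : Type u) [AddCommGroup M] [Module k M]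
    [LieRingModule 𝔤 M] [LieModule k 𝔤 M] (hx : isotropy Γ x = ⊥) :
    (𝔤 →ₗ⁅k, fixedAt Γ 𝔤 x⁆ M) ≃ₗ[k] (𝔤 →ₗ⁅k, 𝔤⁆ M) where
  toFun T :=
    { (T : 𝔤 →ₗ[k] M) with
      map_lie' := fun {u v} => T.map_lie (⟨u, by rw [fixedAt_eq_top hx]; trivial⟩ :
        fixedAt Γ 𝔤 x) v }
  invFun T :=
    { (T : 𝔤 →ₗ[k] M) with
      map_lie' := fun {u v} => T.map_lie (u : 𝔤) v }
  map_add' _ _ := rfl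
  map_smul' _ _ := rfl
  left_inv _ := rfl
  right_inv _ := rfl

variable (x) in
-- The summand coming from `𝔔_x / 𝔎_x'` vanishes, and the local maps live on `𝔪_x/𝔪_x²` without any
-- use of characters.
theorem nonempty_ext1_evalRepFull_equiv [IsAlgClosed k] [Finite Γ] [Module.Finite k 𝔤]
    [Algebra.FiniteType k A] (hfree : ActsFreely k Γ A)
    {V₁ V₂ M : Type u} [AddCommGroup V₁] [Module k V₁] [LieRingModule 𝔤 V₁] [LieModule k 𝔤 V₁]
    [AddCommGroup V₂] [Module k V₂] [LieRingModule 𝔤 V₂] [LieModule k 𝔤 V₂]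
    [AddCommGroup M] [Module k M] [Module.Finite k M] [LieRingModule 𝔤 M] [LieModule k 𝔤 M]
    (f : M ≃ₗ[k] (V₁ →ₗ[k] V₂))
    (hf : ∀ (l : 𝔤) (m : M) (v : V₁), f ⁅l, m⁆ v = ⁅l, f m v⁆ - f m ⁅l, v⁆) :
    Nonempty (Ext1 (evalRepFull Γ 𝔤 x V₁) (evalRepFull Γ 𝔤 x V₂) ≃ₗ[k]
      (𝔤 →ₗ⁅k, 𝔤⁆ M) ⊗[k] Module.Dual k (RingHom.ker x).Cotangent) := by
  have hx := hfree x
  have := isKilling_fixedAt (𝔤 := 𝔤) hx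
  have := subsingleton_QModK' (𝔤 := 𝔤) x hfree
  have : IsNoetherianRing A := Algebra.FiniteType.isNoetherianRing k A
  have : Module.Finite k (RingHom.ker x).Cotangent := finite_cotangent _ x.toLinearMap fun _ h => h
  obtain ⟨e, he⟩ := exists_isSeparating Γ x
  obtain ⟨e₁⟩ := nonempty_ext1_equiv_kerHoms (ev_surjective (Γ := Γ) 𝔤 x) f
    (fun l m v => hf (l : 𝔤) m v)
  obtain ⟨e₂⟩ := nonempty_kerHoms_equiv (𝔤 := 𝔤) (Γ := Γ) x M
  obtain ⟨e₃⟩ := nonempty_kerHomsMod_equiv 𝔤 M he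
  obtain ⟨e₄⟩ := nonempty_localHoms_equiv_of_isotropy_eq_bot 𝔤 M he hx
  obtain ⟨e₅⟩ := nonempty_homs_equiv_tensor (k := k) (C := (RingHom.ker x).Cotangent)
      (N := 𝔤 →ₗ⁅k, fixedAt Γ 𝔤 x⁆ M)
  have : Unique (QModK' Γ 𝔤 x →ₗ⁅k, fixedAt Γ 𝔤 x⁆ M) :=
    { default := 0
      uniq := fun T => LieModuleHom.ext fun q => by
        rw [Subsingleton.elim q 0, map_zero, map_zero] }
  exact ⟨e₁ ≪≫ₗ e₂ ≪≫ₗ LinearEquiv.uniqueProd ≪≫ₗ e₃ ≪≫ₗ e₄ ≪≫ₗ e₅ ≪≫ₗ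
    TensorProduct.congr (lieModuleHomEquiv 𝔤 M hx) (LinearEquiv.refl k _)⟩

end Free

end EquivMap

theorem proposition4p9
    {k : Type u} [Field k] [IsAlgClosed k] [CharZero k]
    {Γ : Type*} [CommGroup Γ] [Finite Γ]
    {A : Type u} [CommRing A] [Algebra k A] [Algebra.FiniteType k A]
    [MulSemiringAction Γ A] [SMulCommClass Γ k A]
    {𝔤 : Type u} [LieRing 𝔤] [LieAlgebra k 𝔤] [Module.Finite k 𝔤]
    -- `𝔤` is reductive
    [LieAlgebra.HasCentralRadical k 𝔤]
    [DistribMulAction Γ 𝔤] [SMulCommClass Γ k 𝔤] [EquivMap.IsLieAction Γ 𝔤]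
    (x : A →ₐ[k] k) :
    -- the case of semisimple `𝔤^x`
    (LieAlgebra.IsSemisimple k (EquivMap.fixedAt Γ 𝔤 x) →
      ∀ (V₁ V₂ : Type u) [AddCommGroup V₁] [Module k V₁] [Module.Finite k V₁]
        [LieRingModule (EquivMap.fixedAt Γ 𝔤 x) V₁] [LieModule k (EquivMap.fixedAt Γ 𝔤 x) V₁]
        [LieModule.IsIrreducible k (EquivMap.fixedAt Γ 𝔤 x) V₁]
        [AddCommGroup V₂] [Module k V₂] [Module.Finite k V₂]
        [LieRingModule (EquivMap.fixedAt Γ 𝔤 x) V₂] [LieModule k (EquivMap.fixedAt Γ 𝔤 x) V₂]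
        [LieModule.IsIrreducible k (EquivMap.fixedAt Γ 𝔤 x) V₂]
        (a : (Γ →* kˣ) ⧸ EquivMap.charSubgroup Γ x → (Γ →* kˣ))
        (_ : ∀ ω, (QuotientGroup.mk (a ω) : (Γ →* kˣ) ⧸ EquivMap.charSubgroup Γ x) = ω),
        Nonempty
          (EquivMap.Ext1 (EquivMap.evalRep Γ 𝔤 x V₁) (EquivMap.evalRep Γ 𝔤 x V₂) ≃ₗ[k]
            (EquivMap.QModK' Γ 𝔤 x
                →ₗ⁅k, EquivMap.fixedAt Γ 𝔤 x⁆ (Module.Dual k V₁ ⊗[k] V₂)) ×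
              ⨁ ω : (Γ →* kˣ) ⧸ EquivMap.charSubgroup Γ x,
                (EquivMap.cosetSpace Γ 𝔤 x ω
                  →ₗ⁅k, EquivMap.fixedAt Γ 𝔤 x⁆ (Module.Dual k V₁ ⊗[k] V₂)) ⊗[k]
                Module.Dual k (EquivMap.cotangentComponent Γ x (a ω)⁻¹))) ∧
    -- the case of a free action and semisimple `𝔤`
    (EquivMap.ActsFreely k Γ A → LieAlgebra.IsSemisimple k 𝔤 →
      ∀ (V₁ V₂ : Type u) [AddCommGroup V₁] [Module k V₁] [Module.Finite k V₁]
        [LieRingModule 𝔤 V₁] [LieModule k 𝔤 V₁]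
        [AddCommGroup V₂] [Module k V₂] [Module.Finite k V₂]
        [LieRingModule 𝔤 V₂] [LieModule k 𝔤 V₂],
        Nonempty
          (EquivMap.Ext1 (EquivMap.evalRepFull Γ 𝔤 x V₁) (EquivMap.evalRepFull Γ 𝔤 x V₂) ≃ₗ[k]
            (𝔤 →ₗ⁅k, 𝔤⁆ (Module.Dual k V₁ ⊗[k] V₂)) ⊗[k]
              Module.Dual k (RingHom.ker x).Cotangent)) := by
  constructor
  · intro hss V₁ V₂ _ _ _ _ _ _ _ _ _ _ _ _ a ha
    -- `V₁* ⊗ V₂` is `Hom(V₁, V₂)` with the commutator action. Semisimplicity enters through the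
    -- nondegeneracy of the Killing form in characteristic zero.
    have hf : ∀ (l : EquivMap.fixedAt Γ 𝔤 x) (t : Module.Dual k V₁ ⊗[k] V₂) (v : V₁),
        dualTensorHomEquiv k V₁ V₂ ⁅l, t⁆ v =
          ⁅l, dualTensorHomEquiv k V₁ V₂ t v⁆ - dualTensorHomEquiv k V₁ V₂ t ⁅l, v⁆ :=
      EquivMap.dualTensorHomEquiv_lie
    exact EquivMap.nonempty_ext1_evalRep_equiv (M := Module.Dual k V₁ ⊗[k] V₂) x
      (dualTensorHomEquiv k V₁ V₂) hf a ha
  · intro hfree hss V₁ V₂ _ _ _ _ _ _ _ _ _ _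
    have hf : ∀ (l : 𝔤) (t : Module.Dual k V₁ ⊗[k] V₂) (v : V₁),
        dualTensorHomEquiv k V₁ V₂ ⁅l, t⁆ v =
          ⁅l, dualTensorHomEquiv k V₁ V₂ t v⁆ - dualTensorHomEquiv k V₁ V₂ t ⁅l, v⁆ :=
      EquivMap.dualTensorHomEquiv_lie
    exact EquivMap.nonempty_ext1_evalRepFull_equiv (M := Module.Dual k V₁ ⊗[k] V₂) x hfree
      (dualTensorHomEquiv k V₁ V₂) hf
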